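/- Let $\mathbb K$ be a field of characteristic $0$, $R=\mathbb K[q^{\pm 1/2}]$, $p=q^{1/2}-1$ and $\mathbb K_1=R/pR$. Let $r,n\ge 0$ and $m=r+n$; the indices $1,\dots,r$ are called mutable and $r+1,\dots,m$ frozen. Let $(\Lambda,\widetilde B)$ be a compatible pair: $\Lambda\in M_m(\mathbb Z)$ is skew-symmetric, $\widetilde B\in M_{m,r}(\mathbb Z)$, and $\widetilde B^{\,t}\Lambda=(D\;\;0)$ with $D$ an $r\times r$ diagonal matrix with positive integer diagonal entries. Fix a set $J$ of frozen indices (the frozen variables that are made invertible; $J=\varnothing$ is allowed). **Quantum side.** Let $\mathcal T_qM$ be the based quantum torus: the free $R$-module on the symbols $M(c)$, $c\in\mathbb Z^m$, with the multiplication $M(c)M(d)=q^{\Lambda(c,d)/2}M(c+d)$, where $\Lambda(c,d)=c^t\Lambda d$. It is an Ore domain; let $\mathcal F$ be its skew field of fractions. The initial quantum seed consists of $\Lambda$, $\widetilde B$ and $X_i=M(e_i)$, $1\le i\le m$. For a triple $(\Lambda',\widetilde B',X')$ with $\Lambda'=(\lambda'_{ij})$, $\widetilde B'=(b_{ij})$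 and $X'=(X'_1,\dots,X'_m)$ in $\mathcal F$, put $$M'(c)=q^{\frac12\sum_{j<i}c_ic_j\lambda'_{ij}}\,X_1'^{c_1}\cdots X_m'^{c_m}.$$ The mutation at a mutable index $k$ replaces $X'_k$ by $M'(-e_k+\sum_{b_{ik}>0}b_{ik}e_i)+M'(-e_k-\sum_{b_{ik}<0}b_{ik}e_i)$ and keeps the other $X'_i$; it replaces $\Lambda'$ by $E^t\Lambda'E$, where $E$ is the identity matrix with its $k$-th column replaced by $-e_k-\sum_{b_{ik}<0}b_{ik}e_i$; and it replaces $\widetilde B'$ by its usual matrix mutation $\mu_k(\widetilde B')$. The quantum seeds are the triples obtained from the initial one by finite sequences of mutations. The quantum cluster algebra $\mathcal A_q=\mathcal A_q(\Lambda,\widetilde B)$ is the $R$-subalgebra of $\mathcal F$ generated by the elements $X'_i$, $1\le i\le m$, of all quantum seeds and by $X_j^{-1}$, $j\in J$. **Classical side.** In $\mathbb K(x_1,\dots,x_m)$, start with the seed $(\widetilde B,(x_1,\dots,x_m))$. The mutation of a seed $(\widetilde B',x')$ at a mutable index $k$ replaces $\widetilde B'=(b_{ij})$ by $\mu_k(\widetilde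 B')$ and $x'_k$ by $\bigl(\prod_{b_{ik}>0}x_i'^{\,b_{ik}}+\prod_{b_{ik}<0}x_i'^{\,-b_{ik}}\bigr)/x'_k$. The seeds are those obtained from the initial seed by finite sequences of mutations, and the elements $x'_i$, $1\le i\le m$, of all seeds are the cluster variables (frozen ones included). The cluster algebra $\mathcal A=\mathcal A(\widetilde B)$ is the $\mathbb K$-algebra generated by all cluster variables and by $x_j^{-1}$, $j\in J$. The upper cluster algebra $\mathcal U=\mathcal U(\widetilde B)$ is the intersection, over all seeds $(\widetilde B',x')$, of the rings generated over $\mathbb K$ by $x'_1,\dots,x'_m$, the inverses of the mutable $x'_k$, and the $x_j'^{-1}$ with $j\in J$. **Theorem.** Assume that 1. $\mathcal A=\mathcal U$; 2. $\mathcal A$ is a $\mathbb Z$-graded cluster algebra with finite-dimensional homogeneous components, i.e. there is a decomposition $\mathcal A=\bigoplus_{g\in\mathbb Z}\mathcal A_g$ into finite-dimensional $\mathbb K$-subspaces with $\mathcal A_g\mathcal A_h\subseteq\mathcal A_{g+h}$ such that every cluster variable lies in some $\mathcal A_g$. Then $\mathcal A_q\subseteq\mathcal T_qM$. Let $i\colon\mathcal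 A_q\to\mathcal T_qM$ be the inclusion and identify $\mathbb K_1\otimes_R\mathcal T_qM$ with $\mathbb K[x_1^{\pm1},\dots,x_m^{\pm1}]$ by the $\mathbb K$-algebra isomorphism $1\otimes M(c)\mapsto x^c$. Then $\mathbb K_1\otimes_R i$ is injective with image $\mathcal A$; that is, it induces a $\mathbb K$-algebra isomorphism $$\mathbb K_1\otimes_R\mathcal A_q(\Lambda,\widetilde B)\;\cong\;\mathcal A(\widetilde B).$$ -/

import Mathlib

open scoped TensorProduct nonZeroDivisors

namespace QuantumCluster

noncomputable section

/-! ### The based quantum torus -/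

section Torus

variable (K : Type*) [Field K] {m : ℕ}

/-- The ground ring `R = K[q^{±1/2}]`; the variable `q^{1/2}` is `LaurentPolynomial.T 1`, so that
`q^{a/2}` is `LaurentPolynomial.T a`. -/
abbrev Coeff : Type _ := LaurentPolynomial K

/-- The `R`-algebra `K_1 = R / (q^{1/2} - 1) R`. -/
abbrev CoeffOne : Type _ :=
  Coeff K ⧸ Ideal.span {(LaurentPolynomial.T 1 - 1 : Coeff K)}

/-- The bilinear form on `ℤ^m` with matrix `Λ`. -/
def form (Λ : Matrix (Fin m) (Fin m) ℤ) (c d : Fin m → ℤ) : ℤ :=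
  c ⬝ᵥ (Λ.mulVec d)

/-- The based quantum torus: the `R`-algebra which is free as an `R`-module on the symbols `X^c`,
`c ∈ ℤ^m`, with `X^c X^d = q^{Λ(c,d)/2} X^{c+d}`.
For skew-symmetric `Λ` it is the algebra generated by the `X_i^{±1}` (`X_i = X^{e_i}`)
with relations `X_i X_j = q^{λ_ij} X_j X_i`. -/
def QTorus (_Λ : Matrix (Fin m) (Fin m) ℤ) : Type _ := (Fin m → ℤ) →₀ Coeff K

variable (Λ : Matrix (Fin m) (Fin m) ℤ)

instance : AddCommGroup (QTorus K Λ) := inferInstanceAs (AddCommGroup ((Fin m → ℤ) →₀ Coeff K))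

instance : Module (Coeff K) (QTorus K Λ) :=
  inferInstanceAs (Module (Coeff K) ((Fin m → ℤ) →₀ Coeff K))

instance : Nontrivial (QTorus K Λ) := inferInstanceAs (Nontrivial ((Fin m → ℤ) →₀ Coeff K))

/-- An element of the quantum torus as its family of coefficients. -/
def toFinsupp : QTorus K Λ ≃ₗ[Coeff K] ((Fin m → ℤ) →₀ Coeff K) :=
  LinearEquiv.refl (Coeff K) ((Fin m → ℤ) →₀ Coeff K)

/-- The basis element `X^c` of the quantum torus. -/
def mono (c : Fin m → ℤ) : QTorus K Λ :=
  (toFinsupp K Λ).symm (Finsupp.single c (1 : Coeff K))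

/-- The multiplication of the quantum torus as a bilinear map. -/
def mulLin : QTorus K Λ →ₗ[Coeff K] QTorus K Λ →ₗ[Coeff K] QTorus K Λ :=
  (Finsupp.linearCombination (Coeff K) fun c =>
    (Finsupp.linearCombination (Coeff K) fun d =>
      (LaurentPolynomial.T (form Λ c d) : Coeff K) • mono K Λ (c + d)) ∘ₗ
        (toFinsupp K Λ).toLinearMap) ∘ₗ (toFinsupp K Λ).toLinearMap

instance : Mul (QTorus K Λ) := ⟨fun x y => mulLin K Λ x y⟩

instance : One (QTorus K Λ) := ⟨mono K Λ 0⟩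

variable {K Λ}

theorem mono_mul_mono (c d : Fin m → ℤ) :
    mono K Λ c * mono K Λ d =
      (LaurentPolynomial.T (form Λ c d) : Coeff K) • mono K Λ (c + d) := by
  change mulLin K Λ (mono K Λ c) (mono K Λ d) = _
  simp [mulLin, mono]

theorem form_add_left (c c' d : Fin m → ℤ) :
    form Λ (c + c') d = form Λ c d + form Λ c' d := by
  simp [form, add_dotProduct]

theorem form_add_right (c d d' : Fin m → ℤ) :
    form Λ c (d + d') = form Λ c d + form Λ c d' := by
  simp [form, Matrix.mulVec_add, dotProduct_add]

theorem torus_hom_ext {N : Type*} [AddCommMonoid N] [Module (Coeff K) N]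
    {f g : QTorus K Λ →ₗ[Coeff K] N} (h : ∀ c, f (mono K Λ c) = g (mono K Λ c)) : f = g := by
  have h' : f ∘ₗ (toFinsupp K Λ).symm.toLinearMap = g ∘ₗ (toFinsupp K Λ).symm.toLinearMap :=
    Finsupp.lhom_ext' fun c => LinearMap.ext_ring (h c)
  ext x
  simpa using congrArg (fun φ => φ (toFinsupp K Λ x)) h'

theorem torus_smul_mul (r : Coeff K) (x y : QTorus K Λ) : (r • x) * y = r • (x * y) := by
  change mulLin K Λ (r • x) y = r • mulLin K Λ x y
  rw [map_smul, LinearMap.smul_apply]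

theorem torus_mul_smul (r : Coeff K) (x y : QTorus K Λ) : x * (r • y) = r • (x * y) := by
  change mulLin K Λ x (r • y) = r • mulLin K Λ x y
  rw [map_smul]

theorem torus_mul_assoc (x y z : QTorus K Λ) : x * y * z = x * (y * z) := by
  let L : QTorus K Λ →ₗ[Coeff K] QTorus K Λ →ₗ[Coeff K] QTorus K Λ →ₗ[Coeff K] QTorus K Λ :=
    (LinearMap.compr₂ (mulLin K Λ) (mulLin K Λ))
  let L' : QTorus K Λ →ₗ[Coeff K] QTorus K Λ →ₗ[Coeff K] QTorus K Λ →ₗ[Coeff K] QTorus K Λ :=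
    LinearMap.lcomp (Coeff K) _ (mulLin K Λ) ∘ₗ
      LinearMap.llcomp (Coeff K) _ _ _ ∘ₗ (mulLin K Λ)
  have hL : L = L' := by
    refine torus_hom_ext fun a => torus_hom_ext fun b => torus_hom_ext fun c => ?_
    change mono K Λ a * mono K Λ b * mono K Λ c = mono K Λ a * (mono K Λ b * mono K Λ c)
    rw [mono_mul_mono, mono_mul_mono, torus_smul_mul, torus_mul_smul, mono_mul_mono,
      mono_mul_mono, smul_smul, smul_smul, ← LaurentPolynomial.T_add, ← LaurentPolynomial.T_add,
      form_add_left, form_add_right, add_assoc]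
    congr 2
    ring
  exact congrArg (fun f => f x y z) hL

theorem torus_one_mul (x : QTorus K Λ) : 1 * x = x := by
  have : mulLin K Λ (mono K Λ 0) = LinearMap.id := torus_hom_ext fun c => by
    change mono K Λ 0 * mono K Λ c = mono K Λ c
    rw [mono_mul_mono]
    simp [form]
  exact congrArg (fun f => f x) this

theorem torus_mul_one (x : QTorus K Λ) : x * 1 = x := by
  have : (mulLin K Λ).flip (mono K Λ 0) = LinearMap.id := torus_hom_ext fun c => by
    change mono K Λ c * mono K Λ 0 = mono K Λ c
    rw [mono_mul_mono]
    simp [form]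
  exact congrArg (fun f => f x) this

instance : Ring (QTorus K Λ) where
  __ := (inferInstance : AddCommGroup (QTorus K Λ))
  left_distrib x y z := map_add (mulLin K Λ x) y z
  right_distrib x y z := by
    change mulLin K Λ (x + y) z = mulLin K Λ x z + mulLin K Λ y z
    rw [map_add, LinearMap.add_apply]
  zero_mul x := by
    change mulLin K Λ 0 x = 0
    rw [map_zero, LinearMap.zero_apply]
  mul_zero x := map_zero (mulLin K Λ x)
  mul_assoc := torus_mul_assoc
  one_mul := torus_one_mul
  mul_one := torus_mul_one

instance : Algebra (Coeff K) (QTorus K Λ) :=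
  Algebra.ofModule torus_smul_mul torus_mul_smul

/-- The defining quasi-commutation relation `X_i X_j = q^{λ_ij} X_j X_i`
(recall that `q` is `LaurentPolynomial.T 2`). -/
theorem mono_quasi_comm (hΛ : Λ.transpose = -Λ) (i j : Fin m) :
    mono K Λ (Pi.single i 1) * mono K Λ (Pi.single j 1) =
      (LaurentPolynomial.T (2 * Λ i j) : Coeff K) •
        (mono K Λ (Pi.single j 1) * mono K Λ (Pi.single i 1)) := by
  have h : Λ j i = -Λ i j := by simpa using congrFun (congrFun hΛ i) j
  rw [mono_mul_mono, mono_mul_mono, smul_smul, ← LaurentPolynomial.T_add, add_comm (Pi.single j 1)]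
  simp only [form, Matrix.mulVec_single_one, single_one_dotProduct, Matrix.col_apply, h]
  congr 2
  ring

/-! ### The quantum torus is an Ore domain -/

/-- The coefficient of `X^c`. -/
def coeffAt (x : QTorus K Λ) (c : Fin m → ℤ) : Coeff K := toFinsupp K Λ x c

/-- The set of exponents occurring in `x`. -/
def supp (x : QTorus K Λ) : Finset (Fin m → ℤ) := (toFinsupp K Λ x).support

theorem eq_sum (x : QTorus K Λ) : x = ∑ c ∈ supp x, coeffAt x c • mono K Λ c := by
  apply (toFinsupp K Λ).injective
  rw [map_sum]
  refine (Finsupp.sum_single (toFinsupp K Λ x)).symm.trans (Finset.sum_congr rfl fun c _ => ?_)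
  simp [mono, coeffAt]

theorem coeffAt_add (x y : QTorus K Λ) (c) : coeffAt (x + y) c = coeffAt x c + coeffAt y c := by
  simp [coeffAt]

theorem coeffAt_smul (r : Coeff K) (x : QTorus K Λ) (c) : coeffAt (r • x) c = r * coeffAt x c := by
  simp [coeffAt]

theorem coeffAt_mono (a c : Fin m → ℤ) :
    coeffAt (mono K Λ a) c = if a = c then 1 else 0 := by
  simp [coeffAt, mono, Finsupp.single_apply]

theorem coeffAt_sum {ι : Type*} (s : Finset ι) (f : ι → QTorus K Λ) (c) :
    coeffAt (∑ i ∈ s, f i) c = ∑ i ∈ s, coeffAt (f i) c := by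
  simp [coeffAt, Finsupp.finsetSum_apply]

theorem coeffAt_zero (c) : coeffAt (0 : QTorus K Λ) c = 0 := by
  simp [coeffAt]

theorem torus_ext {x y : QTorus K Λ} (h : ∀ c, coeffAt x c = coeffAt y c) : x = y :=
  (toFinsupp K Λ).injective (Finsupp.ext h)

theorem mul_eq_sum (x y : QTorus K Λ) :
    x * y = ∑ a ∈ supp x, ∑ b ∈ supp y,
      (coeffAt x a * coeffAt y b * LaurentPolynomial.T (form Λ a b)) • mono K Λ (a + b) := by
  conv_lhs => rw [eq_sum x, eq_sum y]
  rw [Finset.sum_mul_sum]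
  refine Finset.sum_congr rfl fun a _ => Finset.sum_congr rfl fun b _ => ?_
  rw [torus_smul_mul, torus_mul_smul, mono_mul_mono, smul_smul, smul_smul, mul_assoc]

theorem coeffAt_mul (x y : QTorus K Λ) (c) :
    coeffAt (x * y) c = ∑ a ∈ supp x, ∑ b ∈ supp y,
      if a + b = c then coeffAt x a * coeffAt y b * LaurentPolynomial.T (form Λ a b) else 0 := by
  rw [mul_eq_sum, coeffAt_sum]
  refine Finset.sum_congr rfl fun a _ => ?_
  rw [coeffAt_sum]
  refine Finset.sum_congr rfl fun b _ => ?_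
  rw [coeffAt_smul, coeffAt_mono]
  split_ifs <;> simp

theorem mem_supp {x : QTorus K Λ} {c} : c ∈ supp x ↔ coeffAt x c ≠ 0 := Finsupp.mem_support_iff

theorem supp_nonempty {x : QTorus K Λ} (hx : x ≠ 0) : (supp x).Nonempty :=
  Finsupp.support_nonempty_iff.2 fun h => hx ((toFinsupp K Λ).map_eq_zero_iff.1 h)

instance : NoZeroDivisors (QTorus K Λ) where
  eq_zero_or_eq_zero_of_mul_eq_zero {x y} h := by
    by_contra! hxy
    obtain ⟨a, ha, b, hb, hu⟩ := UniqueSums.uniqueAdd_of_nonempty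
      (supp_nonempty hxy.1) (supp_nonempty hxy.2)
    have h0 : coeffAt (x * y) (a + b) = 0 := by rw [h, coeffAt_zero]
    rw [coeffAt_mul, Finset.sum_eq_single a, Finset.sum_eq_single b, if_pos rfl] at h0
    · rcases mul_eq_zero.1 h0 with h1 | h1
      · rcases mul_eq_zero.1 h1 with h2 | h2
        · exact mem_supp.1 ha h2
        · exact mem_supp.1 hb h2
      · exact (LaurentPolynomial.isUnit_T _).ne_zero h1
    · intro b' hb' hne
      rw [if_neg]
      intro h1
      exact hne (hu ha hb' h1).2
    · exact fun h1 => absurd hb h1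
    · intro a' ha' hne
      refine Finset.sum_eq_zero fun b' hb' => if_neg ?_
      intro h1
      exact hne (hu ha' hb' h1).1
    · exact fun h1 => absurd ha h1

/-- The cube of exponents with all entries of absolute value at most `N`. -/
def box (m N : ℕ) : Finset (Fin m → ℤ) := Finset.Icc (fun _ => -(N : ℤ)) (fun _ => (N : ℤ))

theorem card_box (m N : ℕ) : (box m N).card = (2 * N + 1) ^ m := by
  rw [box, Pi.card_Icc]
  simp only [Int.card_Icc, Finset.prod_const, Finset.card_univ, Fintype.card_fin]
  congr 1
  omega

theorem exists_supp_subset_box (x : QTorus K Λ) : ∃ N, supp x ⊆ box m N := by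
  refine ⟨∑ c ∈ supp x, ∑ i, (c i).natAbs, fun c hc => ?_⟩
  have h : ∀ i, (c i).natAbs ≤ ∑ c ∈ supp x, ∑ i, (c i).natAbs := fun i =>
    (Finset.single_le_sum (f := fun i => (c i).natAbs) (fun _ _ => Nat.zero_le _)
      (Finset.mem_univ i)).trans
      (Finset.single_le_sum (f := fun c : Fin m → ℤ => ∑ i, (c i).natAbs)
        (fun _ _ => Nat.zero_le _) hc)
  rw [box, Finset.mem_Icc]
  exact ⟨fun i => by have := h i; simp only; omega, fun i => by have := h i; simp only; omega⟩

theorem box_mono {m N N' : ℕ} (h : N ≤ N') : box m N ⊆ box m N' := by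
  intro c hc
  rw [box, Finset.mem_Icc] at *
  exact ⟨fun i => by have := hc.1 i; simp only at *; omega,
    fun i => by have := hc.2 i; simp only at *; omega⟩

theorem box_add {m N N' : ℕ} {a b : Fin m → ℤ} (ha : a ∈ box m N) (hb : b ∈ box m N') :
    a + b ∈ box m (N + N') := by
  rw [box, Finset.mem_Icc] at *
  exact ⟨fun i => by have := ha.1 i; have := hb.1 i; simp only [Pi.add_apply] at *; omega,
    fun i => by have := ha.2 i; have := hb.2 i; simp only [Pi.add_apply] at *; omega⟩

theorem growth (m C : ℕ) : ∃ N : ℕ, (2 * (N + C) + 1) ^ m < 2 * (2 * N + 1) ^ m := by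
  refine ⟨2 * C * m, ?_⟩
  have hL : (0 : ℝ) < 2 * (2 * C * m + C) + 1 := by positivity
  have hC : (0 : ℝ) ≤ C := by positivity
  have hm : (0 : ℝ) ≤ m := by positivity
  have hCm : (0 : ℝ) ≤ C * m := by positivity
  have h1 := one_add_mul_le_pow (a := -(2 * C : ℝ) / (2 * (2 * C * m + C) + 1))
    (by rw [le_div_iff₀ hL]; nlinarith) m
  have h2 : (1 : ℝ) / 2 < 1 + m * (-(2 * C : ℝ) / (2 * (2 * C * m + C) + 1)) := by
    rw [← mul_div_assoc, ← sub_lt_iff_lt_add', lt_div_iff₀ hL]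
    nlinarith
  have h3 : (1 : ℝ) + -(2 * C : ℝ) / (2 * (2 * C * m + C) + 1) =
      (2 * (2 * C * m) + 1) / (2 * (2 * C * m + C) + 1) := by
    field_simp
    ring
  have h4 := h2.trans_le h1
  rw [h3, div_pow, lt_div_iff₀ (by positivity)] at h4
  have h5 : ((2 * (2 * C * m + C) + 1 : ℝ)) ^ m < 2 * (2 * (2 * C * m) + 1) ^ m := by linarith
  exact_mod_cast h5

/-- The left Ore condition, by comparing the growth of `V x + V y` with that of `V`. -/
theorem ore_condition (x y : QTorus K Λ) (hy : y ≠ 0) :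
    ∃ u v : QTorus K Λ, u ≠ 0 ∧ u * x = v * y := by
  classical
  obtain ⟨C₁, h₁⟩ := exists_supp_subset_box x
  obtain ⟨C₂, h₂⟩ := exists_supp_subset_box y
  set C := max C₁ C₂ with hC
  replace h₁ := h₁.trans (box_mono (m := m) (le_max_left C₁ C₂))
  replace h₂ := h₂.trans (box_mono (m := m) (le_max_right C₁ C₂))
  obtain ⟨N, hN⟩ := growth m C
  let e : (box m N → Coeff K) →ₗ[Coeff K] QTorus K Λ :=
    Fintype.linearCombination (Coeff K) fun c : box m N => mono K Λ c.1
  have he : ∀ f, coeffAt (e f) = fun c => if h : c ∈ box m N then f ⟨c, h⟩ else 0 := by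
    intro f
    funext c
    simp only [e, Fintype.linearCombination_apply, coeffAt_sum, coeffAt_smul, coeffAt_mono,
      mul_ite, mul_one, mul_zero]
    split_ifs with h
    · rw [Finset.sum_eq_single ⟨c, h⟩]
      · simp
      · rintro ⟨b, hb⟩ _ hne
        exact if_neg fun h' => hne (Subtype.ext h')
      · simp
    · exact Finset.sum_eq_zero fun b _ => if_neg fun h' => h (by rw [← h']; exact b.2)
  have hesupp : ∀ f, supp (e f) ⊆ box m N := by
    intro f c hc
    by_contra h
    exact mem_supp.1 hc (by rw [he]; exact dif_neg h)
  have hinj : ∀ f, e f = 0 → f = 0 := by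
    intro f hf
    funext c
    have := congrFun (he f) c.1
    rw [hf] at this
    simpa [coeffAt_zero] using this.symm
  let φ : (box m N ⊕ box m N → Coeff K) →ₗ[Coeff K] QTorus K Λ :=
    (mulLin K Λ).flip x ∘ₗ e ∘ₗ LinearMap.funLeft _ _ Sum.inl -
      (mulLin K Λ).flip y ∘ₗ e ∘ₗ LinearMap.funLeft _ _ Sum.inr
  have hφ : ∀ f, φ f = e (f ∘ Sum.inl) * x - e (f ∘ Sum.inr) * y := fun f => rfl
  let ψ : (box m N ⊕ box m N → Coeff K) →ₗ[Coeff K] (box m (N + C) → Coeff K) :=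
    { toFun := fun f c => coeffAt (φ f) c.1
      map_add' := fun f g => by funext c; rw [map_add, coeffAt_add]; rfl
      map_smul' := fun r f => by funext c; rw [map_smul, coeffAt_smul]; rfl }
  have hψ : ¬ Function.Injective ψ := by
    intro h
    have h' := card_le_of_injective (Coeff K) ψ h
    rw [Fintype.card_sum, Fintype.card_coe, Fintype.card_coe, card_box, card_box] at h'
    omega
  rw [injective_iff_map_eq_zero] at hψ
  push Not at hψ
  obtain ⟨f, hf, hf0⟩ := hψ
  have hout : ∀ (z w : QTorus K Λ), supp z ⊆ box m N → supp w ⊆ box m C →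
      ∀ c, c ∉ box m (N + C) → coeffAt (z * w) c = 0 := by
    intro z w hz hw c hc
    rw [coeffAt_mul]
    refine Finset.sum_eq_zero fun a ha => Finset.sum_eq_zero fun b hb => if_neg ?_
    rintro rfl
    exact hc (box_add (hz ha) (hw hb))
  have hφ0 : e (f ∘ Sum.inl) * x - e (f ∘ Sum.inr) * y = 0 := by
    rw [← hφ]
    refine torus_ext fun c => ?_
    rw [coeffAt_zero]
    by_cases h : c ∈ box m (N + C)
    · exact congrFun hf ⟨c, h⟩
    · have h3 := hout _ x (hesupp (f ∘ Sum.inl)) h₁ c h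
      have h4 := hout _ y (hesupp (f ∘ Sum.inr)) h₂ c h
      rw [hφ, sub_eq_add_neg, ← neg_one_smul (Coeff K), coeffAt_add, coeffAt_smul, h3, h4]
      simp
  refine ⟨e (f ∘ Sum.inl), e (f ∘ Sum.inr), fun h => hf0 ?_, sub_eq_zero.1 hφ0⟩
  rw [h, zero_mul, zero_sub, neg_eq_zero] at hφ0
  have h5 := hinj _ h
  have h6 := hinj _ ((mul_eq_zero.1 hφ0).resolve_right hy)
  funext i
  rcases i with i | i
  · exact congrFun h5 i
  · exact congrFun h6 i

instance : OreLocalization.OreSet (QTorus K Λ)⁰ :=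
  Classical.choice <| OreLocalization.nonempty_oreSet_iff_of_noZeroDivisors.2 fun x s => by
    obtain ⟨u, v, hu, huv⟩ := ore_condition x s.1 (nonZeroDivisors.ne_zero s.2)
    exact ⟨v, ⟨u, mem_nonZeroDivisors_of_ne_zero hu⟩, huv⟩

variable (K Λ)

/-- The skew field of fractions of the quantum torus. -/
abbrev QFrac : Type _ := OreLocalization (QTorus K Λ)⁰ (QTorus K Λ)

/-- The embedding of the quantum torus in its skew field of fractions. -/
abbrev toQFrac : QTorus K Λ →+* QFrac K Λ := OreLocalization.numeratorRingHom

/-- The Laurent polynomial ring `K[x_1^{±1}, …, x_m^{±1}]`. -/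
abbrev CTorus (K : Type*) [Field K] (m : ℕ) : Type _ := AddMonoidAlgebra K (Fin m → ℤ)

/-- The Laurent monomial `x^c`. -/
def cmono (K : Type*) [Field K] {m : ℕ} (c : Fin m → ℤ) : CTorus K m := AddMonoidAlgebra.single c 1

/-- The field `K(x_1, …, x_m)`. -/
abbrev CFrac (K : Type*) [Field K] (m : ℕ) : Type _ := FractionRing (CTorus K m)

end Torus

/-! ### Compatible pairs and matrix mutation

There are `r` mutable and `n` frozen directions, `m = r + n`; the mutable ones come first:
the mutable index `k : Fin r` is `Fin.castAdd n k : Fin (r + n)`, and the frozen index `j : Fin n`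
is `Fin.natAdd r j : Fin (r + n)`. -/

section Mutation

variable {r n : ℕ}

/-- `Λ` is skew-symmetric, and `B̃ᵀ Λ = (D 0)` with `D` diagonal with positive
diagonal entries. -/
structure IsCompatiblePair (Λ : Matrix (Fin (r + n)) (Fin (r + n)) ℤ)
    (B : Matrix (Fin (r + n)) (Fin r) ℤ) : Prop where
  skew : Λ.transpose = -Λ
  compat : ∃ d : Fin r → ℤ, (∀ j, 0 < d j) ∧
    ∀ (j : Fin r) (i : Fin (r + n)),
      (B.transpose * Λ) j i = if i = Fin.castAdd n j then d j else 0

/-- Matrix mutation in direction `k`. -/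
def mutateB (k : Fin r) (B : Matrix (Fin (r + n)) (Fin r) ℤ) :
    Matrix (Fin (r + n)) (Fin r) ℤ :=
  Matrix.of fun i j =>
    if i = Fin.castAdd n k ∨ j = k then -B i j
    else B i j + max (B i k) 0 * max (B (Fin.castAdd n k) j) 0
      - max (-B i k) 0 * max (-B (Fin.castAdd n k) j) 0

/-- The matrix `E` which differs from the identity only in column `k`, where it is
`-e_k + ∑_{b_ik < 0} (-b_ik) e_i`. -/
def mutE (k : Fin r) (B : Matrix (Fin (r + n)) (Fin r) ℤ) :
    Matrix (Fin (r + n)) (Fin (r + n)) ℤ :=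
  Matrix.of fun i j =>
    if j = Fin.castAdd n k then
      if i = Fin.castAdd n k then -1 else max (-B i k) 0
    else if i = j then 1 else 0

/-- Mutation of the skew-symmetric form: `Λ' = Eᵀ Λ E`. -/
def mutateForm (k : Fin r) (B : Matrix (Fin (r + n)) (Fin r) ℤ)
    (L : Matrix (Fin (r + n)) (Fin (r + n)) ℤ) : Matrix (Fin (r + n)) (Fin (r + n)) ℤ :=
  (mutE k B).transpose * L * mutE k B

/-- The positive part of column `k`, as an exponent vector. -/
def posCol (k : Fin r) (B : Matrix (Fin (r + n)) (Fin r) ℤ) : Fin (r + n) → ℤ :=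
  fun i => max (B i k) 0

/-- The negative part of column `k`, as an exponent vector. -/
def negCol (k : Fin r) (B : Matrix (Fin (r + n)) (Fin r) ℤ) : Fin (r + n) → ℤ :=
  fun i => max (-B i k) 0

end Mutation

/-! ### Quantum seeds and quantum cluster algebras -/

section Quantum

variable (K : Type*) [Field K] {r n : ℕ} (Λ : Matrix (Fin (r + n)) (Fin (r + n)) ℤ)

/-- The data of a quantum seed in the skew field of fractions `F` of the initial quantum torus: the
skew-symmetric form `Λ_M` of the toric frame `M`, the exchange matrix, and the elements
`X_i = M(e_i)`, which determine `M`. -/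
structure QSeed where
  L : Matrix (Fin (r + n)) (Fin (r + n)) ℤ
  B : Matrix (Fin (r + n)) (Fin r) ℤ
  X : Fin (r + n) → QFrac K Λ

variable {K Λ}

/-- The toric frame of a quantum seed:
`M(c) = q^{(1/2) ∑_{j < i} c_i c_j λ_ij} X_1^{c_1} ⋯ X_m^{c_m}`; it is normalized so that
`M(c) M(d) = q^{Λ_M(c,d)/2} M(c+d)`. -/
def QSeed.frame (S : QSeed K Λ) (c : Fin (r + n) → ℤ) : QFrac K Λ :=
  (LaurentPolynomial.T (∑ i, ∑ j ∈ Finset.Iio i, c i * c j * S.L i j) : Coeff K) •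
    (List.ofFn fun i => S.X i ^ c i).prod

/-- Mutation of quantum seeds: `X_i' = X_i` for `i ≠ k`, and
`X_k' = M(-e_k + ∑_{b_ik > 0} b_ik e_i) + M(-e_k - ∑_{b_ik < 0} b_ik e_i)`. -/
def QSeed.mutate (S : QSeed K Λ) (k : Fin r) : QSeed K Λ where
  L := mutateForm k S.B S.L
  B := mutateB k S.B
  X := Function.update S.X (Fin.castAdd n k)
    (S.frame (-Pi.single (Fin.castAdd n k) 1 + posCol k S.B) +
      S.frame (-Pi.single (Fin.castAdd n k) 1 + negCol k S.B))

variable (K Λ)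

/-- The initial quantum seed. -/
def QSeed.initial (B : Matrix (Fin (r + n)) (Fin r) ℤ) : QSeed K Λ where
  L := Λ
  B := B
  X := fun i => toQFrac K Λ (mono K Λ (Pi.single i 1))

/-- The quantum seeds obtained from the initial one by finite sequences of mutations. -/
inductive QSeed.Reachable (B : Matrix (Fin (r + n)) (Fin r) ℤ) : QSeed K Λ → Prop
  | init : QSeed.Reachable B (QSeed.initial K Λ B)
  | step (S : QSeed K Λ) (k : Fin r) : QSeed.Reachable B S → QSeed.Reachable B (S.mutate k)

/-- The quantum cluster algebra: the `R`-subalgebra of the skew field of fractions generated by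
all quantum cluster variables (the frozen ones included) and the inverses of
the frozen variables with index in `J`. -/
def quantumClusterAlgebra (B : Matrix (Fin (r + n)) (Fin r) ℤ) (J : Set (Fin n)) :
    Subalgebra (Coeff K) (QFrac K Λ) :=
  Algebra.adjoin (Coeff K)
    ({x | ∃ S, QSeed.Reachable K Λ B S ∧ ∃ i, x = S.X i} ∪
      {x | ∃ j ∈ J, x = ((QSeed.initial K Λ B).X (Fin.natAdd r j))⁻¹})

end Quantum

/-! ### Seeds and cluster algebras -/

section Classical

variable (K : Type*) [Field K] (r n : ℕ)

/-- A seed in the field `K(x_1, …, x_m)`. -/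
structure Seed where
  B : Matrix (Fin (r + n)) (Fin r) ℤ
  x : Fin (r + n) → CFrac K (r + n)

variable {K r n}

/-- Mutation of seeds: `x_k x_k' = ∏_{b_ik > 0} x_i^{b_ik} + ∏_{b_ik < 0} x_i^{-b_ik}`. -/
def Seed.mutate (S : Seed K r n) (k : Fin r) : Seed K r n where
  B := mutateB k S.B
  x := Function.update S.x (Fin.castAdd n k)
    ((∏ i, S.x i ^ posCol k S.B i + ∏ i, S.x i ^ negCol k S.B i) / S.x (Fin.castAdd n k))

variable (K)

/-- The initial seed. -/
def Seed.initial (B : Matrix (Fin (r + n)) (Fin r) ℤ) : Seed K r n where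
  B := B
  x := fun i => algebraMap (CTorus K (r + n)) (CFrac K (r + n)) (cmono K (Pi.single i 1))

/-- The seeds obtained from the initial one by finite sequences of mutations. -/
inductive Seed.Reachable (B : Matrix (Fin (r + n)) (Fin r) ℤ) : Seed K r n → Prop
  | init : Seed.Reachable B (Seed.initial K B)
  | step (S : Seed K r n) (k : Fin r) : Seed.Reachable B S → Seed.Reachable B (S.mutate k)

/-- The set of all cluster variables, the frozen ones included. -/
def clusterVariables (B : Matrix (Fin (r + n)) (Fin r) ℤ) : Set (CFrac K (r + n)) :=
  {x | ∃ S, Seed.Reachable K B S ∧ ∃ i, x = S.x i}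

/-- The cluster algebra: the `K`-subalgebra generated by all cluster variables and
the inverses of the frozen variables with index in `J`. -/
def clusterAlgebra (B : Matrix (Fin (r + n)) (Fin r) ℤ) (J : Set (Fin n)) :
    Subalgebra K (CFrac K (r + n)) :=
  Algebra.adjoin K (clusterVariables K B ∪
    {x | ∃ j ∈ J, x = ((Seed.initial K B).x (Fin.natAdd r j))⁻¹})

variable {K}

/-- The Laurent ring of a seed: generated by all `x_i`, the inverses of the mutable `x_i`,
and the inverses of the frozen `x_i` with index in `J`. -/
def Seed.laurent (S : Seed K r n) (J : Set (Fin n)) : Subalgebra K (CFrac K (r + n)) :=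
  Algebra.adjoin K (Set.range S.x ∪ {x | ∃ k : Fin r, x = (S.x (Fin.castAdd n k))⁻¹} ∪
    {x | ∃ j ∈ J, x = (S.x (Fin.natAdd r j))⁻¹})

variable (K)

/-- The upper cluster algebra: the intersection of the Laurent rings of all seeds. -/
def upperClusterAlgebra (B : Matrix (Fin (r + n)) (Fin r) ℤ) (J : Set (Fin n)) :
    Subalgebra K (CFrac K (r + n)) :=
  ⨅ (S : Seed K r n) (_ : Seed.Reachable K B S), S.laurent J

/-- `𝒜` makes the cluster algebra a `ℤ`-graded cluster algebra. -/
structure IsClusterGrading (B : Matrix (Fin (r + n)) (Fin r) ℤ) (J : Set (Fin n))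
    (𝒜 : ℤ → Submodule K (clusterAlgebra K B J)) : Prop where
  isInternal : DirectSum.IsInternal 𝒜
  mul_mem : ∀ (g h : ℤ) (a b : clusterAlgebra K B J), a ∈ 𝒜 g → b ∈ 𝒜 h → a * b ∈ 𝒜 (g + h)
  homogeneous : ∀ x : clusterAlgebra K B J, (x : CFrac K (r + n)) ∈ clusterVariables K B →
    ∃ g, x ∈ 𝒜 g

end Classical

end

end QuantumCluster

open QuantumCluster

/-! Write `p = q^{1/2} - 1` and let `T` be the initial quantum torus. The commutative torus is
`T/pT`, so the theorem splits into three claims: `A_q` lies in `T`; its image in `T/pT` is `A`; and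
`A_q ∩ pT = p A_q`. The last one is injectivity of the base-changed inclusion.

The first claim is the quantum Laurent phenomenon, proved with upper bounds. Let `W` be the exchange
binomial at `k`, that is, the new variable. An element of the torus of a seed is Laurent in the seed
mutated at `k` exactly when, for each `N`, its part of degree `-N` in `X_k` is left divisible by
`W^N` (`upper`). The elements that are Laurent in a seed and in all its neighbours form its upper
bound, and mutation does not change this set (`upperBound_mutate`). The essential case is a pair of
distinct directions `k`, `l` (`mem_upper_mutate`). It combines an explicit expansion of the exchange
binomial at `l` in the seed mutated at `k` (`exists_map_exch_eq`) with the cancellation of a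
binomial modulo a graded submodule (`mem_of_binomial_mul_mem`). No coprimality assumption is needed,
because compatibility makes distinct columns of the exchange matrix non-proportional. Every cluster
variable lies in the upper bound of its own seed, hence in that of every seed.

For the second claim, an element that is Laurent in all quantum seeds has the same specialization
through each of them (`PairReachable.seedSpec_eq`). It therefore specializes into `U = A`.
Conversely, quantum and classical cluster variables with the same mutation history correspond, so
the image of `A_q` contains the generators of `A` (`exists_specFrac_eq`).

For the third claim, suppose `p y ∈ A_q`. Being Laurent in all seeds is insensitive to the factor
`p`, since the exchange binomials are nonzero in the domain `T/pT`. So `y` specializes into `A`, and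
`y = b + p z` with `b ∈ A_q` and `p^2 z ∈ A_q`; this can be repeated. The grading of `A` gives a
degree on `ℤ^m` that vanishes on the columns of the exchange matrix. For this degree `A_q` is a
graded subalgebra of `T`, so `y` may be taken homogeneous. As the graded pieces of `A` are
finite-dimensional, all corrections can be taken in one finitely generated `R`-module `N ⊆ A_q`.
Thus `y` lies in `N + p^k T` for all `k`, and Krull's intersection theorem gives `(1 - p a) y ∈ N`.
Finally `y = (1 - p a) y + a (p y)` belongs to `A_q`. -/

namespace QuantumCluster

/-! ### The quantum torus: monomials, homogeneous components and cone subalgebras. -/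

section Torus

variable {K : Type*} [Field K] {m : ℕ} {Λ : Matrix (Fin m) (Fin m) ℤ}

/-! ### The bilinear form -/

theorem form_zero_left (d : Fin m → ℤ) : form Λ 0 d = 0 := by simp [form]

theorem form_zero_right (c : Fin m → ℤ) : form Λ c 0 = 0 := by simp [form]

theorem form_neg_left (c d : Fin m → ℤ) : form Λ (-c) d = -form Λ c d := by simp [form]

theorem form_sub_left (c c' d : Fin m → ℤ) :
    form Λ (c - c') d = form Λ c d - form Λ c' d := by
  rw [sub_eq_add_neg, form_add_left, form_neg_left, sub_eq_add_neg]

theorem form_smul_left (a : ℤ) (c d : Fin m → ℤ) : form Λ (a • c) d = a * form Λ c d := by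
  rw [form, form, smul_dotProduct, smul_eq_mul]

theorem form_smul_right (a : ℤ) (c d : Fin m → ℤ) : form Λ c (a • d) = a * form Λ c d := by
  rw [form, form, Matrix.mulVec_smul, dotProduct_smul, smul_eq_mul]

theorem form_swap (h : Λ.transpose = -Λ) (c d : Fin m → ℤ) : form Λ c d = -form Λ d c := by
  have : form Λ d c = form Λ.transpose c d := by
    rw [form, form, Matrix.mulVec_transpose, Matrix.dotProduct_mulVec, dotProduct_comm]
  rw [this, h]
  simp [form, Matrix.neg_mulVec]

theorem form_self (h : Λ.transpose = -Λ) (c : Fin m → ℤ) : form Λ c c = 0 := by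
  have := form_swap h c c
  omega

theorem form_single_single (i j : Fin m) : form Λ (Pi.single i 1) (Pi.single j 1) = Λ i j := by
  simp [form]

theorem form_conj (E : Matrix (Fin m) (Fin m) ℤ) (c d : Fin m → ℤ) :
    form (E.transpose * Λ * E) c d = form Λ (E.mulVec c) (E.mulVec d) := by
  rw [form, form, ← Matrix.mulVec_mulVec, ← Matrix.mulVec_mulVec, Matrix.dotProduct_mulVec,
    Matrix.vecMul_transpose]

/-! ### Monomials -/

theorem one_eq_mono : (1 : QTorus K Λ) = mono K Λ 0 := rfl

theorem mono_ne_zero (c : Fin m → ℤ) : mono K Λ c ≠ 0 := by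
  intro h
  have := congrArg (fun x => coeffAt x c) h
  simp [coeffAt_mono, coeffAt_zero] at this

theorem T_ne_zero (a : ℤ) : (LaurentPolynomial.T a : Coeff K) ≠ 0 :=
  (LaurentPolynomial.isUnit_T a).ne_zero

theorem T_smul_cancel {M : Type*} [AddCommGroup M] [Module (Coeff K) M] (a : ℤ) (x : M) :
    (LaurentPolynomial.T (-a) : Coeff K) • (LaurentPolynomial.T a : Coeff K) • x = x := by
  rw [smul_smul, ← LaurentPolynomial.T_add, neg_add_cancel, LaurentPolynomial.T_zero, one_smul]

theorem T_smul_mem {M : Type*} [AddCommGroup M] [Module (Coeff K) M] (N : Submodule (Coeff K) M)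
    {a : ℤ} {x : M} : (LaurentPolynomial.T a : Coeff K) • x ∈ N ↔ x ∈ N :=
  ⟨fun h => by simpa only [T_smul_cancel] using N.smul_mem (LaurentPolynomial.T (-a)) h,
    fun h => N.smul_mem _ h⟩

theorem mono_add (c d : Fin m → ℤ) :
    mono K Λ (c + d) = (LaurentPolynomial.T (-form Λ c d) : Coeff K) • (mono K Λ c * mono K Λ d) := by
  rw [mono_mul_mono, T_smul_cancel]

theorem mono_pow (h : Λ.transpose = -Λ) (c : Fin m → ℤ) (N : ℕ) :
    mono K Λ c ^ N = mono K Λ (N • c) := by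
  induction N with
  | zero => simp [one_eq_mono]
  | succ N ih =>
    rw [pow_succ, ih, mono_mul_mono, succ_nsmul, ← natCast_zsmul, form_smul_left, form_self h]
    simp

theorem mono_comm (h : Λ.transpose = -Λ) (c d : Fin m → ℤ) :
    mono K Λ c * mono K Λ d =
      (LaurentPolynomial.T (2 * form Λ c d) : Coeff K) • (mono K Λ d * mono K Λ c) := by
  rw [mono_mul_mono, mono_mul_mono, smul_smul, ← LaurentPolynomial.T_add, form_swap h d c,
    add_comm d c]
  congr 2
  ring

/-- Induction on the expansion of an element in the basis of monomials. -/
theorem mem_of_mono (N : Submodule (Coeff K) (QTorus K Λ)) (x : QTorus K Λ)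
    (h : ∀ c ∈ supp x, mono K Λ c ∈ N) : x ∈ N := by
  rw [eq_sum x]
  exact N.sum_mem fun c hc => N.smul_mem _ (h c hc)

/-! ### Algebra homomorphisms out of the quantum torus -/

/-- The linear map given by its values on monomials. -/
noncomputable def monoLin {N : Type*} [AddCommGroup N] [Module (Coeff K) N]
    (μ : (Fin m → ℤ) → N) : QTorus K Λ →ₗ[Coeff K] N :=
  Finsupp.linearCombination (Coeff K) μ ∘ₗ (toFinsupp K Λ).toLinearMap

@[simp]
theorem monoLin_mono {N : Type*} [AddCommGroup N] [Module (Coeff K) N]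
    (μ : (Fin m → ℤ) → N) (c : Fin m → ℤ) : monoLin (Λ := Λ) μ (mono K Λ c) = μ c := by
  simp [monoLin, mono]

/-- The algebra homomorphism given by its values on monomials. -/
noncomputable def monoHom {F : Type*} [Ring F] [Algebra (Coeff K) F] (μ : (Fin m → ℤ) → F)
    (h1 : μ 0 = 1)
    (hmul : ∀ c d, μ c * μ d = (LaurentPolynomial.T (form Λ c d) : Coeff K) • μ (c + d)) :
    QTorus K Λ →ₐ[Coeff K] F :=
  AlgHom.ofLinearMap (monoLin μ) (by rw [one_eq_mono, monoLin_mono, h1]) (by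
    have key : (mulLin K Λ).compr₂ (monoLin μ) =
        (LinearMap.mul (Coeff K) F).compl₁₂ (monoLin (Λ := Λ) μ) (monoLin (Λ := Λ) μ) := by
      refine torus_hom_ext fun c => torus_hom_ext fun d => ?_
      change monoLin μ (mono K Λ c * mono K Λ d) = monoLin μ (mono K Λ c) * monoLin μ (mono K Λ d)
      rw [mono_mul_mono, map_smul, monoLin_mono, monoLin_mono, monoLin_mono, hmul]
    exact fun x y => congrArg (fun f => f x y) key)

@[simp]
theorem monoHom_mono {F : Type*} [Ring F] [Algebra (Coeff K) F] (μ : (Fin m → ℤ) → F)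
    (h1 : μ 0 = 1)
    (hmul : ∀ c d, μ c * μ d = (LaurentPolynomial.T (form Λ c d) : Coeff K) • μ (c + d))
    (c : Fin m → ℤ) : monoHom (Λ := Λ) μ h1 hmul (mono K Λ c) = μ c :=
  monoLin_mono (Λ := Λ) μ c

/-! ### Homogeneous components -/

/-- The component of degree `n` with respect to the grading by an additive functional. -/
noncomputable def comp (f : (Fin m → ℤ) →+ ℤ) (n : ℤ) : QTorus K Λ →ₗ[Coeff K] QTorus K Λ :=
  monoLin fun c => if f c = n then mono K Λ c else 0

variable (f : (Fin m → ℤ) →+ ℤ)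

theorem comp_mono (n : ℤ) (c : Fin m → ℤ) :
    comp f n (mono K Λ c) = if f c = n then mono K Λ c else 0 := monoLin_mono _ _

theorem coeffAt_comp (n : ℤ) (x : QTorus K Λ) (c : Fin m → ℤ) :
    coeffAt (comp f n x) c = if f c = n then coeffAt x c else 0 := by
  let coeffLin : QTorus K Λ →ₗ[Coeff K] Coeff K :=
    { toFun := fun x => coeffAt x c
      map_add' := fun x y => coeffAt_add x y c
      map_smul' := fun r x => coeffAt_smul r x c }
  have key : coeffLin ∘ₗ comp f n = (if f c = n then (1 : Coeff K) else 0) • coeffLin := by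
    refine torus_hom_ext fun a => ?_
    change coeffAt (comp f n (mono K Λ a)) c = _ * coeffAt (mono K Λ a) c
    rw [comp_mono, coeffAt_mono]
    by_cases hac : a = c
    · subst hac
      by_cases h : f a = n <;> simp [h, coeffAt_mono, coeffAt_zero]
    · split_ifs <;> simp [coeffAt_mono, coeffAt_zero, hac]
  have := congrArg (fun φ => φ x) key
  change coeffAt (comp f n x) c = _ * coeffAt x c at this
  rw [this]
  split_ifs <;> simp

theorem comp_mono_mul (n : ℤ) (u : Fin m → ℤ) (x : QTorus K Λ) :
    comp f n (mono K Λ u * x) = mono K Λ u * comp f (n - f u) x := by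
  have key : comp f n ∘ₗ mulLin K Λ (mono K Λ u) = mulLin K Λ (mono K Λ u) ∘ₗ comp f (n - f u) := by
    refine torus_hom_ext fun a => ?_
    change comp f n (mono K Λ u * mono K Λ a) = mono K Λ u * comp f (n - f u) (mono K Λ a)
    rw [mono_mul_mono, map_smul, comp_mono, comp_mono, map_add]
    by_cases h : f a = n - f u
    · rw [if_pos h, if_pos (by omega), mono_mul_mono]
    · rw [if_neg h, if_neg (by omega), mul_zero, smul_zero]
  exact congrArg (fun φ => φ x) key

theorem comp_comp (f' : (Fin m → ℤ) →+ ℤ) (n n' : ℤ) (x : QTorus K Λ) :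
    comp f n (comp f' n' x) = comp f' n' (comp f n x) := by
  refine torus_ext fun c => ?_
  simp only [coeffAt_comp]
  split_ifs <;> rfl

theorem comp_comp_self (n n' : ℤ) (x : QTorus K Λ) :
    comp f n (comp f n' x) = if n = n' then comp f n x else 0 := by
  refine torus_ext fun c => ?_
  simp only [coeffAt_comp]
  split_ifs <;> simp_all [coeffAt_comp, coeffAt_zero]

/-- Multiplication by a homogeneous binomial commutes with taking components. -/
theorem comp_binomial_mul {n : ℤ} {u v : Fin m → ℤ} (h : f u = f v) (x : QTorus K Λ) :
    comp f n ((mono K Λ u + mono K Λ v) * x) =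
      (mono K Λ u + mono K Λ v) * comp f (n - f u) x := by
  rw [add_mul, map_add, comp_mono_mul, comp_mono_mul, ← h, add_mul]

theorem comp_binomial_pow_mul {n : ℤ} {u v : Fin m → ℤ} (h : f u = f v) (N : ℕ)
    (x : QTorus K Λ) :
    comp f n ((mono K Λ u + mono K Λ v) ^ N * x) =
      (mono K Λ u + mono K Λ v) ^ N * comp f (n - N * f u) x := by
  induction N generalizing n with
  | zero => simp
  | succ N ih =>
    rw [pow_succ', mul_assoc, comp_binomial_mul f h, ih, ← mul_assoc]
    congr 3
    push_cast
    ring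

theorem comp_eq_zero_of_notMem {n : ℤ} {x : QTorus K Λ} (h : n ∉ (supp x).image f) :
    comp f n x = 0 := by
  refine torus_ext fun c => ?_
  rw [coeffAt_comp, coeffAt_zero]
  split_ifs with hc
  · by_contra h0
    exact h (Finset.mem_image.2 ⟨c, mem_supp.2 h0, hc⟩)
  · rfl

theorem sum_comp (x : QTorus K Λ) : x = ∑ n ∈ (supp x).image f, comp f n x := by
  refine torus_ext fun c => ?_
  simp only [coeffAt_sum, coeffAt_comp]
  by_cases hc : c ∈ supp x
  · rw [Finset.sum_eq_single (f c)]
    · simp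
    · exact fun b _ hb => if_neg hb.symm
    · exact fun h => absurd (Finset.mem_image_of_mem f hc) h
  · have : coeffAt x c = 0 := by_contra fun h => hc (mem_supp.2 h)
    simp [this]

theorem mem_of_comp {N : Submodule (Coeff K) (QTorus K Λ)} {x : QTorus K Λ}
    (h : ∀ n, comp f n x ∈ N) : x ∈ N := by
  rw [sum_comp f x]
  exact N.sum_mem fun n _ => h n

theorem exists_comp_eq_zero (x : QTorus K Λ) : ∃ n₀, ∀ n < n₀, comp f n x = 0 := by
  obtain ⟨n₀, h⟩ := ((supp x).image f).bddBelow
  exact ⟨n₀, fun n hn => comp_eq_zero_of_notMem f fun hmem => absurd (h hmem) (not_le.2 hn)⟩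

theorem comp_neg (n : ℤ) (x : QTorus K Λ) : comp (-f) n x = comp f (-n) x := by
  refine torus_ext fun c => ?_
  simp only [coeffAt_comp, AddMonoidHom.neg_apply, neg_eq_iff_eq_neg]

/-- A binomial with terms of different degrees is a nonzerodivisor modulo a graded submodule which
is stable under one of its terms and the other one's inverse. -/
theorem mem_of_binomial_mul_mem {N : Submodule (Coeff K) (QTorus K Λ)}
    (hN : ∀ n, ∀ x ∈ N, comp f n x ∈ N) {u v : Fin m → ℤ}
    (hu : ∀ x ∈ N, mono K Λ (-u) * x ∈ N) (hv : ∀ x ∈ N, mono K Λ v * x ∈ N)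
    (huv : f u ≠ f v) {y : QTorus K Λ} (hy : (mono K Λ u + mono K Λ v) * y ∈ N) : y ∈ N := by
  -- The roles of `u` and `v` are not symmetric, so the order of the degrees is reversed by passing
  -- to `-f` rather than by swapping the terms.
  wlog hlt : f u < f v generalizing f
  · exact this (-f) (fun n x hx => by rw [comp_neg]; exact hN _ x hx)
      (fun h => huv (neg_injective h)) (neg_lt_neg (lt_of_le_of_ne (not_lt.1 hlt) huv.symm))
  obtain ⟨n₀, h₀⟩ := exists_comp_eq_zero f y
  -- Induction upwards from the lowest degree of `y`.
  suffices H : ∀ (t : ℕ) (n : ℤ), n < n₀ + t → comp f n y ∈ N from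
    mem_of_comp f fun n => H (n - n₀ + 1).toNat n (by omega)
  intro t
  induction t with
  | zero => exact fun n hn => by rw [h₀ n (by simpa using hn)]; exact N.zero_mem
  | succ t ih =>
    intro n hn
    -- In degree `n + f u` the product is `X^u y_n + X^v y_{n + f u - f v}`. The second index is
    -- below `n`, so the induction hypothesis removes that term and `X^{-u}` isolates `y_n`.
    have h1 := hN (n + f u) _ hy
    rw [add_mul, map_add, comp_mono_mul, comp_mono_mul, add_sub_cancel_right] at h1
    have h2 := (N.add_mem_iff_left (hv _ (ih (n + f u - f v) (by push_cast at hn; omega)))).1 h1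
    have h3 := hu _ h2
    rw [← mul_assoc, mono_mul_mono, neg_add_cancel, ← one_eq_mono, smul_mul_assoc, one_mul,
      T_smul_mem] at h3
    exact h3

theorem mem_of_binomial_pow_mul_mem {N : Submodule (Coeff K) (QTorus K Λ)}
    (hN : ∀ n, ∀ x ∈ N, comp f n x ∈ N) {u v : Fin m → ℤ}
    (hu : ∀ x ∈ N, mono K Λ (-u) * x ∈ N) (hv : ∀ x ∈ N, mono K Λ v * x ∈ N)
    (huv : f u ≠ f v) (t : ℕ) {y : QTorus K Λ} (hy : (mono K Λ u + mono K Λ v) ^ t * y ∈ N) :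
    y ∈ N := by
  induction t with
  | zero => simpa using hy
  | succ t ih =>
    rw [pow_succ', mul_assoc] at hy
    exact ih (mem_of_binomial_mul_mem f hN hu hv huv hy)

/-! ### Elements supported in a cone -/

/-- The subalgebra of elements whose exponents lie in a submonoid. -/
noncomputable def coneAlg (K : Type*) [Field K] (Λ : Matrix (Fin m) (Fin m) ℤ)
    (C : AddSubmonoid (Fin m → ℤ)) :
    Subalgebra (Coeff K) (QTorus K Λ) where
  carrier := {x | ∀ c ∈ supp x, c ∈ C}
  mul_mem' := by
    intro x y hx hy c hc
    by_contra hcC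
    refine mem_supp.1 hc ?_
    rw [coeffAt_mul]
    refine Finset.sum_eq_zero fun a ha => Finset.sum_eq_zero fun b hb => if_neg ?_
    rintro rfl
    exact hcC (C.add_mem (hx a ha) (hy b hb))
  add_mem' := by
    intro x y hx hy c hc
    by_contra hcC
    refine mem_supp.1 hc ?_
    rw [coeffAt_add, by_contra fun h => hcC (hx c (mem_supp.2 h)),
      by_contra fun h => hcC (hy c (mem_supp.2 h)), add_zero]
  algebraMap_mem' := by
    intro a c hc
    rw [Algebra.algebraMap_eq_smul_one, mem_supp, coeffAt_smul, one_eq_mono, coeffAt_mono] at hc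
    split_ifs at hc with h
    · rw [← h]; exact C.zero_mem
    · simp at hc

variable {C : AddSubmonoid (Fin m → ℤ)}

theorem mono_mem_coneAlg {c : Fin m → ℤ} : mono K Λ c ∈ coneAlg K Λ C ↔ c ∈ C := by
  refine ⟨fun h => h c (by simp [mem_supp, coeffAt_mono]), fun h a ha => ?_⟩
  rw [mem_supp, coeffAt_mono] at ha
  split_ifs at ha with h'
  · rwa [← h']
  · exact absurd rfl ha

theorem comp_mem_coneAlg (n : ℤ) {x : QTorus K Λ} (hx : x ∈ coneAlg K Λ C) :
    comp f n x ∈ coneAlg K Λ C := by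
  intro c hc
  refine hx c ?_
  rw [mem_supp, coeffAt_comp] at hc
  rw [mem_supp]
  exact fun h => hc (by rw [h, ite_self])

/-- To show that a homomorphism maps a cone algebra into a subalgebra it suffices to look at
monomials. -/
theorem map_mem_of_mem_coneAlg {F : Type*} [Ring F] [Algebra (Coeff K) F]
    (φ : QTorus K Λ →ₗ[Coeff K] F) (N : Submodule (Coeff K) F)
    (h : ∀ c ∈ C, φ (mono K Λ c) ∈ N) {x : QTorus K Λ} (hx : x ∈ coneAlg K Λ C) : φ x ∈ N :=
  mem_of_mono (N.comap φ) x fun c hc => h c (hx c hc)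

end Torus

/-! ### Compatible pairs and their mutation. -/

section Mutation

variable {r n : ℕ} {L : Matrix (Fin (r + n)) (Fin (r + n)) ℤ}
  {B : Matrix (Fin (r + n)) (Fin r) ℤ} {d : Fin r → ℤ}

/-- The basis vector of a mutable direction. -/
def mutVec (n : ℕ) (k : Fin r) : Fin (r + n) → ℤ := Pi.single (Fin.castAdd n k) 1

@[simp]
theorem mutVec_self (k : Fin r) : mutVec n k (Fin.castAdd n k) = 1 := by simp [mutVec]

theorem mutVec_of_ne {k : Fin r} {i : Fin (r + n)} (h : i ≠ Fin.castAdd n k) :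
    mutVec n k i = 0 := by simp [mutVec, h]

theorem mutVec_castAdd_of_ne {k l : Fin r} (h : l ≠ k) :
    mutVec n k (Fin.castAdd n l) = 0 := mutVec_of_ne fun h' => h (Fin.castAdd_injective r n h')

/-- A column of the exchange matrix. -/
def col (k : Fin r) (B : Matrix (Fin (r + n)) (Fin r) ℤ) : Fin (r + n) → ℤ := fun i => B i k

theorem posCol_sub_negCol (k : Fin r) : posCol k B - negCol k B = col k B := by
  funext i
  simp only [posCol, negCol, col, Pi.sub_apply]
  omega

theorem posCol_eq (k : Fin r) : posCol k B = negCol k B + col k B := by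
  rw [← posCol_sub_negCol, add_sub_cancel]

theorem posCol_nonneg (k : Fin r) (i) : 0 ≤ posCol k B i := le_max_right _ _

theorem negCol_nonneg (k : Fin r) (i) : 0 ≤ negCol k B i := le_max_right _ _

/-- The compatibility of a skew-symmetric form and an exchange matrix, as an identity of forms. -/
structure Compat (d : Fin r → ℤ) (L : Matrix (Fin (r + n)) (Fin (r + n)) ℤ)
    (B : Matrix (Fin (r + n)) (Fin r) ℤ) : Prop where
  skew : L.transpose = -L
  pos : ∀ k, 0 < d k
  form_col : ∀ k c, form L (col k B) c = d k * c (Fin.castAdd n k)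

theorem IsCompatiblePair.exists_compat (h : IsCompatiblePair L B) : ∃ d, Compat d L B := by
  obtain ⟨d, hd, hc⟩ := h.compat
  refine ⟨d, h.skew, hd, fun k c => ?_⟩
  have : form L (col k B) c = ∑ i, (B.transpose * L) k i * c i := by
    rw [form, Matrix.dotProduct_mulVec]
    rfl
  rw [this, Finset.sum_eq_single (Fin.castAdd n k)]
  · rw [hc, if_pos rfl]
  · intro i _ hi
    rw [hc, if_neg hi, zero_mul]
  · simp

namespace Compat

variable (h : Compat d L B)
include h

theorem form_col_right (k : Fin r) (c : Fin (r + n) → ℤ) :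
    form L c (col k B) = -(d k * c (Fin.castAdd n k)) := by
  rw [form_swap h.skew, h.form_col]

/-- Compatibility evaluates the form on a pair of columns from either side. The outcome is that the
principal part of the exchange matrix is skew-symmetrizable by `d`. -/
theorem skew_entry (j k : Fin r) :
    d j * B (Fin.castAdd n j) k = -(d k * B (Fin.castAdd n k) j) := by
  have h1 := h.form_col j (col k B)
  rw [h.form_col_right] at h1
  exact h1.symm

theorem diag (k : Fin r) : B (Fin.castAdd n k) k = 0 := by
  have h1 := h.skew_entry k k
  have h2 := h.pos k
  have h3 : d k * B (Fin.castAdd n k) k = 0 := by omega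
  exact (mul_eq_zero.1 h3).resolve_left h2.ne'

theorem posCol_self (k : Fin r) : posCol k B (Fin.castAdd n k) = 0 := by simp [posCol, h.diag]

theorem negCol_self (k : Fin r) : negCol k B (Fin.castAdd n k) = 0 := by simp [negCol, h.diag]

/-- Two distinct columns of the exchange matrix are separated by an additive functional. -/
theorem exists_functional {k l : Fin r} (hkl : k ≠ l) :
    ∃ f : (Fin (r + n) → ℤ) →+ ℤ, f (col l B) = 0 ∧ f (col k B) ≠ 0 := by
  by_contra! H
  -- The functional `c ↦ B_il c_j - B_jl c_i` kills column `l`, hence also column `k`: all `2 × 2`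
  -- minors of the two columns vanish.
  have h0 : ∀ i j, B i l * B j k - B j l * B i k = 0 := fun i j =>
    H (B i l • Pi.evalAddMonoidHom _ j - B j l • Pi.evalAddMonoidHom _ i) (by simp [col, mul_comm])
  have h1 : ∀ i, B i l = 0 := by
    intro i
    have h2 : B i l • col k B - B i k • col l B = 0 := by
      funext j
      have := h0 i j
      simp only [col, Pi.sub_apply, Pi.smul_apply, smul_eq_mul, Pi.zero_apply]
      linarith [mul_comm (B j l) (B i k)]
    -- Pairing with `e_k` sees column `k` but not column `l`, which forces `B_il = 0`.
    have h3 := congrArg (fun v => form L v (mutVec n k)) h2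
    simp only [form_sub_left, form_smul_left, h.form_col, mutVec_self,
      mutVec_castAdd_of_ne hkl.symm, form_zero_left] at h3
    have h4 := h.pos k
    have h5 : B i l * d k = 0 := by linarith
    exact (mul_eq_zero.1 h5).resolve_right h4.ne'
  have h6 := h.form_col l (mutVec n l)
  have h7 : col l B = 0 := funext h1
  rw [h7, form_zero_left, mutVec_self] at h6
  have := h.pos l
  omega

end Compat

theorem mutE_mulVec (k : Fin r) (c : Fin (r + n) → ℤ) (hB : negCol k B (Fin.castAdd n k) = 0) :
    (mutE k B).mulVec c =
      c - (2 * c (Fin.castAdd n k)) • mutVec n k + c (Fin.castAdd n k) • negCol k B := by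
  funext i
  have h1 : ∀ j, mutE k B i j * c j =
      (if i = j then c j else 0) + if j = Fin.castAdd n k then
        (if i = Fin.castAdd n k then -2 * c j else negCol k B i * c j) else 0 := by
    intro j
    simp only [mutE, Matrix.of_apply, negCol]
    split_ifs <;> simp_all
    ring
  simp only [Matrix.mulVec, dotProduct, h1, Finset.sum_add_distrib, Finset.sum_ite_eq,
    Finset.sum_ite_eq', Finset.mem_univ, if_true, Pi.add_apply, Pi.sub_apply, Pi.smul_apply,
    smul_eq_mul]
  by_cases hi : i = Fin.castAdd n k
  · subst hi
    simp [hB]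
    ring
  · simp [hi, mutVec_of_ne hi]
    ring

theorem form_mutateForm (k : Fin r) (c c' : Fin (r + n) → ℤ) :
    form (mutateForm k B L) c c' = form L ((mutE k B).mulVec c) ((mutE k B).mulVec c') :=
  form_conj _ _ _

theorem mutateForm_skew (h : L.transpose = -L) (k : Fin r) :
    (mutateForm k B L).transpose = -mutateForm k B L := by
  rw [mutateForm, Matrix.transpose_mul, Matrix.transpose_mul, Matrix.transpose_transpose, h]
  simp [Matrix.mul_assoc]

theorem col_mutateB_self (k : Fin r) : col k (mutateB k B) = -col k B := by
  funext i
  simp [col, mutateB]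

theorem posCol_mutateB_self (k : Fin r) : posCol k (mutateB k B) = negCol k B := by
  funext i
  simp [posCol, negCol, mutateB]

theorem negCol_mutateB_self (k : Fin r) : negCol k (mutateB k B) = posCol k B := by
  funext i
  simp [posCol, negCol, mutateB]

namespace Compat

variable (h : Compat d L B)
include h

theorem mutE_mulVec (k : Fin r) (c : Fin (r + n) → ℤ) :
    (mutE k B).mulVec c =
      c - (2 * c (Fin.castAdd n k)) • mutVec n k + c (Fin.castAdd n k) • negCol k B :=
  QuantumCluster.mutE_mulVec k c (h.negCol_self k)

theorem mutE_mulVec_of_eq_zero {k : Fin r} {c : Fin (r + n) → ℤ} (hc : c (Fin.castAdd n k) = 0) :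
    (mutE k B).mulVec c = c := by
  simp [h.mutE_mulVec, hc]

theorem mutE_mulVec_mutVec (k : Fin r) :
    (mutE k B).mulVec (mutVec n k) = -mutVec n k + negCol k B := by
  rw [h.mutE_mulVec, mutVec_self]
  module

theorem col_mutateB {j k : Fin r} (hjk : j ≠ k) :
    col j (mutateB k B) = col j B - (2 * B (Fin.castAdd n k) j) • mutVec n k +
      max (B (Fin.castAdd n k) j) 0 • posCol k B - max (-B (Fin.castAdd n k) j) 0 • negCol k B := by
  funext i
  simp only [col, mutateB, Matrix.of_apply, hjk, or_false, Pi.add_apply, Pi.sub_apply,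
    Pi.smul_apply, smul_eq_mul]
  split_ifs with hi
  · subst hi
    rw [mutVec_self, h.posCol_self, h.negCol_self]
    ring
  · rw [mutVec_of_ne hi, posCol, negCol]
    ring

/-- Seen through `E`, mutation only adds a multiple of column `k` to column `j`. Hence both
compatibility and the vanishing of a functional on all columns are inherited by the mutated seed. -/
theorem mutE_mulVec_col_mutateB {j k : Fin r} (hjk : j ≠ k) :
    (mutE k B).mulVec (col j (mutateB k B)) =
      col j B + max (B (Fin.castAdd n k) j) 0 • col k B := by
  have h2 : col j (mutateB k B) (Fin.castAdd n k) = -B (Fin.castAdd n k) j := by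
    simp [col, mutateB]
  rw [h.mutE_mulVec, h2, h.col_mutateB hjk, posCol_eq]
  have h3 : max (-B (Fin.castAdd n k) j) 0 =
    max (B (Fin.castAdd n k) j) 0 - B (Fin.castAdd n k) j := by omega
  rw [h3]
  module

theorem mutE_mulVec_col_mutateB_self (k : Fin r) :
    (mutE k B).mulVec (col k (mutateB k B)) = -col k B := by
  rw [col_mutateB_self, h.mutE_mulVec_of_eq_zero (by simp [col, h.diag])]

theorem mutate (k : Fin r) : Compat d (mutateForm k B L) (mutateB k B) where
  skew := mutateForm_skew h.skew k
  pos := h.pos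
  form_col j c := by
    rw [form_mutateForm]
    by_cases hjk : j = k
    · subst hjk
      rw [h.mutE_mulVec_col_mutateB_self, form_neg_left, h.form_col, h.mutE_mulVec]
      simp [h.negCol_self]
      ring
    · have h1 := h.mutE_mulVec_col_mutateB hjk
      have h4 := h.skew_entry j k
      have h6 := h.pos j
      have h7 := h.pos k
      -- By `skew_entry`, `b_jk` and `b_kj` have opposite signs, so the positive parts also match
      -- after scaling by `d`.
      have h5 : d j * negCol k B (Fin.castAdd n j) = d k * max (B (Fin.castAdd n k) j) 0 := by
        rw [negCol]
        rcases le_total (B (Fin.castAdd n j) k) 0 with h8 | h8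
        · rw [max_eq_left (by omega), max_eq_left (by nlinarith)]
          linarith
        · rw [max_eq_right (by omega), max_eq_right (by nlinarith)]
          simp
      rw [h1, form_add_left, form_smul_left, h.form_col, h.form_col, h.mutE_mulVec]
      simp only [Pi.add_apply, Pi.sub_apply, Pi.smul_apply, smul_eq_mul, mutVec_self,
        h.negCol_self, mutVec_castAdd_of_ne hjk]
      linear_combination c (Fin.castAdd n k) * h5

theorem form_mutateForm_of_eq_zero {k : Fin r} {c c' : Fin (r + n) → ℤ}
    (hc : c (Fin.castAdd n k) = 0) (hc' : c' (Fin.castAdd n k) = 0) :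
    form (mutateForm k B L) c c' = form L c c' := by
  rw [form_mutateForm, h.mutE_mulVec_of_eq_zero hc, h.mutE_mulVec_of_eq_zero hc']

theorem form_mutateForm_mutVec {k : Fin r} {c : Fin (r + n) → ℤ} (hc : c (Fin.castAdd n k) = 0) :
    form (mutateForm k B L) (mutVec n k) c = form L (-mutVec n k + negCol k B) c := by
  rw [form_mutateForm, h.mutE_mulVec_mutVec, h.mutE_mulVec_of_eq_zero hc]

/-- The difference of the two vectors is column `k`, which pairs with `c` to a multiple of `c_k`.
This is why both terms of an exchange binomial quasi-commute in the same way with monomials free of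
`X_k`. -/
theorem form_posCol_negCol {k : Fin r} {c : Fin (r + n) → ℤ} (hc : c (Fin.castAdd n k) = 0) :
    form L (posCol k B) c = form L (negCol k B) c := by
  rw [posCol_eq, form_add_left, h.form_col, hc, mul_zero, add_zero]

theorem mutateB_mutateB (k : Fin r) : mutateB k (mutateB k B) = B := by
  ext i j
  have hd := h.diag k
  by_cases hj : j = k
  · simp [mutateB, hj]
  · by_cases hi : i = Fin.castAdd n k
    · simp [mutateB, hi]
    · simp only [mutateB, Matrix.of_apply, hi, hj, or_self, or_true, true_or, if_false, if_true,
        neg_neg]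
      ring

theorem mutateForm_mutateForm (k : Fin r) :
    mutateForm k (mutateB k B) (mutateForm k B L) = L := by
  ext i j
  rw [← form_single_single (Λ := mutateForm k (mutateB k B) (mutateForm k B L)),
    ← form_single_single (Λ := L), form_mutateForm, form_mutateForm]
  -- The product of the two matrices `E` is not the identity but a transvection along column `k`;
  -- compatibility makes it an isometry of `L`.
  have key : ∀ c, (mutE k B).mulVec ((mutE k (mutateB k B)).mulVec c) =
      c + c (Fin.castAdd n k) • col k B := by
    intro c
    have h1 : ((mutE k (mutateB k B)).mulVec c) (Fin.castAdd n k) = -c (Fin.castAdd n k) := by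
      rw [(h.mutate k).mutE_mulVec, negCol_mutateB_self]
      simp [h.posCol_self]
      ring
    rw [h.mutE_mulVec, h1, (h.mutate k).mutE_mulVec, negCol_mutateB_self, posCol_eq]
    module
  rw [key, key]
  simp only [form_add_left, form_add_right, form_smul_left, form_smul_right, h.form_col,
    h.form_col_right, Pi.add_apply, Pi.smul_apply, smul_eq_mul, col, h.diag]
  ring

end Compat

end Mutation

section MutHom

/-! ### The toric frame of a mutated seed -/

theorem zpow_quasi_comm {R D : Type*} [CommRing R] [DivisionRing D] [Algebra (LaurentPolynomial R) D]
    {x W : D} (hW : W ≠ 0) {s : ℤ}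
    (h : x * W = (LaurentPolynomial.T s : LaurentPolynomial R) • (W * x)) (l : ℤ) :
    x * W ^ l = (LaurentPolynomial.T (l * s) : LaurentPolynomial R) • (W ^ l * x) := by
  have hnat : ∀ n : ℕ,
      x * W ^ n = (LaurentPolynomial.T (n * s) : LaurentPolynomial R) • (W ^ n * x) := by
    intro n
    induction n with
    | zero => simp
    | succ n ih =>
      rw [pow_succ, ← mul_assoc, ih, smul_mul_assoc, mul_assoc, h, mul_smul_comm, smul_smul,
        ← LaurentPolynomial.T_add, mul_assoc]
      congr 2
      push_cast
      ring
  obtain ⟨n, rfl | rfl⟩ := l.eq_nat_or_neg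
  · simpa using hnat n
  · have hn := hnat n
    have hWn : W ^ n ≠ 0 := pow_ne_zero n hW
    rw [zpow_neg, zpow_natCast, ← mul_left_inj' hWn, mul_assoc, inv_mul_cancel₀ hWn, mul_one,
      smul_mul_assoc, mul_assoc, hn, mul_smul_comm, inv_mul_cancel_left₀ hWn, smul_smul,
      ← LaurentPolynomial.T_add]
    simp

variable {K : Type*} [Field K] {r n : ℕ} {L : Matrix (Fin (r + n)) (Fin (r + n)) ℤ}
  {B : Matrix (Fin (r + n)) (Fin r) ℤ} {d : Fin r → ℤ}

/-- The new cluster variable of a mutation, as an element of the quantum torus. -/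
noncomputable def exch (K : Type*) [Field K] (L : Matrix (Fin (r + n)) (Fin (r + n)) ℤ)
    (B : Matrix (Fin (r + n)) (Fin r) ℤ) (k : Fin r) : QTorus K L :=
  mono K L (-mutVec n k + posCol k B) + mono K L (-mutVec n k + negCol k B)

/-- An exponent vector with one mutable coordinate set to zero. -/
def dropAt (k : Fin r) (c : Fin (r + n) → ℤ) : Fin (r + n) → ℤ :=
  c - c (Fin.castAdd n k) • mutVec n k

@[simp]
theorem dropAt_self (k : Fin r) (c : Fin (r + n) → ℤ) : dropAt k c (Fin.castAdd n k) = 0 := by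
  simp [dropAt]

theorem dropAt_of_ne (k : Fin r) (c : Fin (r + n) → ℤ) {i} (hi : i ≠ Fin.castAdd n k) :
    dropAt k c i = c i := by
  simp [dropAt, mutVec_of_ne hi]

theorem dropAt_add (k : Fin r) (c c' : Fin (r + n) → ℤ) :
    dropAt k (c + c') = dropAt k c + dropAt k c' := by
  simp only [dropAt, Pi.add_apply]
  module

theorem dropAt_eq_self {k : Fin r} {c : Fin (r + n) → ℤ} (h : c (Fin.castAdd n k) = 0) :
    dropAt k c = c := by
  simp [dropAt, h]

theorem eq_smul_add_dropAt (k : Fin r) (c : Fin (r + n) → ℤ) :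
    c = c (Fin.castAdd n k) • mutVec n k + dropAt k c := by
  simp [dropAt]

namespace Compat

variable (h : Compat d L B)
include h

theorem exch_ne_zero (k : Fin r) : exch K L B k ≠ 0 := by
  intro h0
  have hne : posCol k B ≠ negCol k B := by
    intro h1
    have h2 := h.form_col k (mutVec n k)
    rw [← posCol_sub_negCol, h1, sub_self, form_zero_left, mutVec_self] at h2
    have := h.pos k
    omega
  have h1 := congrArg (fun x => coeffAt x (-mutVec n k + posCol k B)) h0
  simp [exch, coeffAt_add, coeffAt_mono, coeffAt_zero, hne.symm] at h1

/-- Both terms acquire the same power of `q`, so the binomial behaves like a single quasi-commuting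
variable; this makes the mutated frame a quantum torus. -/
theorem exch_comm {k : Fin r} {c : Fin (r + n) → ℤ} (hc : c (Fin.castAdd n k) = 0) :
    mono K L c * exch K L B k =
      (LaurentPolynomial.T (-(2 * form L (-mutVec n k + negCol k B) c)) : Coeff K) •
        (exch K L B k * mono K L c) := by
  have h1 : form L c (-mutVec n k + posCol k B) = form L c (-mutVec n k + negCol k B) := by
    rw [form_swap h.skew, form_add_left, h.form_posCol_negCol hc, ← form_add_left,
      ← form_swap h.skew]
  rw [exch, mul_add, mono_comm h.skew, mono_comm h.skew c, h1, ← smul_add, ← add_mul,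
    form_swap h.skew c]
  congr 2
  ring

variable {D : Type*} [DivisionRing D] [Algebra (Coeff K) D] {ι : QTorus K L →ₐ[Coeff K] D}

/-- The frame of the mutated seed, as a homomorphism from the quantum torus of the mutated form. -/
noncomputable def mutHom (hι : Function.Injective ι) (k : Fin r) :
    QTorus K (mutateForm k B L) →ₐ[Coeff K] D :=
  -- The exponent is minus the mutated form on the pair `(c_k e_k, dropAt k c)`: it normalizes the
  -- product of the new variable's power with the remaining monomial.
  monoHom (fun c => (LaurentPolynomial.T
      (-(c (Fin.castAdd n k) * form L (-mutVec n k + negCol k B) (dropAt k c))) : Coeff K) •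
        (ι (exch K L B k) ^ c (Fin.castAdd n k) * ι (mono K L (dropAt k c))))
    (by simp [dropAt, form_zero_right, ← one_eq_mono])
    (by
      intro c c'
      have hW : ι (exch K L B k) ≠ 0 := (map_ne_zero_iff ι hι).2 (h.exch_ne_zero k)
      have hc : ∀ c : Fin (r + n) → ℤ, form (mutateForm k B L) (mutVec n k) (dropAt k c) =
          form L (-mutVec n k + negCol k B) (dropAt k c) := fun c =>
        h.form_mutateForm_mutVec (dropAt_self k c)
      have h1 : ι (mono K L (dropAt k c)) * ι (exch K L B k) = (LaurentPolynomial.T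
          (-(2 * form L (-mutVec n k + negCol k B) (dropAt k c))) : Coeff K) •
            (ι (exch K L B k) * ι (mono K L (dropAt k c))) := by
        rw [← map_mul, h.exch_comm (dropAt_self k c), map_smul, map_mul]
      have h2 := zpow_quasi_comm hW h1 (c' (Fin.castAdd n k))
      have h3 : form (mutateForm k B L) c c' = form L (dropAt k c) (dropAt k c') +
          c (Fin.castAdd n k) * form L (-mutVec n k + negCol k B) (dropAt k c') -
          c' (Fin.castAdd n k) * form L (-mutVec n k + negCol k B) (dropAt k c) := by
        conv_lhs => rw [eq_smul_add_dropAt k c, eq_smul_add_dropAt k c']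
        have hsk := mutateForm_skew (k := k) (B := B) h.skew
        rw [form_add_left, form_add_right, form_add_right, form_smul_left, form_smul_left,
          form_smul_right, form_smul_right, form_self hsk, hc, form_swap hsk (dropAt k c), hc,
          h.form_mutateForm_of_eq_zero (dropAt_self k c) (dropAt_self k c')]
        ring
      rw [smul_mul_smul_comm, mul_assoc, ← mul_assoc (ι (mono K L (dropAt k c))), h2,
        smul_mul_assoc, mul_assoc, ← map_mul, mono_mul_mono, map_smul, mul_smul_comm,
        mul_smul_comm, mul_smul_comm, ← mul_assoc, ← zpow_add₀ hW, ← dropAt_add, smul_smul,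
        smul_smul, smul_smul, Pi.add_apply, h3, ← LaurentPolynomial.T_add,
        ← LaurentPolynomial.T_add, ← LaurentPolynomial.T_add, ← LaurentPolynomial.T_add,
        dropAt_add, form_add_right]
      congr 2
      ring)

theorem mutHom_mono (hι : Function.Injective ι) (k : Fin r) (c : Fin (r + n) → ℤ) :
    h.mutHom hι k (mono K _ c) = (LaurentPolynomial.T
      (-(c (Fin.castAdd n k) * form L (-mutVec n k + negCol k B) (dropAt k c))) : Coeff K) •
        (ι (exch K L B k) ^ c (Fin.castAdd n k) * ι (mono K L (dropAt k c))) :=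
  monoHom_mono _ _ _ c

theorem mutHom_of_eq_zero (hι : Function.Injective ι) {k : Fin r} {c : Fin (r + n) → ℤ}
    (hc : c (Fin.castAdd n k) = 0) : h.mutHom hι k (mono K _ c) = ι (mono K L c) := by
  simp [h.mutHom_mono, dropAt_eq_self hc, hc]

theorem mutHom_mutVec (hι : Function.Injective ι) (k : Fin r) :
    h.mutHom hι k (mono K _ (mutVec n k)) = ι (exch K L B k) := by
  simp [h.mutHom_mono, dropAt, form_zero_right, ← one_eq_mono]

end Compat

/-- The expansion, in the quantum torus of a seed, of elements of the quantum torus of the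
mutated seed which are polynomial in the new cluster variable. -/
noncomputable def expand (K : Type*) [Field K] (L : Matrix (Fin (r + n)) (Fin (r + n)) ℤ)
    (B : Matrix (Fin (r + n)) (Fin r) ℤ) (k : Fin r) :
    QTorus K (mutateForm k B L) →ₗ[Coeff K] QTorus K L :=
  monoLin fun c => (LaurentPolynomial.T
      (-(c (Fin.castAdd n k) * form L (-mutVec n k + negCol k B) (dropAt k c))) : Coeff K) •
        -- `toNat` turns negative exponents into `0`; the map is meaningful, and used, only where
        -- the exponent of the new variable is nonnegative.
        (exch K L B k ^ (c (Fin.castAdd n k)).toNat * mono K L (dropAt k c))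

/-- The identification of quantum tori with the same exponents. -/
noncomputable def transfer {m : ℕ} (K : Type*) [Field K] (L L' : Matrix (Fin m) (Fin m) ℤ) :
    QTorus K L ≃ₗ[Coeff K] QTorus K L' :=
  (toFinsupp K L).trans (toFinsupp K L').symm

@[simp]
theorem transfer_mono {m : ℕ} {L L' : Matrix (Fin m) (Fin m) ℤ} (c : Fin m → ℤ) :
    transfer K L L' (mono K L c) = mono K L' c := by
  simp [transfer, mono]

/-- The exponents whose coordinate at an index is nonnegative. -/
def halfSpace {m : ℕ} (i : Fin m) : AddSubmonoid (Fin m → ℤ) where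
  carrier := {c | 0 ≤ c i}
  add_mem' := fun ha hb => add_nonneg (α := ℤ) ha hb
  zero_mem' := le_refl (0 : ℤ)

theorem mem_halfSpace {m : ℕ} {i : Fin m} {c : Fin m → ℤ} : c ∈ halfSpace i ↔ 0 ≤ c i := Iff.rfl

theorem eq_of_mem_coneAlg {m : ℕ} {L : Matrix (Fin m) (Fin m) ℤ} {M : Type*} [AddCommGroup M]
    [Module (Coeff K) M] {C : AddSubmonoid (Fin m → ℤ)} {φ ψ : QTorus K L →ₗ[Coeff K] M}
    (h : ∀ c ∈ C, φ (mono K L c) = ψ (mono K L c)) {x : QTorus K L} (hx : x ∈ coneAlg K L C) :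
    φ x = ψ x :=
  mem_of_mono (LinearMap.eqLocus φ ψ) x fun c hc => h c (hx c hc)

/-- The degree in a variable. -/
def degAt {m : ℕ} (i : Fin m) : (Fin m → ℤ) →+ ℤ := Pi.evalAddMonoidHom (fun _ => ℤ) i

@[simp]
theorem degAt_apply {m : ℕ} (i : Fin m) (c : Fin m → ℤ) : degAt i c = c i := rfl

/-- Clearing denominators: the finite support bounds the negative powers of `X_k`. -/
theorem exists_mono_mul_mem_halfSpace {L : Matrix (Fin (r + n)) (Fin (r + n)) ℤ} (k : Fin r)
    (x : QTorus K L) : ∃ N₀ : ℕ, ∀ N : ℕ, N₀ ≤ N →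
      mono K L (N • mutVec n k) * x ∈ coneAlg K L (halfSpace (Fin.castAdd n k)) := by
  obtain ⟨N₀, h⟩ := exists_supp_subset_box x
  refine ⟨N₀, fun N hN => ?_⟩
  refine mem_of_mono ((coneAlg K L (halfSpace (Fin.castAdd n k))).toSubmodule.comap
    (mulLin K L (mono K L (N • mutVec n k)))) x fun c hc => ?_
  change mono K L (N • mutVec n k) * mono K L c ∈ coneAlg K L (halfSpace (Fin.castAdd n k))
  rw [mono_mul_mono]
  refine Subalgebra.smul_mem _ (mono_mem_coneAlg.2 ?_) _
  have h1 := h hc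
  rw [box, Finset.mem_Icc] at h1
  have h2 : -(N₀ : ℤ) ≤ c (Fin.castAdd n k) := h1.1 (Fin.castAdd n k)
  rw [mem_halfSpace, Pi.add_apply, Pi.smul_apply, mutVec_self, nsmul_eq_mul, mul_one]
  omega

namespace Compat

variable (h : Compat d L B)
include h

variable {D : Type*} [DivisionRing D] [Algebra (Coeff K) D] {ι : QTorus K L →ₐ[Coeff K] D}

theorem map_expand (hι : Function.Injective ι) (k : Fin r) {x : QTorus K (mutateForm k B L)}
    (hx : x ∈ coneAlg K _ (halfSpace (Fin.castAdd n k))) :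
    ι (expand K L B k x) = h.mutHom hι k x := by
  refine eq_of_mem_coneAlg (φ := ι.toLinearMap ∘ₗ expand K L B k)
    (ψ := (h.mutHom hι k).toLinearMap) (fun c hc => ?_) hx
  obtain ⟨N, hN⟩ := Int.eq_ofNat_of_zero_le (mem_halfSpace.1 hc)
  simp [expand, h.mutHom_mono, hN]

theorem comp_expand_mono (k : Fin r) {c : Fin (r + n) → ℤ} (hc : 0 ≤ c (Fin.castAdd n k)) (N : ℕ) :
    comp (degAt (Fin.castAdd n k)) (-N) (expand K L B k (mono K (mutateForm k B L) c)) = exch K L B k ^ N *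
      transfer K (mutateForm k B L) L (mono K (mutateForm k B L) (-(N • mutVec n k)) *
        comp (degAt (Fin.castAdd n k)) N (mono K (mutateForm k B L) c)) := by
  obtain ⟨M, hM⟩ := Int.eq_ofNat_of_zero_le hc
  have h0 : degAt (Fin.castAdd n k) (-mutVec n k + posCol k B) = -1 := by simp [h.posCol_self]
  have h1 : degAt (Fin.castAdd n k) (-mutVec n k + posCol k B) =
      degAt (Fin.castAdd n k) (-mutVec n k + negCol k B) := by simp [h.posCol_self, h.negCol_self]
  rw [expand, monoLin_mono, map_smul, hM, Int.toNat_natCast]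
  conv_lhs => rw [exch]
  rw [comp_binomial_pow_mul _ h1, ← exch, h0, comp_mono, comp_mono]
  simp only [degAt_apply, dropAt_self, hM]
  by_cases hMN : M = N
  · subst hMN
    have hsk := mutateForm_skew (k := k) (B := B) h.skew
    have h2 : -(M • mutVec n k) + c = dropAt k c := by
      rw [dropAt, hM, natCast_zsmul]
      abel
    have h3 : form (mutateForm k B L) (-(M • mutVec n k)) c =
        -(M * form L (-mutVec n k + negCol k B) (dropAt k c)) := by
      rw [← natCast_zsmul, form_neg_left, form_smul_left, eq_smul_add_dropAt k c, form_add_right,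
        form_smul_right, form_self hsk, h.form_mutateForm_mutVec (dropAt_self k c),
        ← eq_smul_add_dropAt]
      ring
    rw [if_pos (by ring), if_pos rfl, mono_mul_mono, h2, h3, map_smul, transfer_mono,
      mul_smul_comm]
  · rw [if_neg (by omega), if_neg (by omega)]
    simp

/-- The new variable has degree `-1` in `X_k`, so the part of degree `N` in it becomes the part of
degree `-N` in `X_k`. This is the source of the divisibility condition in `upper`. -/
theorem comp_expand (k : Fin r) {x : QTorus K (mutateForm k B L)}
    (hx : x ∈ coneAlg K _ (halfSpace (Fin.castAdd n k))) (N : ℕ) :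
    comp (degAt (Fin.castAdd n k)) (-N) (expand K L B k x) = exch K L B k ^ N *
      transfer K (mutateForm k B L) L (mono K (mutateForm k B L) (-(N • mutVec n k)) * comp (degAt (Fin.castAdd n k)) N x) := by
  have key := eq_of_mem_coneAlg (φ := comp (degAt (Fin.castAdd n k)) (-N) ∘ₗ expand K L B k)
    (ψ := LinearMap.mulLeft (Coeff K) (exch K L B k ^ N) ∘ₗ (transfer K (mutateForm k B L) L).toLinearMap ∘ₗ
      LinearMap.mulLeft (Coeff K) (mono K (mutateForm k B L) (-(N • mutVec n k))) ∘ₗ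
        comp (degAt (Fin.castAdd n k)) N)
    (fun c hc => h.comp_expand_mono k hc N) hx
  exact key

/-- Once denominators in the new variable are cleared, `comp_expand` recovers each component of `x`
from its image, because the torus is a domain and the binomial is nonzero. -/
theorem mutHom_injective (hι : Function.Injective ι) (k : Fin r) :
    Function.Injective (h.mutHom hι k) := by
  rw [injective_iff_map_eq_zero]
  intro x hx
  obtain ⟨N₀, hN₀⟩ := exists_mono_mul_mem_halfSpace k x
  have h1 := hN₀ N₀ le_rfl
  have h2 := h.map_expand hι k h1
  rw [map_mul (h.mutHom hι k), hx, mul_zero, map_eq_zero_iff ι hι] at h2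
  have h3 : mono K (mutateForm k B L) (N₀ • mutVec n k) * x = 0 := by
    have h5 : ∀ N, comp (degAt (Fin.castAdd n k)) N
        (mono K (mutateForm k B L) (N₀ • mutVec n k) * x) = 0 := by
      intro N
      rcases le_or_gt 0 N with hN | hN
      · obtain ⟨M, rfl⟩ := Int.eq_ofNat_of_zero_le hN
        have h4 := h.comp_expand k h1 M
        rw [h2, map_zero, eq_comm, mul_eq_zero] at h4
        have h6 := h4.resolve_left (pow_ne_zero M (h.exch_ne_zero k))
        rw [LinearEquiv.map_eq_zero_iff] at h6
        exact (mul_eq_zero.1 h6).resolve_left (mono_ne_zero _)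
      · refine torus_ext fun c => ?_
        rw [coeffAt_comp, coeffAt_zero]
        split_ifs with hc
        · by_contra h7
          have := mem_halfSpace.1 (h1 c (mem_supp.2 h7))
          simp at hc
          omega
        · rfl
    exact (Submodule.mem_bot (Coeff K)).1 (mem_of_comp (degAt (Fin.castAdd n k))
      fun N => (Submodule.mem_bot _).2 (h5 N))
  exact (mul_eq_zero.1 h3).resolve_left (mono_ne_zero _)

end Compat

end MutHom

section Upper

/-! ### Elements which are Laurent in a seed and in an adjacent seed -/

variable {K : Type*} [Field K] {r n : ℕ} {L : Matrix (Fin (r + n)) (Fin (r + n)) ℤ}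
  {B : Matrix (Fin (r + n)) (Fin r) ℤ} {d : Fin r → ℤ}

/-- The elements of the quantum torus of a seed which are Laurent polynomials also in the seed
mutated at `k`: the component of degree `-N` in `X_k` is divisible by the `N`-th power of
the new cluster variable. -/
noncomputable def upper (K : Type*) [Field K] (L : Matrix (Fin (r + n)) (Fin (r + n)) ℤ)
    (B : Matrix (Fin (r + n)) (Fin r) ℤ) (k : Fin r) : Submodule (Coeff K) (QTorus K L) where
  carrier := {x | ∀ N : ℕ, ∃ a, comp (degAt (Fin.castAdd n k)) (-N) x = exch K L B k ^ N * a}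
  add_mem' := by
    intro x y hx hy N
    obtain ⟨a, ha⟩ := hx N
    obtain ⟨b, hb⟩ := hy N
    exact ⟨a + b, by rw [map_add, ha, hb, mul_add]⟩
  zero_mem' := fun N => ⟨0, by simp⟩
  smul_mem' := by
    intro c x hx N
    obtain ⟨a, ha⟩ := hx N
    exact ⟨c • a, by rw [map_smul, ha, mul_smul_comm]⟩

/-- The exponents whose coordinates at some indices are nonnegative. -/
def nonnegOn {m : ℕ} (I : Set (Fin m)) : AddSubmonoid (Fin m → ℤ) where
  carrier := {c | ∀ i ∈ I, 0 ≤ c i}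
  add_mem' := fun ha hb i hi => add_nonneg (ha i hi) (hb i hi)
  zero_mem' := fun _ _ => le_rfl

theorem mem_coneAlg_nonnegOn {m : ℕ} {L : Matrix (Fin m) (Fin m) ℤ} {I : Set (Fin m)}
    {x : QTorus K L} :
    x ∈ coneAlg K L (nonnegOn I) ↔ ∀ i ∈ I, x ∈ coneAlg K L (halfSpace i) :=
  ⟨fun h i hi c hc => h c hc i hi, fun h c hc i hi => h i hi c hc⟩

theorem mem_coneAlg_nonnegOn_empty {m : ℕ} {L : Matrix (Fin m) (Fin m) ℤ} (x : QTorus K L) :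
    x ∈ coneAlg K L (nonnegOn ∅) := fun _ _ i hi => absurd hi (Set.notMem_empty i)

theorem comp_mem_halfSpace {m : ℕ} {L : Matrix (Fin m) (Fin m) ℤ} {i : Fin m} {N : ℤ} (hN : 0 ≤ N)
    (x : QTorus K L) : comp (degAt i) N x ∈ coneAlg K L (halfSpace i) := by
  intro c hc
  rw [mem_supp, coeffAt_comp] at hc
  split_ifs at hc with h
  · rwa [mem_halfSpace, ← degAt_apply i c, h]
  · exact absurd rfl hc

theorem comp_eq_zero_of_mem_halfSpace {m : ℕ} {L : Matrix (Fin m) (Fin m) ℤ} {i : Fin m} {N : ℤ}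
    (hN : N < 0) {x : QTorus K L} (hx : x ∈ coneAlg K L (halfSpace i)) :
    comp (degAt i) N x = 0 := by
  refine torus_ext fun c => ?_
  rw [coeffAt_comp, coeffAt_zero]
  split_ifs with h
  · by_contra h0
    have := mem_halfSpace.1 (hx c (mem_supp.2 h0))
    rw [degAt_apply] at h
    omega
  · rfl

theorem mem_upper_of_mem_halfSpace {k : Fin r} {x : QTorus K L}
    (hx : x ∈ coneAlg K L (halfSpace (Fin.castAdd n k))) : x ∈ upper K L B k := by
  intro N
  rcases N.eq_zero_or_pos with rfl | hN
  · exact ⟨_, by rw [pow_zero, one_mul]⟩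
  · exact ⟨0, by rw [mul_zero, comp_eq_zero_of_mem_halfSpace (by omega) hx]⟩

theorem exch_mem_halfSpace {k : Fin r} {i : Fin (r + n)} (hi : i ≠ Fin.castAdd n k) :
    exch K L B k ∈ coneAlg K L (halfSpace i) := by
  refine Subalgebra.add_mem _ (mono_mem_coneAlg.2 ?_) (mono_mem_coneAlg.2 ?_)
  · have := posCol_nonneg (B := B) k i
    simpa [mem_halfSpace, mutVec_of_ne hi] using this
  · have := negCol_nonneg (B := B) k i
    simpa [mem_halfSpace, mutVec_of_ne hi] using this

namespace Compat

variable (h : Compat d L B)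
include h

theorem exch_degree (k : Fin r) :
    degAt (Fin.castAdd n k) (-mutVec n k + posCol k B) = -1 := by simp [h.posCol_self]

theorem exch_homogeneous (k : Fin r) : degAt (Fin.castAdd n k) (-mutVec n k + posCol k B) =
    degAt (Fin.castAdd n k) (-mutVec n k + negCol k B) := by
  simp [h.posCol_self, h.negCol_self]

theorem comp_exch_pow_mul (k : Fin r) (M : ℤ) (N : ℕ) (x : QTorus K L) :
    comp (degAt (Fin.castAdd n k)) M (exch K L B k ^ N * x) =
      exch K L B k ^ N * comp (degAt (Fin.castAdd n k)) (M + N) x := by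
  rw [exch, comp_binomial_pow_mul _ (h.exch_homogeneous k), h.exch_degree]
  congr 3
  ring

omit h in
-- The two exponents of the exchange binomial differ by column `k`, so it is `f`-homogeneous and
-- taking components preserves divisibility by its powers.
theorem comp_mem_upper {k : Fin r} {f : (Fin (r + n) → ℤ) →+ ℤ} (hf : f (col k B) = 0) (t : ℤ)
    {x : QTorus K L} (hx : x ∈ upper K L B k) : comp f t x ∈ upper K L B k := by
  intro N
  obtain ⟨a, ha⟩ := hx N
  have h1 : f (-mutVec n k + posCol k B) = f (-mutVec n k + negCol k B) := by
    rw [posCol_eq, map_add, map_add, map_add, hf, add_zero]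
  rw [comp_comp, ha, exch, comp_binomial_pow_mul f h1]
  exact ⟨_, rfl⟩

/-- The left side and the binomial power both have degree `-M`, so only the degree `0` part of the
quotient contributes. -/
theorem comp_eq_exch_pow_mul {k : Fin r} {M : ℕ} {a b : QTorus K L}
    (hb : comp (degAt (Fin.castAdd n k)) (-M) a = exch K L B k ^ M * b) :
    comp (degAt (Fin.castAdd n k)) (-M) a =
      exch K L B k ^ M * comp (degAt (Fin.castAdd n k)) 0 b := by
  have h2 := comp_comp_self (degAt (Fin.castAdd n k)) (-M) (-M) a
  rwa [if_pos rfl, hb, h.comp_exch_pow_mul, neg_add_cancel, ← hb, eq_comm] at h2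

theorem mem_upper_of_exch (k : Fin r) : exch K L B k ∈ upper K L B k := by
  intro N
  have h1 := h.comp_exch_pow_mul (K := K) k (-N) 1 1
  rw [pow_one, mul_one, one_eq_mono, comp_mono, map_zero] at h1
  rw [h1]
  split_ifs with h2
  · have : N = 1 := by push_cast at h2; omega
    exact ⟨1, by rw [this, ← one_eq_mono]; simp⟩
  · exact ⟨0, by simp⟩

theorem exch_pow_comm {k : Fin r} {c : Fin (r + n) → ℤ} (hc : c (Fin.castAdd n k) = 0) (N : ℕ) :
    ∃ s : ℤ, mono K L c * exch K L B k ^ N =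
      (LaurentPolynomial.T s : Coeff K) • (exch K L B k ^ N * mono K L c) := by
  induction N with
  | zero => exact ⟨0, by simp⟩
  | succ N ih =>
    obtain ⟨s, hs⟩ := ih
    rw [pow_succ, ← mul_assoc, hs, smul_mul_assoc, mul_assoc, h.exch_comm hc, mul_smul_comm,
      smul_smul, ← LaurentPolynomial.T_add, ← mul_assoc]
    exact ⟨_, rfl⟩

/-- `X_k` times the binomial is a sum of two monomials free of `X_k`. Each passes the remaining
powers up to a power of `q`, so `X_k` uses up just one power. -/
theorem mutVec_mul_exch_pow (k : Fin r) (N : ℕ) : ∃ b,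
    mono K L (mutVec n k) * exch K L B k ^ (N + 1) = exch K L B k ^ N * b := by
  obtain ⟨s, hs⟩ := h.exch_pow_comm (K := K) (h.posCol_self k) N
  obtain ⟨t, ht⟩ := h.exch_pow_comm (K := K) (h.negCol_self k) N
  rw [pow_succ', ← mul_assoc]
  conv in mono K L (mutVec n k) * exch K L B k =>
    rw [exch, mul_add, mono_mul_mono, mono_mul_mono, add_neg_cancel_left, add_neg_cancel_left]
  rw [add_mul, smul_mul_assoc, smul_mul_assoc, hs, ht, ← mul_smul_comm, ← mul_smul_comm,
    ← mul_smul_comm, ← mul_smul_comm, ← mul_add]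
  exact ⟨_, rfl⟩

theorem mono_mul_exch_pow {k : Fin r} {z : Fin (r + n) → ℤ} (t : ℕ)
    (hz : z (Fin.castAdd n k) = t) (N : ℕ) : ∃ b,
    mono K L z * exch K L B k ^ (N + t) = exch K L B k ^ N * b := by
  induction t generalizing z N with
  | zero =>
    obtain ⟨s, hs⟩ := h.exch_pow_comm (K := K) (k := k) (c := z) (by simpa using hz) N
    rw [add_zero, hs, ← mul_smul_comm]
    exact ⟨_, rfl⟩
  | succ t ih =>
    obtain ⟨b, hb⟩ := ih (z := z - mutVec n k) (by simp [hz]) (N + 1)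
    obtain ⟨b', hb'⟩ := h.mutVec_mul_exch_pow (K := K) k N
    rw [← add_sub_cancel (mutVec n k) z, mono_add, smul_mul_assoc, mul_assoc, ← add_assoc,
      add_right_comm, hb, ← mul_assoc, hb', mul_assoc, ← mul_smul_comm]
    exact ⟨_, rfl⟩

/-- A monomial of degree `t` in `X_k` costs `t` powers of the binomial when moved past them, but it
also raises degrees by `t`, so the part needed is divisible by `t` more powers. -/
theorem mono_mul_mem_upper {k : Fin r} {z : Fin (r + n) → ℤ} (hz : 0 ≤ z (Fin.castAdd n k))
    {x : QTorus K L} (hx : x ∈ upper K L B k) : mono K L z * x ∈ upper K L B k := by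
  intro N
  obtain ⟨t, ht⟩ := Int.eq_ofNat_of_zero_le hz
  obtain ⟨a, ha⟩ := hx (N + t)
  obtain ⟨b, hb⟩ := h.mono_mul_exch_pow (K := K) t ht N
  have h1 : -(N : ℤ) - degAt (Fin.castAdd n k) z = -((N + t : ℕ) : ℤ) := by
    rw [degAt_apply, ht]
    push_cast
    ring
  rw [comp_mono_mul, h1, ha, ← mul_assoc, hb, mul_assoc]
  exact ⟨_, rfl⟩

theorem exists_functional_ne_zero (k : Fin r) :
    ∃ f : (Fin (r + n) → ℤ) →+ ℤ, f (col k B) ≠ 0 := by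
  refine ⟨{ toFun := fun c => form L c (mutVec n k), map_zero' := form_zero_left _,
            map_add' := fun c c' => form_add_left _ _ _ }, ?_⟩
  have := h.pos k
  change form L (col k B) (mutVec n k) ≠ 0
  rw [h.form_col, mutVec_self]
  omega

/-- One of the two terms of the binomial does not involve `X_i`, so its inverse preserves
polynomiality in `X_i`. The binomial can then be cancelled by `mem_of_binomial_pow_mul_mem`. -/
theorem mem_halfSpace_of_exch_pow_mul {k : Fin r} {i : Fin (r + n)} (hi : i ≠ Fin.castAdd n k)
    {N : ℕ} {x : QTorus K L} (hx : exch K L B k ^ N * x ∈ coneAlg K L (halfSpace i)) :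
    x ∈ coneAlg K L (halfSpace i) := by
  obtain ⟨f, hf⟩ := h.exists_functional_ne_zero k
  rw [← posCol_sub_negCol, map_sub, sub_ne_zero] at hf
  have hstab : ∀ z : Fin (r + n) → ℤ, 0 ≤ z i →
      ∀ x ∈ (coneAlg K L (halfSpace i)).toSubmodule,
        mono K L z * x ∈ (coneAlg K L (halfSpace i)).toSubmodule := fun z hz x hx =>
    Subalgebra.mul_mem _ (mono_mem_coneAlg.2 hz) hx
  have hgr : ∀ t, ∀ x ∈ (coneAlg K L (halfSpace i)).toSubmodule,
      comp f t x ∈ (coneAlg K L (halfSpace i)).toSubmodule := fun t x hx =>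
    comp_mem_coneAlg f t hx
  have hp := posCol_nonneg (B := B) k i
  have hn := negCol_nonneg (B := B) k i
  rcases le_total (B i k) 0 with hB | hB
  · have h0 : posCol k B i = 0 := max_eq_right hB
    exact mem_of_binomial_pow_mul_mem f hgr (u := -mutVec n k + posCol k B)
      (v := -mutVec n k + negCol k B) (hstab _ (by simp [mutVec_of_ne hi, h0]))
      (hstab _ (by simpa [mutVec_of_ne hi] using hn)) (by simpa using hf) N hx
  · have h0 : negCol k B i = 0 := max_eq_right (by omega)
    rw [exch, add_comm (mono K L _)] at hx
    exact mem_of_binomial_pow_mul_mem f hgr (u := -mutVec n k + negCol k B)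
      (v := -mutVec n k + posCol k B) (hstab _ (by simp [mutVec_of_ne hi, h0]))
      (hstab _ (by simpa [mutVec_of_ne hi] using hp)) (by simpa using hf.symm) N hx

variable {D : Type*} [DivisionRing D] [Algebra (Coeff K) D] {ι : QTorus K L →ₐ[Coeff K] D}

/-- Mutating twice at the same index gives back the initial cluster variable. -/
theorem mutHom_exch (hι : Function.Injective ι) (k : Fin r) :
    h.mutHom hι k (exch K (mutateForm k B L) (mutateB k B) k) = ι (mono K L (mutVec n k)) := by
  have hW : ι (exch K L B k) ≠ 0 := (map_ne_zero_iff ι hι).2 (h.exch_ne_zero k)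
  have hx : ∀ x : Fin (r + n) → ℤ, x (Fin.castAdd n k) = 0 →
      h.mutHom hι k (mono K _ (-mutVec n k + x)) =
        (LaurentPolynomial.T (form L (-mutVec n k + negCol k B) x) : Coeff K) •
          ((ι (exch K L B k))⁻¹ * ι (mono K L x)) := by
    intro x hx
    have h1 : dropAt k (-mutVec n k + x) = x := by
      simp [dropAt, hx]
    rw [h.mutHom_mono, h1]
    simp [hx]
  rw [exch, posCol_mutateB_self, negCol_mutateB_self, map_add, hx _ (h.negCol_self k),
    hx _ (h.posCol_self k), ← mul_smul_comm, ← mul_smul_comm, ← mul_add, inv_mul_eq_iff_eq_mul₀ hW,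
    ← map_smul, ← map_smul, ← map_add, ← map_mul]
  congr 1
  rw [exch, add_mul, mono_mul_mono, mono_mul_mono, neg_add_cancel_comm, neg_add_cancel_comm,
    add_comm (_ • mono K L (posCol k B))]
  -- What remains is to match the powers of `q` in the exchange relation, term by term.
  have h1 : form L (-mutVec n k + negCol k B) (posCol k B) =
      form L (-mutVec n k + posCol k B) (mutVec n k) := by
    have h2 : form L (negCol k B) (posCol k B) = 0 := by
      rw [← h.form_posCol_negCol (h.posCol_self k), form_self h.skew]
    rw [form_add_left, h2, form_add_left, form_neg_left, form_neg_left, form_self h.skew,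
      form_swap h.skew (posCol k B)]
    ring
  have h3 : form L (-mutVec n k + negCol k B) (negCol k B) =
      form L (-mutVec n k + negCol k B) (mutVec n k) := by
    rw [form_add_left, form_add_left, form_neg_left, form_neg_left, form_self h.skew,
      form_self h.skew, form_swap h.skew (negCol k B)]
    ring
  rw [h1, h3]

/-- Multiplying by the `N`-th power of the new variable makes `a'` polynomial in it. The components
of the product are then given by `comp_expand`, and the extra `N` powers cancel. -/
theorem mem_upper_of_map_eq (hι : Function.Injective ι) {k : Fin r} {a : QTorus K L}
    {a' : QTorus K (mutateForm k B L)} (ha : ι a = h.mutHom hι k a') : a ∈ upper K L B k := by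
  obtain ⟨N, hN⟩ := exists_mono_mul_mem_halfSpace k a'
  replace hN := hN N le_rfl
  rw [← mono_pow (mutateForm_skew h.skew k)] at hN
  have h1 := h.map_expand hι k hN
  rw [map_mul (h.mutHom hι k), ← ha, map_pow,
    h.mutHom_mutVec, ← map_pow, ← map_mul] at h1
  intro M
  have h2 := h.comp_expand k hN (N + M)
  rw [hι h1, h.comp_exch_pow_mul, pow_add, mul_assoc] at h2
  have h3 := mul_left_cancel₀ (pow_ne_zero N (h.exch_ne_zero k)) h2
  rw [show -((N + M : ℕ) : ℤ) + N = -M by push_cast; ring] at h3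
  exact ⟨_, h3⟩

/-- An element of `upper` with nonnegative exponents in some directions has the same property in
the mutated seed. -/
theorem mem_map_of_mem_upper (hι : Function.Injective ι) {k : Fin r} {I : Set (Fin (r + n))}
    (hI : Fin.castAdd n k ∉ I) {a : QTorus K L} (ha : a ∈ upper K L B k)
    (haI : a ∈ coneAlg K L (nonnegOn I)) :
    ι a ∈ (coneAlg K (mutateForm k B L) (nonnegOn I)).map (h.mutHom hι k) := by
  set A := (coneAlg K (mutateForm k B L) (nonnegOn I)).map (h.mutHom hι k) with hA
  have hne : ∀ i ∈ I, i ≠ Fin.castAdd n k := fun i hi h0 => hI (h0 ▸ hi)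
  have hX : ι (mono K L (mutVec n k)) ∈ A := by
    rw [← h.mutHom_exch hι]
    exact ⟨_, mem_coneAlg_nonnegOn.2 fun i hi => exch_mem_halfSpace (hne i hi), rfl⟩
  have hW : ι (exch K L B k) ∈ A := by
    rw [← h.mutHom_mutVec hι]
    refine ⟨_, mono_mem_coneAlg.2 fun i hi => ?_, rfl⟩
    rw [mutVec_of_ne (hne i hi)]
  have hpos : ∀ x, x ∈ coneAlg K L (nonnegOn I) →
      x ∈ coneAlg K L (halfSpace (Fin.castAdd n k)) → ι x ∈ A := by
    intro x hx hx'
    refine mem_of_mono (A.toSubmodule.comap ι.toLinearMap) x fun c hc => ?_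
    change ι (mono K L c) ∈ A
    obtain ⟨N, hN⟩ := Int.eq_ofNat_of_zero_le (mem_halfSpace.1 (hx' c hc))
    rw [eq_smul_add_dropAt k c, mono_add, hN, natCast_zsmul, ← mono_pow h.skew, map_smul, map_mul,
      map_pow]
    refine A.smul_mem (A.mul_mem (A.pow_mem hX N) ?_) _
    rw [← h.mutHom_of_eq_zero hι (dropAt_self k c)]
    refine ⟨_, mono_mem_coneAlg.2 fun i hi => ?_, rfl⟩
    rw [dropAt_of_ne k c (hne i hi)]
    exact hx c hc i hi
  -- Split by degree in `X_k`. Parts of nonnegative degree are polynomial in `X_k`, itself an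
  -- exchange binomial of the mutated seed; parts of negative degree are powers of the new variable
  -- times a part free of `X_k`.
  refine mem_of_comp (degAt (Fin.castAdd n k)) (N := A.toSubmodule.comap ι.toLinearMap) fun N => ?_
  change ι (comp _ N a) ∈ A
  rcases le_or_gt 0 N with hN | hN
  · exact hpos _ (comp_mem_coneAlg _ _ haI) (comp_mem_halfSpace hN a)
  · obtain ⟨M, hM⟩ := Int.eq_ofNat_of_zero_le (neg_nonneg.2 hN.le)
    obtain rfl : N = -M := by omega
    obtain ⟨b, hb⟩ := ha M
    have h1 := h.comp_eq_exch_pow_mul hb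
    have h3 : comp (degAt (Fin.castAdd n k)) 0 b ∈ coneAlg K L (nonnegOn I) :=
      mem_coneAlg_nonnegOn.2 fun i hi => h.mem_halfSpace_of_exch_pow_mul (hne i hi)
        (mem_coneAlg_nonnegOn.1 (h1 ▸ comp_mem_coneAlg _ _ haI) i hi)
    rw [h1, map_mul, map_pow]
    exact A.mul_mem (A.pow_mem hW M) (hpos _ h3 (comp_mem_halfSpace le_rfl b))

end Compat

end Upper

section TwoStep

/-! ### Laurentness at a seed two mutations away -/

variable {K : Type*} [Field K] {r n : ℕ} {L : Matrix (Fin (r + n)) (Fin (r + n)) ℤ}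
  {B : Matrix (Fin (r + n)) (Fin r) ℤ} {d : Fin r → ℤ}

/-- Each factor `X^b` raises the degree in `X_i` by at least one, which already compensates the `-1`
of `X^c`. Only the term without `X^b` keeps a negative exponent. -/
theorem binomial_pow_mul_mono {m : ℕ} {L : Matrix (Fin m) (Fin m) ℤ} (hL : L.transpose = -L)
    {i : Fin m} {a b c : Fin m → ℤ} (ha : a i = 0) (hb : 0 < b i) (hc : c i = -1) (β : ℕ) :
    ∃ x ∈ coneAlg K L (halfSpace i),
      (mono K L a + mono K L b) ^ β * mono K L c = mono K L (β • a) * mono K L c + x := by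
  induction β with
  | zero => exact ⟨0, Subalgebra.zero_mem _, by simp [← one_eq_mono]⟩
  | succ β ih =>
    obtain ⟨x, hx, he⟩ := ih
    refine ⟨mono K L b * (mono K L (β • a) * mono K L c) + (mono K L a + mono K L b) * x,
      Subalgebra.add_mem _ ?_ (Subalgebra.mul_mem _ (Subalgebra.add_mem _ (mono_mem_coneAlg.2 ?_)
        (mono_mem_coneAlg.2 ?_)) hx), ?_⟩
    · rw [mono_mul_mono, mul_smul_comm, mono_mul_mono]
      refine Subalgebra.smul_mem _ (Subalgebra.smul_mem _ (mono_mem_coneAlg.2 ?_) _) _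
      rw [mem_halfSpace]
      simp [ha, hc]
      omega
    · exact ha.ge
    · exact hb.le
    · rw [pow_succ', mul_assoc, he, ← mono_pow hL, ← mono_pow hL, pow_succ']
      noncomm_ring

namespace Compat

variable (h : Compat d L B)
include h

theorem shifted_exch_mem_upper {k : Fin r} {s : Fin (r + n) → ℤ} (hs : s (Fin.castAdd n k) = 0) :
    mono K L (s + (-mutVec n k + posCol k B)) + mono K L (s + (-mutVec n k + negCol k B)) ∈
      upper K L B k := by
  have h1 : form L s (-mutVec n k + posCol k B) = form L s (-mutVec n k + negCol k B) := by
    rw [posCol_eq, ← add_assoc, form_add_right, h.form_col_right, hs]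
    simp
  rw [mono_add s, mono_add s (-mutVec n k + negCol k B), h1, ← smul_add, ← mul_add, ← exch]
  exact Submodule.smul_mem _ _ (h.mono_mul_mem_upper hs.ge (h.mem_upper_of_exch k))

variable {D : Type*} [DivisionRing D] [Algebra (Coeff K) D] {ι : QTorus K L →ₐ[Coeff K] D}

/-- A monomial of degree `-1` in `X_l`, polynomial in `X_k`, in terms of the seed mutated
at `k`, up to terms which are polynomial in `X_l`. -/
theorem map_mono_eq (hι : Function.Injective ι) {k l : Fin r} {a b c : Fin (r + n) → ℤ} {β : ℕ}
    (hβ : c (Fin.castAdd n k) = β)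
    (hab : exch K (mutateForm k B L) (mutateB k B) k = mono K _ a + mono K _ b)
    (ha : a (Fin.castAdd n l) = 0) (hb : 0 < b (Fin.castAdd n l))
    (hc : dropAt k c (Fin.castAdd n l) = -1)
    (hf : form (mutateForm k B L) a (dropAt k c) = form L (mutVec n k) (dropAt k c)) :
    ∃ x ∈ coneAlg K (mutateForm k B L) (halfSpace (Fin.castAdd n l)),
      ι (mono K L c) = h.mutHom hι k (mono K _ (β • a + dropAt k c) + x) := by
  obtain ⟨x, hx, he⟩ := binomial_pow_mul_mono (K := K) (mutateForm_skew (k := k) (B := B) h.skew)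
    ha hb hc β
  refine ⟨(LaurentPolynomial.T (-form L (β • mutVec n k) (dropAt k c)) : Coeff K) • x,
    Subalgebra.smul_mem _ hx _, ?_⟩
  have h1 : form (mutateForm k B L) (β • a) (dropAt k c) =
      form L (β • mutVec n k) (dropAt k c) := by
    rw [← natCast_zsmul, ← natCast_zsmul, form_smul_left, form_smul_left, hf]
  rw [mono_add (β • a), h1, ← smul_add, ← he, map_smul, map_mul, map_pow, ← hab,
    h.mutHom_exch, h.mutHom_of_eq_zero hι (dropAt_self k c), ← map_pow, ← map_mul, ← map_smul,
    mono_pow h.skew, ← mono_add]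
  conv_lhs => rw [eq_smul_add_dropAt k c, hβ, natCast_zsmul]

/-- For `β = |b_kl| > 0`, exactly one term of the binomial at `l` contains `X_k`, to the power `β`.
Substitute for `X_k` the exchange binomial of the mutated seed. Modulo elements polynomial in `X_l`,
only one monomial of its `β`-th power matters. Together with the other term it forms a monomial
multiple of the mutated seed's exchange binomial at `l`. If `b_kl = 0`, column `l` does not change.
-/
theorem exists_map_exch_eq (hι : Function.Injective ι) {k l : Fin r} (hkl : k ≠ l) :
    ∃ z ∈ upper K (mutateForm k B L) (mutateB k B) l,
      ι (exch K L B l) = h.mutHom hι k z := by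
  have h' := h.mutate k
  have hskew := h.skew_entry k l
  have hdk := h.pos k
  have hdl := h.pos l
  have hcol := h.col_mutateB hkl.symm
  have hpn := posCol_sub_negCol (B := B) l
  have hpn' := posCol_sub_negCol (B := mutateB k B) l
  have hk0 : mutVec n l (Fin.castAdd n k) = 0 := mutVec_castAdd_of_ne hkl
  have hl0 : mutVec n k (Fin.castAdd n l) = 0 := mutVec_castAdd_of_ne hkl.symm
  have hlne : Fin.castAdd n l ≠ Fin.castAdd n k := fun h0 => hkl (Fin.castAdd_injective r n h0).symm
  rcases lt_trichotomy (B (Fin.castAdd n k) l) 0 with hB | hB | hB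
  · obtain ⟨β, hβ⟩ := Int.eq_ofNat_of_zero_le (neg_nonneg.2 hB.le)
    -- By skew-symmetrizability `b_lk` has the sign opposite to `b_kl`; this decides which term of
    -- the binomial for `X_k` is free of `X_l`.
    have hlk : 0 < B (Fin.castAdd n l) k := by nlinarith
    have hneg : negCol l B (Fin.castAdd n k) = β := by
      rw [negCol, max_eq_left (by omega), hβ]
    have hpos : posCol l B (Fin.castAdd n k) = 0 := max_eq_right hB.le
    obtain ⟨x, hx, he⟩ := h.map_mono_eq hι (k := k) (l := l) (a := -mutVec n k + negCol k B)
      (b := -mutVec n k + posCol k B) (c := -mutVec n l + negCol l B) (β := β)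
      (by simp [hk0, hneg]) (by rw [exch, posCol_mutateB_self, negCol_mutateB_self])
      (by simp [hl0, negCol, hlk.le]) (by simp [hl0, posCol, hlk])
      (by rw [dropAt_of_ne _ _ hlne]; simp [h.negCol_self])
      (by
        rw [form_mutateForm, h.mutE_mulVec_of_eq_zero (dropAt_self _ _), h.mutE_mulVec,
          show (-mutVec n k + negCol k B) (Fin.castAdd n k) = -1 by simp [h.negCol_self]]
        congr 1
        module)
    refine ⟨mono K _ ((posCol l B - posCol l (mutateB k B)) +
        (-mutVec n l + posCol l (mutateB k B))) +
      mono K _ ((posCol l B - posCol l (mutateB k B)) +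
        (-mutVec n l + negCol l (mutateB k B))) + x,
      Submodule.add_mem _ (h'.shifted_exch_mem_upper
        (by simp [h.posCol_self, h'.posCol_self])) (mem_upper_of_mem_halfSpace hx), ?_⟩
    have e1 : posCol l B - posCol l (mutateB k B) + (-mutVec n l + posCol l (mutateB k B)) =
        -mutVec n l + posCol l B := by abel
    -- This identity of exponents is the matrix mutation rule for column `l`.
    have e2 : posCol l B - posCol l (mutateB k B) + (-mutVec n l + negCol l (mutateB k B)) =
        β • (-mutVec n k + negCol k B) + dropAt k (-mutVec n l + negCol l B) := by
      have e3 : (-mutVec n l + negCol l B) (Fin.castAdd n k) = β := by simp [hk0, hneg]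
      have e4 : max (B (Fin.castAdd n k) l) 0 = 0 := max_eq_right hB.le
      have e5 : max (-B (Fin.castAdd n k) l) 0 = β := by rw [max_eq_left (by omega), hβ]
      have e6 : B (Fin.castAdd n k) l = -β := by rw [eq_neg_iff_add_eq_zero]; omega
      rw [e4, e5, e6, ← hpn, ← hpn'] at hcol
      rw [dropAt, e3, eq_add_of_sub_eq hcol, ← natCast_zsmul]
      module
    rw [e1, e2, exch, map_add, he, ← h.mutHom_of_eq_zero hι (k := k) (c := -mutVec n l + posCol l B)
      (by simp [hk0, hpos]), ← map_add, add_assoc]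
  · have hlk : B (Fin.castAdd n l) k = 0 := by
      have : d l * B (Fin.castAdd n l) k = 0 := by
        have := h.skew_entry l k
        rw [hB] at this
        simpa using this
      exact (mul_eq_zero.1 this).resolve_left hdl.ne'
    have hcol' : col l (mutateB k B) = col l B := by rw [hcol, hB]; simp
    have hp : posCol l (mutateB k B) = posCol l B :=
      funext fun i => congrArg (fun t => max t 0) (congrFun hcol' i)
    have hn : negCol l (mutateB k B) = negCol l B :=
      funext fun i => congrArg (fun t => max (-t) 0) (congrFun hcol' i)
    refine ⟨_, h'.mem_upper_of_exch l, ?_⟩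
    rw [exch, exch, hp, hn, map_add, map_add, h.mutHom_of_eq_zero, h.mutHom_of_eq_zero]
    · simp [hk0, negCol, hB]
    · simp [hk0, posCol, hB]
  · obtain ⟨β, hβ⟩ := Int.eq_ofNat_of_zero_le hB.le
    have hlk : B (Fin.castAdd n l) k < 0 := by nlinarith
    have hpos : posCol l B (Fin.castAdd n k) = β := by
      rw [posCol, max_eq_left hB.le, hβ]
    have hneg : negCol l B (Fin.castAdd n k) = 0 := max_eq_right (by omega)
    obtain ⟨x, hx, he⟩ := h.map_mono_eq hι (k := k) (l := l) (a := -mutVec n k + posCol k B)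
      (b := -mutVec n k + negCol k B) (c := -mutVec n l + posCol l B) (β := β)
      (by simp [hk0, hpos])
      (by rw [exch, posCol_mutateB_self, negCol_mutateB_self, add_comm (mono K _ _)])
      (by simp [hl0, posCol, hlk.le]) (by simp [hl0, negCol, hlk])
      (by rw [dropAt_of_ne _ _ hlne]; simp [h.posCol_self])
      (by
        rw [form_mutateForm, h.mutE_mulVec_of_eq_zero (dropAt_self _ _), h.mutE_mulVec,
          show (-mutVec n k + posCol k B) (Fin.castAdd n k) = -1 by simp [h.posCol_self],
          posCol_eq k, show (-mutVec n k + (negCol k B + col k B) -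
            (2 * (-1 : ℤ)) • mutVec n k + (-1 : ℤ) • negCol k B) = mutVec n k + col k B by module,
          form_add_left, h.form_col, dropAt_self, mul_zero, add_zero])
    refine ⟨mono K _ ((negCol l B - negCol l (mutateB k B)) +
        (-mutVec n l + posCol l (mutateB k B))) +
      mono K _ ((negCol l B - negCol l (mutateB k B)) +
        (-mutVec n l + negCol l (mutateB k B))) + x,
      Submodule.add_mem _ (h'.shifted_exch_mem_upper
        (by simp [h.negCol_self, h'.negCol_self])) (mem_upper_of_mem_halfSpace hx), ?_⟩
    have e1 : negCol l B - negCol l (mutateB k B) + (-mutVec n l + negCol l (mutateB k B)) =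
        -mutVec n l + negCol l B := by abel
    have e2 : negCol l B - negCol l (mutateB k B) + (-mutVec n l + posCol l (mutateB k B)) =
        β • (-mutVec n k + posCol k B) + dropAt k (-mutVec n l + posCol l B) := by
      have e3 : (-mutVec n l + posCol l B) (Fin.castAdd n k) = β := by simp [hk0, hpos]
      have e4 : max (-B (Fin.castAdd n k) l) 0 = 0 := max_eq_right (by omega)
      have e5 : max (B (Fin.castAdd n k) l) 0 = β := by rw [max_eq_left hB.le, hβ]
      rw [e4, e5, hβ, ← hpn, ← hpn'] at hcol
      rw [dropAt, e3, eq_add_of_sub_eq hcol, ← natCast_zsmul]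
      module
    rw [e1, e2, exch, map_add, he, ← h.mutHom_of_eq_zero hι (k := k) (c := -mutVec n l + negCol l B)
      (by simp [hk0, hneg]), ← map_add, add_right_comm]

/-- Membership in `range` of the twice mutated frame. -/
theorem map_mem_range_of_mem_halfSpace (hι : Function.Injective ι) {k l : Fin r} (hkl : k ≠ l)
    {b : QTorus K L} (hb : b ∈ upper K L B l)
    (hbk : b ∈ coneAlg K L (halfSpace (Fin.castAdd n k))) :
    ∃ z ∈ upper K (mutateForm k B L) (mutateB k B) l, ι b = h.mutHom hι k z := by
  have h' := h.mutate k
  have hι' := h.mutHom_injective hι k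
  have hne : Fin.castAdd n k ≠ Fin.castAdd n l := fun h0 => hkl (Fin.castAdd_injective r n h0)
  set A := (h'.mutHom hι' l).range with hA
  -- It is enough that `b` be Laurent in the twice mutated seed. It is Laurent after the mutation at
  -- `k` because it is polynomial in `X_k`, and then `mem_upper_of_map_eq` applies in the mutated
  -- seed.
  suffices H : ι b ∈ A by
    obtain ⟨z, hz⟩ : ι b ∈ (h.mutHom hι k).range := by
      obtain ⟨z, -, hz⟩ := h.mem_map_of_mem_upper hι (I := ∅) (by simp)
        (mem_upper_of_mem_halfSpace hbk) (mem_coneAlg_nonnegOn_empty b)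
      exact ⟨z, hz⟩
    obtain ⟨z', hz'⟩ := H
    exact ⟨z, h'.mem_upper_of_map_eq hι' (hz.trans hz'.symm), hz.symm⟩
  have hup : ∀ z ∈ upper K (mutateForm k B L) (mutateB k B) l, h.mutHom hι k z ∈ A := by
    intro z hz
    obtain ⟨z', -, hz'⟩ := h'.mem_map_of_mem_upper hι' (I := ∅) (by simp) hz
      (mem_coneAlg_nonnegOn_empty z)
    exact ⟨z', hz'⟩
  have hpos : ∀ x, x ∈ coneAlg K L (halfSpace (Fin.castAdd n k)) →
      x ∈ coneAlg K L (halfSpace (Fin.castAdd n l)) → ι x ∈ A := by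
    intro x hxk hxl
    obtain ⟨z, hz, he⟩ := h.mem_map_of_mem_upper hι (I := {Fin.castAdd n l}) (by simpa using hne)
      (mem_upper_of_mem_halfSpace hxk) (mem_coneAlg_nonnegOn.2 (by simpa using hxl))
    rw [← he]
    exact hup z (mem_upper_of_mem_halfSpace (mem_coneAlg_nonnegOn.1 hz _ rfl))
  obtain ⟨w, hw, hwe⟩ := h.exists_map_exch_eq hι hkl
  have hW : ι (exch K L B l) ∈ A := hwe ▸ hup w hw
  -- Every component in `X_l` is a power of the exchange binomial at `l` times an element polynomial
  -- in both `X_k` and `X_l`.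
  refine mem_of_comp (degAt (Fin.castAdd n l)) (N := A.toSubmodule.comap ι.toLinearMap) fun N => ?_
  change ι (comp _ N b) ∈ A
  rcases le_or_gt 0 N with hN | hN
  · exact hpos _ (comp_mem_coneAlg _ _ hbk) (comp_mem_halfSpace hN b)
  · obtain ⟨M, hM⟩ := Int.eq_ofNat_of_zero_le (neg_nonneg.2 hN.le)
    obtain rfl : N = -M := by omega
    obtain ⟨c, hc⟩ := hb M
    have h1 := h.comp_eq_exch_pow_mul hc
    rw [h1, map_mul, map_pow]
    exact A.mul_mem (A.pow_mem hW M) (hpos _ (h.mem_halfSpace_of_exch_pow_mul hne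
      (h1 ▸ comp_mem_coneAlg _ _ hbk)) (comp_mem_halfSpace le_rfl c))

/-- Left multiplication by a power of `X_k` reduces to elements polynomial in `X_k`. In the mutated
seed that power is a power of the exchange binomial at `k`, which has to be cancelled modulo `upper`
at `l`. A functional that kills column `l` but not column `k` grades `upper` and separates the two
terms. One of them is free of `X_l`, so multiplication by its inverse is allowed. -/
theorem mem_upper_mutate (hι : Function.Injective ι) {k l : Fin r} (hkl : k ≠ l)
    {a : QTorus K L} (ha : a ∈ upper K L B l) {a' : QTorus K (mutateForm k B L)}
    (haa' : ι a = h.mutHom hι k a') : a' ∈ upper K (mutateForm k B L) (mutateB k B) l := by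
  have h' := h.mutate k
  obtain ⟨N, hN⟩ := exists_mono_mul_mem_halfSpace k a
  obtain ⟨z, hz, he⟩ := h.map_mem_range_of_mem_halfSpace hι hkl
    (h.mono_mul_mem_upper (z := N • mutVec n k) (by simp [mutVec_castAdd_of_ne hkl.symm]) ha)
    (hN N le_rfl)
  rw [map_mul, haa', ← mono_pow h.skew, map_pow, ← h.mutHom_exch hι, ← map_pow, ← map_mul] at he
  rw [← h.mutHom_injective hι k he] at hz
  obtain ⟨f, hfl, hfk⟩ := h'.exists_functional hkl
  rw [← posCol_sub_negCol, map_sub, sub_ne_zero] at hfk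
  have hlne : mutVec n k (Fin.castAdd n l) = 0 := mutVec_castAdd_of_ne hkl.symm
  have hp := posCol_nonneg (B := mutateB k B) k (Fin.castAdd n l)
  have hn := negCol_nonneg (B := mutateB k B) k (Fin.castAdd n l)
  rcases le_total (mutateB k B (Fin.castAdd n l) k) 0 with hB | hB
  · have h0 : posCol k (mutateB k B) (Fin.castAdd n l) = 0 := max_eq_right hB
    exact mem_of_binomial_pow_mul_mem f (fun t x hx => comp_mem_upper hfl t hx)
      (u := -mutVec n k + posCol k (mutateB k B)) (v := -mutVec n k + negCol k (mutateB k B))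
      (fun x hx => h'.mono_mul_mem_upper (by simp [hlne, h0]) hx)
      (fun x hx => h'.mono_mul_mem_upper (by simpa [hlne] using hn) hx) (by simpa using hfk) N hz
  · have h0 : negCol k (mutateB k B) (Fin.castAdd n l) = 0 := max_eq_right (by omega)
    rw [exch, add_comm (mono K _ _)] at hz
    exact mem_of_binomial_pow_mul_mem f (fun t x hx => comp_mem_upper hfl t hx)
      (u := -mutVec n k + negCol k (mutateB k B)) (v := -mutVec n k + posCol k (mutateB k B))
      (fun x hx => h'.mono_mul_mem_upper (by simp [hlne, h0]) hx)
      (fun x hx => h'.mono_mul_mem_upper (by simpa [hlne] using hp) hx) (by simpa using hfk.symm)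
      N hz

end Compat

end TwoStep

section Frames

/-! ### Toric frames -/

variable {K : Type*} [Field K]

theorem prod_ofFn_mono {m N : ℕ} {Λ : Matrix (Fin m) (Fin m) ℤ} (v : Fin N → Fin m → ℤ) :
    (List.ofFn fun i => mono K Λ (v i)).prod =
      (LaurentPolynomial.T (∑ i, ∑ j ∈ Finset.Iio i, form Λ (v j) (v i)) : Coeff K) •
        mono K Λ (∑ i, v i) := by
  induction N with
  | zero => simp [one_eq_mono]
  | succ N ih =>
    have h1 : ∀ i : Fin N, ∑ j ∈ Finset.Iio i.castSucc, form Λ (v j) (v i.castSucc) =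
        ∑ j ∈ Finset.Iio i, form Λ (v j.castSucc) (v i.castSucc) := by
      intro i
      rw [← Fin.map_castSuccEmb_Iio, Finset.sum_map]
      rfl
    have h2 : ∑ j ∈ Finset.Iio (Fin.last N), form Λ (v j) (v (Fin.last N)) =
        form Λ (∑ j : Fin N, v j.castSucc) (v (Fin.last N)) := by
      have h3 : form Λ (∑ j : Fin N, v j.castSucc) (v (Fin.last N)) =
          ∑ j : Fin N, form Λ (v j.castSucc) (v (Fin.last N)) :=
        map_sum ({ toFun := fun c => form Λ c (v (Fin.last N)), map_zero' := form_zero_left _,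
                   map_add' := fun _ _ => form_add_left _ _ _ } : (Fin m → ℤ) →+ ℤ) _ _
      rw [h3, Fin.Iio_last_eq_map, Finset.sum_map]
      rfl
    rw [List.ofFn_succ', List.concat_eq_append, List.prod_append, List.prod_singleton, ih,
      smul_mul_assoc, mono_mul_mono, smul_smul, ← LaurentPolynomial.T_add, Fin.sum_univ_castSucc,
      Fin.sum_univ_castSucc, h2]
    simp only [h1]

theorem map_mono_smul {m : ℕ} {Λ : Matrix (Fin m) (Fin m) ℤ} (hΛ : Λ.transpose = -Λ) {D : Type*}
    [DivisionRing D] [Algebra (Coeff K) D] (ι : QTorus K Λ →ₐ[Coeff K] D) (c : Fin m → ℤ) (a : ℤ) :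
    ι (mono K Λ (a • c)) = ι (mono K Λ c) ^ a := by
  obtain ⟨N, rfl | rfl⟩ := a.eq_nat_or_neg
  · rw [natCast_zsmul, ← mono_pow hΛ, map_pow, zpow_natCast]
  · have h1 : ι (mono K Λ (-(N • c))) * ι (mono K Λ (N • c)) = 1 := by
      rw [← map_mul, mono_mul_mono, form_neg_left, form_self hΛ, neg_add_cancel, ← one_eq_mono]
      simp
    rw [neg_smul, natCast_zsmul, zpow_neg, zpow_natCast, ← map_pow, mono_pow hΛ]
    exact eq_inv_of_mul_eq_one_left h1

variable {r n : ℕ} {Λ : Matrix (Fin (r + n)) (Fin (r + n)) ℤ} {d : Fin r → ℤ}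

/-- The toric frame of a seed is given by an embedding of the quantum torus of its form, and the
seed is compatible. -/
structure QSeed.IsToric (S : QSeed K Λ) (d : Fin r → ℤ)
    (ι : QTorus K S.L →ₐ[Coeff K] QFrac K Λ) : Prop where
  compat : Compat d S.L S.B
  injective : Function.Injective ι
  map_single : ∀ i, ι (mono K S.L (Pi.single i 1)) = S.X i

/-! ### Laurent elements and upper bounds of a quantum seed. -/

namespace QSeed

/-- The span of the elements of the toric frame with exponents in a cone. -/
noncomputable def laurentSpan (S : QSeed K Λ) (C : AddSubmonoid (Fin (r + n) → ℤ)) :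
    Submodule (Coeff K) (QFrac K Λ) := Submodule.span (Coeff K) (S.frame '' C)

namespace IsToric

variable {S : QSeed K Λ} {ι : QTorus K S.L →ₐ[Coeff K] QFrac K Λ} (h : S.IsToric d ι)
include h

/-- By skew-symmetry, the normalizing power of `q` in the frame cancels the power produced by
multiplying the variables in increasing order. -/
theorem frame_eq (c : Fin (r + n) → ℤ) : S.frame c = ι (mono K S.L c) := by
  have h1 : (fun i => S.X i ^ c i) = fun i => ι (mono K S.L (c i • Pi.single i 1)) := by
    funext i
    rw [map_mono_smul h.compat.skew, h.map_single]
  have h2 : (∑ i, c i • (Pi.single i 1 : Fin (r + n) → ℤ)) = c := by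
    funext j
    simp [Finset.sum_apply, Pi.single_apply]
  have h3 : (List.ofFn fun i => ι (mono K S.L (c i • Pi.single i 1))) =
      (List.ofFn fun i => mono K S.L (c i • Pi.single i 1)).map ι := by
    rw [List.map_ofFn]
    rfl
  rw [frame, h1, h3, ← map_list_prod, prod_ofFn_mono, h2, map_smul, smul_smul,
    ← LaurentPolynomial.T_add, ← Finset.sum_add_distrib]
  have h4 : ∀ i, (∑ j ∈ Finset.Iio i, c i * c j * S.L i j) + ∑ j ∈ Finset.Iio i,
      form S.L (c j • Pi.single j 1) (c i • Pi.single i 1) = 0 := by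
    intro i
    rw [← Finset.sum_add_distrib]
    refine Finset.sum_eq_zero fun j _ => ?_
    have h5 : S.L j i = -S.L i j := by
      simpa using congrFun (congrFun h.compat.skew i) j
    rw [form_smul_left, form_smul_right, form_single_single, h5]
    ring
  rw [Finset.sum_eq_zero fun i _ => h4 i, LaurentPolynomial.T_zero, one_smul]

theorem mem_laurentSpan {C : AddSubmonoid (Fin (r + n) → ℤ)} {y : QFrac K Λ} :
    y ∈ S.laurentSpan C ↔ ∃ a ∈ coneAlg K S.L C, ι a = y := by
  constructor
  · intro hy
    have : S.laurentSpan C ≤ ((coneAlg K S.L C).map ι).toSubmodule := by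
      rw [laurentSpan, Submodule.span_le]
      rintro _ ⟨c, hc, rfl⟩
      exact ⟨_, mono_mem_coneAlg.2 hc, (h.frame_eq c).symm⟩
    exact this hy
  · rintro ⟨a, ha, rfl⟩
    refine map_mem_of_mem_coneAlg ι.toLinearMap _ (fun c hc => ?_) ha
    exact Submodule.subset_span ⟨c, hc, h.frame_eq c⟩

theorem map_exch (k : Fin r) :
    (S.mutate k).X (Fin.castAdd n k) = ι (exch K S.L S.B k) := by
  rw [exch, map_add, ← h.frame_eq, ← h.frame_eq]
  exact Function.update_self _ _ _

theorem mutate (k : Fin r) : (S.mutate k).IsToric d (h.compat.mutHom h.injective k) where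
  compat := h.compat.mutate k
  injective := h.compat.mutHom_injective h.injective k
  map_single i := by
    by_cases hi : i = Fin.castAdd n k
    · subst hi
      rw [h.map_exch]
      exact h.compat.mutHom_mutVec h.injective k
    · have h1 : (S.mutate k).X i = S.X i := Function.update_of_ne hi _ _
      rw [h1, ← h.map_single]
      exact h.compat.mutHom_of_eq_zero h.injective (Pi.single_eq_of_ne' hi 1)

/-- Mutation of seeds is involutive. -/
theorem mutate_mutate (k : Fin r) : (S.mutate k).mutate k = S := by
  have hX : ((S.mutate k).mutate k).X = S.X := by
    funext i
    by_cases hi : i = Fin.castAdd n k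
    · subst hi
      rw [(h.mutate k).map_exch, ← h.map_single]
      exact h.compat.mutHom_exch h.injective k
    · exact (Function.update_of_ne hi _ _).trans (Function.update_of_ne hi _ _)
  cases S
  simp only [QSeed.mutate] at hX ⊢
  congr 1
  · exact h.compat.mutateForm_mutateForm k
  · exact h.compat.mutateB_mutateB k

end IsToric

/-- The elements which are Laurent polynomials in a seed and all adjacent ones, and in which
the variables from `I` do not occur with negative exponents. -/
def upperBound (S : QSeed K Λ) (I : Set (Fin (r + n))) : Set (QFrac K Λ) :=
  {y | y ∈ S.laurentSpan (nonnegOn I) ∧ ∀ k, y ∈ (S.mutate k).laurentSpan ⊤}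

namespace IsToric

variable {S : QSeed K Λ} {ι : QTorus K S.L →ₐ[Coeff K] QFrac K Λ} (h : S.IsToric d ι)
include h

theorem mem_laurentSpan_mutate_iff {k : Fin r} {a : QTorus K S.L} :
    ι a ∈ (S.mutate k).laurentSpan ⊤ ↔ a ∈ upper K S.L S.B k := by
  rw [(h.mutate k).mem_laurentSpan]
  constructor
  · rintro ⟨a', -, ha'⟩
    exact h.compat.mem_upper_of_map_eq h.injective ha'.symm
  · intro ha
    obtain ⟨a', -, ha'⟩ := h.compat.mem_map_of_mem_upper h.injective (I := ∅) (by simp) ha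
      (mem_coneAlg_nonnegOn_empty a)
    exact ⟨a', fun _ _ => AddSubmonoid.mem_top _, ha'⟩

theorem mem_laurentSpan_mutate {k : Fin r} {I : Set (Fin (r + n))} (hI : Fin.castAdd n k ∉ I)
    {y : QFrac K Λ} (hy : y ∈ S.laurentSpan (nonnegOn I)) (hy' : y ∈ (S.mutate k).laurentSpan ⊤) :
    y ∈ (S.mutate k).laurentSpan (nonnegOn I) := by
  obtain ⟨a, ha, rfl⟩ := h.mem_laurentSpan.1 hy
  rw [h.mem_laurentSpan_mutate_iff] at hy'
  exact (h.mutate k).mem_laurentSpan.2 (h.compat.mem_map_of_mem_upper h.injective hI hy' ha)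

/-- Of the neighbours of the mutated seed, the one in direction `k` is the old seed by involutivity;
the others are handled by `mem_upper_mutate`. -/
theorem upperBound_subset_mutate {I : Set (Fin (r + n))} (hI : ∀ k, Fin.castAdd n k ∉ I)
    (k : Fin r) : S.upperBound I ⊆ (S.mutate k).upperBound I := by
  rintro y ⟨hy, hy'⟩
  have h1 := h.mem_laurentSpan_mutate (hI k) hy (hy' k)
  refine ⟨h1, fun l => ?_⟩
  by_cases hkl : k = l
  · subst hkl
    rw [h.mutate_mutate k]
    obtain ⟨a, -, rfl⟩ := h.mem_laurentSpan.1 hy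
    exact h.mem_laurentSpan.2 ⟨a, fun _ _ => AddSubmonoid.mem_top _, rfl⟩
  · obtain ⟨a, -, rfl⟩ := h.mem_laurentSpan.1 hy
    obtain ⟨a', -, ha'⟩ := (h.mutate k).mem_laurentSpan.1 (hy' k)
    rw [← ha', (h.mutate k).mem_laurentSpan_mutate_iff]
    exact h.compat.mem_upper_mutate h.injective hkl (h.mem_laurentSpan_mutate_iff.1 (hy' l))
      ha'.symm

theorem upperBound_mutate {I : Set (Fin (r + n))} (hI : ∀ k, Fin.castAdd n k ∉ I)
    (k : Fin r) : (S.mutate k).upperBound I = S.upperBound I := by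
  refine (h.upperBound_subset_mutate hI k).antisymm' ?_
  have h1 := (h.mutate k).upperBound_subset_mutate hI k
  rwa [h.mutate_mutate k] at h1

theorem X_mem_laurentSpan (I : Set (Fin (r + n))) (i) : S.X i ∈ S.laurentSpan (nonnegOn I) := by
  rw [h.mem_laurentSpan]
  refine ⟨_, mono_mem_coneAlg.2 fun j _ => ?_, h.map_single i⟩
  by_cases hij : j = i
  · subst hij; simp
  · simp [hij]

theorem X_mem_upperBound {I : Set (Fin (r + n))} (i : Fin (r + n)) :
    S.X i ∈ S.upperBound I := by
  refine ⟨h.X_mem_laurentSpan I i, fun k => ?_⟩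
  rw [← h.map_single, h.mem_laurentSpan_mutate_iff]
  by_cases hi : i = Fin.castAdd n k
  · subst hi
    exact mem_upper_of_mem_halfSpace (mono_mem_coneAlg.2 (by simp [mem_halfSpace]))
  · exact mem_upper_of_mem_halfSpace (mono_mem_coneAlg.2 (by simp [mem_halfSpace, Ne.symm hi]))

end IsToric

end QSeed

/-- The embedding of the initial quantum torus in its skew field of fractions. -/
noncomputable def toQFracAlg (K : Type*) [Field K] {m : ℕ} (Λ : Matrix (Fin m) (Fin m) ℤ) :
    QTorus K Λ →ₐ[Coeff K] QFrac K Λ :=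
  { toQFrac K Λ with
    commutes' := fun _ => rfl }

theorem toQFracAlg_injective {m : ℕ} {Λ : Matrix (Fin m) (Fin m) ℤ} :
    Function.Injective (toQFracAlg K Λ) :=
  OreLocalization.numeratorHom_inj inf_le_left

theorem QSeed.IsToric.initial {B : Matrix (Fin (r + n)) (Fin r) ℤ} (h : Compat d Λ B) :
    (QSeed.initial K Λ B).IsToric d (toQFracAlg K Λ) where
  compat := h
  injective := toQFracAlg_injective
  map_single _ := rfl

end Frames

section Specialization

/-! ### Specialization at `q = 1` -/

variable {K : Type*} [Field K]

/-- The evaluation `q^{1/2} ↦ 1`. -/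
noncomputable def evalOne (K : Type*) [Field K] : Coeff K →+* K :=
  LaurentPolynomial.eval₂ (RingHom.id K) 1

@[simp]
theorem evalOne_T (a : ℤ) : evalOne K (LaurentPolynomial.T a) = 1 := by simp [evalOne]

@[simp]
theorem evalOne_C (a : K) : evalOne K (LaurentPolynomial.C a) = a := by simp [evalOne]

/-- An algebra over `K`, as an algebra over `R` through the evaluation `q^{1/2} ↦ 1`. -/
noncomputable abbrev specAlgebra (K : Type*) [Field K] (A : Type*) [Semiring A] [Algebra K A] :
    Algebra (Coeff K) A := Algebra.compHom A (evalOne K)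

/-- With `R` acting through `q^{1/2} = 1`, specializations become `R`-algebra homomorphisms and can
be defined on monomials. -/
noncomputable instance {m : ℕ} : Algebra (Coeff K) (CTorus K m) := specAlgebra K _

theorem smul_CTorus {m : ℕ} (c : Coeff K) (x : CTorus K m) : c • x = evalOne K c • x := rfl

theorem smul_CFrac {m : ℕ} (c : Coeff K) (x : CFrac K m) : c • x = evalOne K c • x := by
  rw [← one_smul (CTorus K m) x, ← smul_assoc, smul_CTorus, smul_assoc]

theorem cmono_mul {m : ℕ} (c c' : Fin m → ℤ) : cmono K c * cmono K c' = cmono K (c + c') := by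
  simp [cmono, AddMonoidAlgebra.single_mul_single]

/-- The specialization of the quantum torus at `q = 1`. -/
noncomputable def spec (K : Type*) [Field K] {m : ℕ} (Λ : Matrix (Fin m) (Fin m) ℤ) :
    QTorus K Λ →ₐ[Coeff K] CTorus K m :=
  monoHom (cmono K) rfl fun c c' => by rw [smul_CTorus, evalOne_T, one_smul, cmono_mul]

@[simp]
theorem spec_mono {m : ℕ} {Λ : Matrix (Fin m) (Fin m) ℤ} (c : Fin m → ℤ) :
    spec K Λ (mono K Λ c) = cmono K c := monoHom_mono _ _ _ c

/-- The specialization at `q = 1` of the quantum torus of a seed with given cluster variables. -/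
noncomputable def seedSpec {m : ℕ} (Λ : Matrix (Fin m) (Fin m) ℤ) (x : Fin m → CFrac K m)
    (hx : ∀ i, x i ≠ 0) : QTorus K Λ →ₐ[Coeff K] CFrac K m :=
  monoHom (fun c => ∏ i, x i ^ c i) (by simp) fun c c' => by
    rw [smul_CFrac, evalOne_T, one_smul, ← Finset.prod_mul_distrib]
    exact Finset.prod_congr rfl fun i _ => (zpow_add₀ (hx i) _ _).symm

theorem seedSpec_mono {m : ℕ} {Λ : Matrix (Fin m) (Fin m) ℤ} {x : Fin m → CFrac K m}
    (hx : ∀ i, x i ≠ 0) (c : Fin m → ℤ) :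
    seedSpec Λ x hx (mono K Λ c) = ∏ i, x i ^ c i := monoHom_mono _ _ _ c

theorem seedSpec_mono_single {m : ℕ} {Λ : Matrix (Fin m) (Fin m) ℤ} {x : Fin m → CFrac K m}
    (hx : ∀ i, x i ≠ 0) (i : Fin m) : seedSpec Λ x hx (mono K Λ (Pi.single i 1)) = x i := by
  rw [seedSpec_mono, Finset.prod_eq_single i]
  · simp
  · intro j _ hj
    simp [hj]
  · simp

variable {r n : ℕ} {L : Matrix (Fin (r + n)) (Fin (r + n)) ℤ}
  {B : Matrix (Fin (r + n)) (Fin r) ℤ} {d : Fin r → ℤ}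

/-- The specializations of the quantum tori of adjacent seeds agree on common elements. -/
theorem Compat.spec_eq_of_map_eq (h : Compat d L B) {D : Type*} [DivisionRing D]
    [Algebra (Coeff K) D] {ι : QTorus K L →ₐ[Coeff K] D} (hι : Function.Injective ι) {k : Fin r}
    {ρ : QTorus K L →ₐ[Coeff K] CFrac K (r + n)}
    {ρ' : QTorus K (mutateForm k B L) →ₐ[Coeff K] CFrac K (r + n)}
    (h0 : ∀ c, c (Fin.castAdd n k) = 0 → ρ' (mono K _ c) = ρ (mono K L c))
    (hk : ρ' (mono K _ (mutVec n k)) = ρ (exch K L B k))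
    {a : QTorus K L} {a' : QTorus K (mutateForm k B L)} (ha : ι a = h.mutHom hι k a') :
    ρ a = ρ' a' := by
  have hsk := mutateForm_skew (k := k) (B := B) h.skew
  have hexp : ∀ z ∈ coneAlg K (mutateForm k B L) (halfSpace (Fin.castAdd n k)),
      ρ (expand K L B k z) = ρ' z := by
    intro z hz
    refine eq_of_mem_coneAlg (φ := ρ.toLinearMap ∘ₗ expand K L B k) (ψ := ρ'.toLinearMap)
      (fun c hc => ?_) hz
    change ρ (expand K L B k (mono K _ c)) = ρ' (mono K _ c)
    obtain ⟨N, hN⟩ := Int.eq_ofNat_of_zero_le (mem_halfSpace.1 hc)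
    rw [expand, monoLin_mono, hN, Int.toNat_natCast, map_smul, map_mul, map_pow, ← hk,
      ← h0 _ (dropAt_self k c), ← map_pow, mono_pow hsk]
    conv_rhs => rw [eq_smul_add_dropAt k c, mono_add, hN, natCast_zsmul, map_smul, map_mul]
    simp only [smul_CFrac, evalOne_T]
  obtain ⟨N, hN⟩ := exists_mono_mul_mem_halfSpace k a'
  replace hN := hN N le_rfl
  have h1 := h.map_expand hι k hN
  rw [map_mul (h.mutHom hι k), ← ha, ← mono_pow hsk, map_pow, h.mutHom_mutVec, ← map_pow,
    ← map_mul] at h1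
  have h2 := hexp _ hN
  rw [← mono_pow hsk, hι h1, map_mul, map_mul, map_pow, map_pow, hk] at h2
  -- The new variable is a unit of the mutated torus, so its specialization is nonzero and can be
  -- cancelled.
  refine mul_left_cancel₀ (pow_ne_zero N ?_) h2
  rw [← hk]
  intro h3
  have h4 : mono K (mutateForm k B L) (-mutVec n k) * mono K _ (mutVec n k) = 1 := by
    rw [mono_mul_mono, form_neg_left, form_self hsk, neg_add_cancel, ← one_eq_mono]
    simp
  have h5 := congrArg ρ' h4
  rw [map_mul, h3, mul_zero, map_one] at h5
  exact zero_ne_one h5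

/-! ### Positivity of cluster variables at `x = 1` -/

/-- The augmentation of the Laurent polynomial ring. -/
noncomputable def augment (K : Type*) [Field K] (m : ℕ) : CTorus K m →ₐ[K] K :=
  AddMonoidAlgebra.lift K K (Fin m → ℤ) 1

theorem augment_cmono {m : ℕ} (c : Fin m → ℤ) : augment K m (cmono K c) = 1 := by
  simp [augment, cmono]

/-- Rational functions with a positive rational value at `x = 1`. -/
def IsPositive {m : ℕ} (f : CFrac K m) : Prop :=
  ∃ (a b : CTorus K m) (α β : ℚ), 0 < α ∧ 0 < β ∧ augment K m a = α ∧ augment K m b = β ∧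
    f * algebraMap _ _ b = algebraMap _ _ a

namespace IsPositive

variable {m : ℕ} {f g : CFrac K m}

theorem one : IsPositive (1 : CFrac K m) := ⟨1, 1, 1, 1, by simp⟩

theorem cmono (c : Fin m → ℤ) : IsPositive (algebraMap _ (CFrac K m) (cmono K c)) :=
  ⟨QuantumCluster.cmono K c, 1, 1, 1, by simp [augment_cmono]⟩

variable [CharZero K]

theorem mul (hf : IsPositive f) (hg : IsPositive g) : IsPositive (f * g) := by
  obtain ⟨a, b, α, β, hα, hβ, ha, hb, h⟩ := hf
  obtain ⟨a', b', α', β', hα', hβ', ha', hb', h'⟩ := hg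
  refine ⟨a * a', b * b', α * α', β * β', mul_pos hα hα', mul_pos hβ hβ',
    by rw [map_mul, ha, ha', Rat.cast_mul], by rw [map_mul, hb, hb', Rat.cast_mul], ?_⟩
  rw [map_mul, map_mul, ← h, ← h']
  ring

theorem pow (hf : IsPositive f) (N : ℕ) : IsPositive (f ^ N) := by
  induction N with
  | zero => rw [pow_zero]; exact one
  | succ N ih => rw [pow_succ]; exact ih.mul hf

theorem prod {ι : Type*} (s : Finset ι) {f : ι → CFrac K m} (hf : ∀ i, IsPositive (f i)) :
    IsPositive (∏ i ∈ s, f i) :=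
  Finset.prod_induction f IsPositive (fun _ _ => mul) one fun i _ => hf i

theorem add (hf : IsPositive f) (hg : IsPositive g) : IsPositive (f + g) := by
  obtain ⟨a, b, α, β, hα, hβ, ha, hb, h⟩ := hf
  obtain ⟨a', b', α', β', hα', hβ', ha', hb', h'⟩ := hg
  refine ⟨a * b' + a' * b, b * b', α * β' + α' * β, β * β', by positivity, mul_pos hβ hβ',
    by simp [ha, ha', hb, hb'], by simp [hb, hb'], ?_⟩
  rw [map_mul, map_add, map_mul, map_mul, ← h, ← h']
  ring

theorem ne_zero (hf : IsPositive f) : f ≠ 0 := by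
  rintro rfl
  obtain ⟨a, b, α, β, hα, hβ, ha, hb, h⟩ := hf
  rw [zero_mul, eq_comm, FaithfulSMul.algebraMap_eq_zero_iff] at h
  rw [h, map_zero, eq_comm, Rat.cast_eq_zero] at ha
  exact hα.ne' ha

theorem inv (hf : IsPositive f) : IsPositive f⁻¹ := by
  have h0 := hf.ne_zero
  obtain ⟨a, b, α, β, hα, hβ, ha, hb, h⟩ := hf
  exact ⟨b, a, β, α, hβ, hα, hb, ha, by rw [← h, inv_mul_cancel_left₀ h0]⟩

theorem zpow (hf : IsPositive f) (N : ℤ) : IsPositive (f ^ N) := by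
  obtain ⟨M, rfl | rfl⟩ := N.eq_nat_or_neg
  · rw [zpow_natCast]; exact hf.pow M
  · rw [zpow_neg, zpow_natCast]; exact (hf.pow M).inv

end IsPositive

/-! ### Quantum seeds and seeds with the same mutation history -/

variable {Λ : Matrix (Fin (r + n)) (Fin (r + n)) ℤ}

/-- Quantum seeds and seeds obtained from the initial ones by the same mutations. -/
inductive PairReachable (B : Matrix (Fin (r + n)) (Fin r) ℤ) : QSeed K Λ → Seed K r n → Prop
  | init : PairReachable B (QSeed.initial K Λ B) (Seed.initial K B)
  | step (S : QSeed K Λ) (s : Seed K r n) (k : Fin r) : PairReachable B S s →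
      PairReachable B (S.mutate k) (s.mutate k)

theorem PairReachable.left {S : QSeed K Λ} {s : Seed K r n} (h : PairReachable B S s) :
    QSeed.Reachable K Λ B S := by
  induction h with
  | init => exact .init
  | step S s k _ ih => exact .step S k ih

theorem Seed.Reachable.exists_pair (Λ : Matrix (Fin (r + n)) (Fin (r + n)) ℤ) {s : Seed K r n}
    (h : Seed.Reachable K B s) : ∃ S : QSeed K Λ, PairReachable B S s := by
  induction h with
  | init => exact ⟨_, .init⟩
  | step s k _ ih => exact ih.imp' (fun S => S.mutate k) fun S hS => .step S s k hS

theorem PairReachable.right {S : QSeed K Λ} {s : Seed K r n} (h : PairReachable B S s) :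
    Seed.Reachable K B s := by
  induction h with
  | init => exact .init
  | step S s k _ ih => exact .step s k ih

theorem PairReachable.B_eq {S : QSeed K Λ} {s : Seed K r n} (h : PairReachable B S s) :
    s.B = S.B := by
  induction h with
  | init => rfl
  | step S s k _ ih => exact congrArg (mutateB k) ih

/-- Mutation is subtraction-free, so values at `x = 1` stay positive rationals. In characteristic
`0` this shows that cluster variables are nonzero. -/
theorem Seed.Reachable.isPositive [CharZero K] {s : Seed K r n} (h : Seed.Reachable K B s) (i) :
    IsPositive (s.x i) := by
  induction h generalizing i with
  | init => exact IsPositive.cmono _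
  | step s k _ ih =>
    by_cases hi : i = Fin.castAdd n k
    · subst hi
      have h1 : (s.mutate k).x (Fin.castAdd n k) = _ := Function.update_self _ _ _
      rw [h1, div_eq_mul_inv]
      exact ((IsPositive.prod _ fun i => (ih i).zpow _).add
        (IsPositive.prod _ fun i => (ih i).zpow _)).mul (ih _).inv
    · have h1 : (s.mutate k).x i = s.x i := Function.update_of_ne hi _ _
      rw [h1]
      exact ih i

theorem QSeed.Reachable.exists_isToric (hc : Compat d Λ B) {S : QSeed K Λ}
    (h : QSeed.Reachable K Λ B S) : ∃ ι, S.IsToric d ι := by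
  induction h with
  | init => exact ⟨_, QSeed.IsToric.initial hc⟩
  | step S k _ ih => exact let ⟨_, h⟩ := ih; ⟨_, h.mutate k⟩

theorem seedSpec_exch {x : Fin (r + n) → CFrac K (r + n)} (hx : ∀ i, x i ≠ 0) (k : Fin r) :
    seedSpec L x hx (exch K L B k) =
      (∏ i, x i ^ posCol k B i + ∏ i, x i ^ negCol k B i) / x (Fin.castAdd n k) := by
  have h1 : ∀ c : Fin (r + n) → ℤ, seedSpec L x hx (mono K L (-mutVec n k + c)) =
      (∏ i, x i ^ c i) / x (Fin.castAdd n k) := by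
    intro c
    rw [eq_div_iff (hx _), ← seedSpec_mono_single (Λ := L) hx, ← seedSpec_mono (Λ := L) hx,
      ← map_mul, mono_mul_mono, map_smul, smul_CFrac, evalOne_T, one_smul]
    congr 2
    change -mutVec n k + c + mutVec n k = c
    abel
  rw [exch, map_add, h1, h1, add_div]

theorem QSeed.IsToric.unique {S : QSeed K Λ} {ι ι' : QTorus K S.L →ₐ[Coeff K] QFrac K Λ}
    (h : S.IsToric d ι) (h' : S.IsToric d ι') : ι = ι' := by
  have : ι.toLinearMap = ι'.toLinearMap :=
    torus_hom_ext fun c => (h.frame_eq c).symm.trans (h'.frame_eq c)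
  exact AlgHom.toLinearMap_injective this

theorem prod_initial_zpow (B : Matrix (Fin (r + n)) (Fin r) ℤ) (c : Fin (r + n) → ℤ) :
    ∏ i, (Seed.initial K B).x i ^ c i = algebraMap _ (CFrac K (r + n)) (cmono K c) := by
  -- The zero form is skew-symmetric, so the rule for powers of monomials in a quantum torus also
  -- applies to commutative monomials.
  let φ : QTorus K (0 : Matrix (Fin (r + n)) (Fin (r + n)) ℤ) →ₐ[Coeff K] CFrac K (r + n) :=
    (IsScalarTower.toAlgHom (Coeff K) (CTorus K (r + n)) (CFrac K (r + n))).comp (spec K _)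
  have hφ : ∀ c, φ (mono K _ c) = algebraMap _ (CFrac K (r + n)) (cmono K c) := fun c => by
    simp [φ]
  have h1 : ∀ (s : Finset (Fin (r + n))), ∏ i ∈ s, (Seed.initial K B).x i ^ c i =
      algebraMap _ (CFrac K (r + n)) (cmono K (∑ i ∈ s, c i • Pi.single i 1)) := by
    intro s
    induction s using Finset.cons_induction with
    | empty => exact (map_one (algebraMap (CTorus K (r + n)) (CFrac K (r + n)))).symm
    | cons i s hi ih =>
      rw [Finset.prod_cons, Finset.sum_cons, ih, ← cmono_mul, map_mul, ← hφ (c i • _),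
        map_mono_smul (by simp), hφ]
      rfl
  rw [h1]
  congr 2
  funext j
  simp [Finset.sum_apply, Pi.single_apply]

theorem seedSpec_initial (B : Matrix (Fin (r + n)) (Fin r) ℤ)
    (hx : ∀ i, (Seed.initial K B).x i ≠ 0) (b : QTorus K Λ) :
    seedSpec Λ (Seed.initial K B).x hx b = algebraMap _ (CFrac K (r + n)) (spec K Λ b) := by
  have : (seedSpec Λ (Seed.initial K B).x hx).toLinearMap =
      ((IsScalarTower.toAlgHom (Coeff K) (CTorus K (r + n)) (CFrac K (r + n))).comp
        (spec K Λ)).toLinearMap := by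
    refine torus_hom_ext fun c => ?_
    simp only [AlgHom.toLinearMap_apply, AlgHom.comp_apply, spec_mono, seedSpec_mono,
      prod_initial_zpow]
    rfl
  exact congrArg (fun f => f b) this

/-- The elements of the initial quantum torus which are Laurent polynomials in all quantum seeds
specialize compatibly in all seeds. -/
theorem PairReachable.seedSpec_eq [CharZero K] (hc : Compat d Λ B) {S : QSeed K Λ}
    {s : Seed K r n} (h : PairReachable B S s) {b : QTorus K Λ}
    (hb : ∀ S, QSeed.Reachable K Λ B S → toQFrac K Λ b ∈ S.laurentSpan ⊤)
    (hx : ∀ i, s.x i ≠ 0) (ι : QTorus K S.L →ₐ[Coeff K] QFrac K Λ) (hι : S.IsToric d ι)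
    (a : QTorus K S.L) (hab : ι a = toQFrac K Λ b) :
    seedSpec S.L s.x hx a = algebraMap _ (CFrac K (r + n)) (spec K Λ b) := by
  induction h with
  | init =>
    rw [hι.unique (QSeed.IsToric.initial hc)] at hab
    rw [toQFracAlg_injective hab]
    exact seedSpec_initial B hx b
  | step S s k hS ih =>
    obtain ⟨ι₀, h₀⟩ := hS.left.exists_isToric hc
    rw [hι.unique (h₀.mutate k)] at hab
    -- Laurentness in the intermediate seed supplies the expression through which the two adjacent
    -- specializations are compared.
    obtain ⟨a₀, -, ha₀⟩ := h₀.mem_laurentSpan.1 (hb S hS.left)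
    have hx₀ : ∀ i, s.x i ≠ 0 := fun i => (hS.right.isPositive i).ne_zero
    rw [← ih hx₀ ι₀ h₀ a₀ ha₀]
    refine (h₀.compat.spec_eq_of_map_eq h₀.injective (k := k) (ρ := seedSpec S.L s.x hx₀)
      (ρ' := seedSpec (mutateForm k S.B S.L) (s.mutate k).x hx) (fun c hck => ?_) ?_
      (ha₀.trans hab.symm)).symm
    · rw [seedSpec_mono, seedSpec_mono]
      refine Finset.prod_congr rfl fun i _ => ?_
      by_cases hi : i = Fin.castAdd n k
      · rw [hi, hck, zpow_zero, zpow_zero]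
      · have h1 : (s.mutate k).x i = s.x i := Function.update_of_ne hi _ _
        rw [h1]
    · have h1 : (s.mutate k).x (Fin.castAdd n k) = _ := Function.update_self _ _ _
      rw [mutVec, seedSpec_mono_single, seedSpec_exch, h1, hS.B_eq]

/-- The frozen directions in which the variables are not invertible. -/
def polyDirs (r : ℕ) (J : Set (Fin n)) : Set (Fin (r + n)) := Fin.natAdd r '' Jᶜ

theorem castAdd_notMem_polyDirs (J : Set (Fin n)) (k : Fin r) :
    Fin.castAdd n k ∉ polyDirs r J := by
  rintro ⟨j, -, hj⟩
  have := congrArg Fin.val hj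
  simp at this
  omega

theorem seedSpec_mem_laurent {s : Seed K r n} (hx : ∀ i, s.x i ≠ 0) {J : Set (Fin n)}
    {a : QTorus K L} (ha : a ∈ coneAlg K L (nonnegOn (polyDirs r J))) :
    seedSpec L s.x hx a ∈ s.laurent J := by
  let N : Submodule (Coeff K) (CFrac K (r + n)) :=
    { (s.laurent J).toSubmodule.toAddSubmonoid with
      smul_mem' := fun c x hx => by
        rw [smul_CFrac]
        exact (s.laurent J).smul_mem hx _ }
  refine map_mem_of_mem_coneAlg (seedSpec L s.x hx).toLinearMap N (fun c hc => ?_) ha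
  change seedSpec L s.x hx (mono K L c) ∈ s.laurent J
  rw [seedSpec_mono]
  refine Subalgebra.prod_mem _ fun i _ => ?_
  have hmem : s.x i ∈ s.laurent J := Algebra.subset_adjoin (Or.inl (Or.inl ⟨i, rfl⟩))
  have hz : (s.x i)⁻¹ ∈ s.laurent J ∨ 0 ≤ c i := by
    refine Fin.addCases (motive := fun i => (s.x i)⁻¹ ∈ s.laurent J ∨ 0 ≤ c i) (fun k => ?_)
      (fun j => ?_) i
    · exact Or.inl (Algebra.subset_adjoin (Or.inl (Or.inr ⟨k, rfl⟩)))
    · by_cases hj : j ∈ J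
      · exact Or.inl (Algebra.subset_adjoin (Or.inr ⟨j, hj, rfl⟩))
      · exact Or.inr (hc _ ⟨j, hj, rfl⟩)
  obtain ⟨N, hN | hN⟩ := (c i).eq_nat_or_neg
  · rw [hN, zpow_natCast]
    exact Subalgebra.pow_mem _ hmem N
  · rcases hz with hz | hz
    · rw [hN, zpow_neg, zpow_natCast, ← inv_pow]
      exact Subalgebra.pow_mem _ hz N
    · obtain ⟨M, hM⟩ := Int.eq_ofNat_of_zero_le hz
      rw [hM, zpow_natCast]
      exact Subalgebra.pow_mem _ hmem M

/-- The elements of the initial quantum torus which are Laurent polynomials in all quantum seeds. -/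
noncomputable def quantumUpper (K : Type*) [Field K] (Λ : Matrix (Fin (r + n)) (Fin (r + n)) ℤ)
    (B : Matrix (Fin (r + n)) (Fin r) ℤ) (J : Set (Fin n)) : Set (QTorus K Λ) :=
  {b | ∀ S, QSeed.Reachable K Λ B S → toQFrac K Λ b ∈ S.laurentSpan (nonnegOn (polyDirs r J))}

theorem QSeed.laurentSpan_mono (S : QSeed K Λ) {C C' : AddSubmonoid (Fin (r + n) → ℤ)}
    (h : C ≤ C') : S.laurentSpan C ≤ S.laurentSpan C' :=
  Submodule.span_mono (Set.image_mono h)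

/-- Specializing the expansion in a quantum seed gives a Laurent polynomial in the matching
classical seed, and by `seedSpec_eq` the result does not depend on the seed. -/
theorem spec_mem_upperClusterAlgebra [CharZero K] (hc : Compat d Λ B) {J : Set (Fin n)}
    {b : QTorus K Λ} (hb : b ∈ quantumUpper K Λ B J) :
    algebraMap _ (CFrac K (r + n)) (spec K Λ b) ∈ upperClusterAlgebra K B J := by
  rw [upperClusterAlgebra, Algebra.mem_iInf]
  intro s
  rw [Algebra.mem_iInf]
  intro hs
  obtain ⟨S, hSs⟩ := hs.exists_pair Λ
  obtain ⟨ι, hι⟩ := hSs.left.exists_isToric hc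
  obtain ⟨a, ha, hab⟩ := hι.mem_laurentSpan.1 (hb S hSs.left)
  have hx : ∀ i, s.x i ≠ 0 := fun i => (hs.isPositive i).ne_zero
  rw [← hSs.seedSpec_eq hc (fun S hS => S.laurentSpan_mono le_top (hb S hS)) hx ι hι a hab]
  exact seedSpec_mem_laurent hx ha

end Specialization

section QuantumLaurent

variable {K : Type*} [Field K]

/-! ### Divisibility by `q^{1/2} - 1` -/

/-- The element `q^{1/2} - 1`. -/
noncomputable def uniformizer (K : Type*) [Field K] : Coeff K := LaurentPolynomial.T 1 - 1

theorem uniformizer_ne_zero : uniformizer K ≠ 0 := by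
  intro h
  rw [uniformizer, sub_eq_zero, ← LaurentPolynomial.T_zero] at h
  have := AddMonoidAlgebra.single_left_injective (one_ne_zero (α := K)) h
  exact one_ne_zero this

theorem uniformizer_dvd_T_sub_one (a : ℤ) : uniformizer K ∣ LaurentPolynomial.T a - 1 := by
  have hnat : ∀ N : ℕ, uniformizer K ∣ LaurentPolynomial.T (N : ℤ) - 1 := by
    intro N
    have h1 := sub_dvd_pow_sub_pow (LaurentPolynomial.T 1 : Coeff K) 1 N
    rwa [LaurentPolynomial.T_pow, one_pow, mul_one] at h1
  obtain ⟨N, rfl | rfl⟩ := a.eq_nat_or_neg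
  · exact hnat N
  · have h1 : (LaurentPolynomial.T (-(N : ℤ)) - 1 : Coeff K) =
        -LaurentPolynomial.T (-(N : ℤ)) * (LaurentPolynomial.T (N : ℤ) - 1) := by
      rw [neg_mul, mul_sub, ← LaurentPolynomial.T_add]
      simp
    rw [h1]
    exact (hnat N).mul_left _

theorem uniformizer_dvd_sub_evalOne (c : Coeff K) :
    uniformizer K ∣ c - LaurentPolynomial.C (evalOne K c) := by
  induction c using LaurentPolynomial.induction_on' with
  | add p q hp hq =>
    have : p + q - LaurentPolynomial.C (evalOne K (p + q)) =
        (p - LaurentPolynomial.C (evalOne K p)) + (q - LaurentPolynomial.C (evalOne K q)) := by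
      rw [map_add, map_add]
      ring
    rw [this]
    exact dvd_add hp hq
  | C_mul_T a k =>
    rw [map_mul, evalOne_C, evalOne_T, mul_one]
    have : (LaurentPolynomial.C k * LaurentPolynomial.T a - LaurentPolynomial.C k : Coeff K) =
        LaurentPolynomial.C k * (LaurentPolynomial.T a - 1) := by ring
    rw [this]
    exact (uniformizer_dvd_T_sub_one a).mul_left _

theorem evalOne_uniformizer : evalOne K (uniformizer K) = 0 := by
  simp [uniformizer]

variable {m : ℕ} {Λ : Matrix (Fin m) (Fin m) ℤ}

theorem spec_uniformizer_smul (x : QTorus K Λ) : spec K Λ (uniformizer K • x) = 0 := by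
  rw [map_smul, smul_CTorus, evalOne_uniformizer, zero_smul]

theorem uniformizer_smul_injective :
    Function.Injective fun x : QTorus K Λ => uniformizer K • x := by
  intro x y h
  refine torus_ext fun c => ?_
  have h1 := congrArg (fun x => coeffAt x c) h
  simp only [coeffAt_smul] at h1
  exact mul_left_cancel₀ uniformizer_ne_zero h1

theorem coeff_spec (x : QTorus K Λ) (c : Fin m → ℤ) :
    (spec K Λ x).coeff c = evalOne K (coeffAt x c) := by
  conv_lhs => rw [eq_sum x]
  conv_rhs => rw [eq_sum x]
  simp only [map_sum, map_smul, coeffAt_sum, coeffAt_smul, coeffAt_mono, spec_mono, smul_CTorus]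
  simp only [cmono, apply_ite]
  by_cases h : coeffAt x c = 0 <;> simp [Finsupp.single_apply, mem_supp, h]

/-- The kernel of the specialization at `q = 1`. -/
theorem exists_eq_uniformizer_smul {x : QTorus K Λ} (hx : spec K Λ x = 0) :
    ∃ y, x = uniformizer K • y := by
  have h1 : ∀ c, uniformizer K ∣ coeffAt x c := by
    intro c
    have h2 := uniformizer_dvd_sub_evalOne (coeffAt x c)
    rw [← coeff_spec, hx] at h2
    simpa using h2
  choose y hy using h1
  refine ⟨∑ c ∈ supp x, y c • mono K Λ c, ?_⟩
  conv_lhs => rw [eq_sum x]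
  rw [Finset.smul_sum]
  exact Finset.sum_congr rfl fun c _ => by rw [smul_smul, ← hy]

theorem uniformizer_smul_mem_coneAlg {C : AddSubmonoid (Fin m → ℤ)} {x : QTorus K Λ} :
    uniformizer K • x ∈ coneAlg K Λ C ↔ x ∈ coneAlg K Λ C := by
  refine forall_congr' fun c => ?_
  rw [mem_supp, mem_supp, coeffAt_smul, mul_ne_zero_iff_left uniformizer_ne_zero]

variable {r n : ℕ} {L : Matrix (Fin (r + n)) (Fin (r + n)) ℤ}
  {B : Matrix (Fin (r + n)) (Fin r) ℤ} {d : Fin r → ℤ}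

theorem Compat.spec_exch_ne_zero (h : Compat d L B) (k : Fin r) : spec K L (exch K L B k) ≠ 0 := by
  intro h0
  have hne : posCol k B ≠ negCol k B := by
    intro h1
    have h2 := h.form_col k (mutVec n k)
    rw [← posCol_sub_negCol, h1, sub_self, form_zero_left, mutVec_self] at h2
    have := h.pos k
    omega
  have h1 := congrArg (fun x => x.coeff (-mutVec n k + posCol k B)) h0
  simp [exch, cmono, hne.symm] at h1

/-- Modulo `p` the torus is a commutative domain in which the exchange binomial is nonzero. So if
`p` divides a power of the binomial times `a`, it divides `a`. -/
theorem Compat.mem_upper_of_uniformizer_smul (h : Compat d L B) {k : Fin r} {x : QTorus K L}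
    (hx : uniformizer K • x ∈ upper K L B k) : x ∈ upper K L B k := by
  intro N
  obtain ⟨a, ha⟩ := hx N
  rw [map_smul] at ha
  have h1 := congrArg (spec K L) ha
  rw [spec_uniformizer_smul, map_mul, map_pow, eq_comm, mul_eq_zero] at h1
  obtain ⟨b, rfl⟩ := exists_eq_uniformizer_smul
    (h1.resolve_left (pow_ne_zero N (h.spec_exch_ne_zero k)))
  rw [mul_smul_comm] at ha
  exact ⟨b, uniformizer_smul_injective ha⟩

/-! ### The quantum Laurent phenomenon -/

variable {Λ : Matrix (Fin (r + n)) (Fin (r + n)) ℤ}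

theorem QSeed.Reachable.upperBound_eq (hc : Compat d Λ B) {I : Set (Fin (r + n))}
    (hI : ∀ k, Fin.castAdd n k ∉ I) {S : QSeed K Λ} (h : QSeed.Reachable K Λ B S) :
    S.upperBound I = (QSeed.initial K Λ B).upperBound I := by
  induction h with
  | init => rfl
  | step S k hS ih =>
    obtain ⟨ι, hι⟩ := hS.exists_isToric hc
    rw [hι.upperBound_mutate hI, ih]

theorem QSeed.Reachable.X_natAdd_eq {S : QSeed K Λ} (h : QSeed.Reachable K Λ B S) (j : Fin n) :
    S.X (Fin.natAdd r j) = (QSeed.initial K Λ B).X (Fin.natAdd r j) := by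
  induction h with
  | init => rfl
  | step S k hS ih =>
    have hne : Fin.natAdd r j ≠ Fin.castAdd n k := by
      intro h0
      have := congrArg Fin.val h0
      simp at this
      omega
    exact (Function.update_of_ne hne _ _).trans ih

theorem QSeed.IsToric.inv_X {S : QSeed K Λ} {ι : QTorus K S.L →ₐ[Coeff K] QFrac K Λ}
    (h : S.IsToric d ι) (i : Fin (r + n)) : (S.X i)⁻¹ = ι (mono K S.L (-Pi.single i 1)) := by
  rw [← h.map_single, ← zpow_neg_one, ← map_mono_smul h.compat.skew, neg_one_smul]

/-- The Laurent phenomenon for quantum cluster algebras. -/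
theorem mem_laurentSpan_of_mem_quantumClusterAlgebra (hc : Compat d Λ B) {J : Set (Fin n)}
    {y : QFrac K Λ} (hy : y ∈ quantumClusterAlgebra K Λ B J) {S : QSeed K Λ}
    (hS : QSeed.Reachable K Λ B S) : y ∈ S.laurentSpan (nonnegOn (polyDirs r J)) := by
  obtain ⟨ι, hι⟩ := hS.exists_isToric hc
  have hle : quantumClusterAlgebra K Λ B J ≤
      (coneAlg K S.L (nonnegOn (polyDirs r J))).map ι := by
    refine Algebra.adjoin_le ?_
    rintro y (⟨S', hS', i, rfl⟩ | ⟨j, hj, rfl⟩)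
    · obtain ⟨ι', hι'⟩ := hS'.exists_isToric hc
      have h1 := hι'.X_mem_upperBound (I := polyDirs r J) i
      -- All seeds have the same upper bound, so a variable of `S'` is Laurent in `S`.
      rw [hS'.upperBound_eq hc (castAdd_notMem_polyDirs J),
        ← hS.upperBound_eq hc (castAdd_notMem_polyDirs J)] at h1
      exact hι.mem_laurentSpan.1 h1.1
    · rw [← hS.X_natAdd_eq, hι.inv_X]
      refine ⟨_, mono_mem_coneAlg.2 ?_, rfl⟩
      rintro _ ⟨j', hj', rfl⟩
      have hne : Fin.natAdd r j' ≠ Fin.natAdd r j := by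
        intro h0
        rw [Fin.natAdd_inj] at h0
        exact hj' (h0 ▸ hj)
      simp [hne]
  exact hι.mem_laurentSpan.2 (hle hy)

/-- The quantum cluster algebra, as a subalgebra of the initial quantum torus. -/
noncomputable def torusClusterAlgebra (K : Type*) [Field K]
    (Λ : Matrix (Fin (r + n)) (Fin (r + n)) ℤ) (B : Matrix (Fin (r + n)) (Fin r) ℤ)
    (J : Set (Fin n)) : Subalgebra (Coeff K) (QTorus K Λ) :=
  (quantumClusterAlgebra K Λ B J).comap (toQFracAlg K Λ)

theorem mem_torusClusterAlgebra {J : Set (Fin n)} {b : QTorus K Λ} :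
    b ∈ torusClusterAlgebra K Λ B J ↔ toQFracAlg K Λ b ∈ quantumClusterAlgebra K Λ B J := Iff.rfl

theorem exists_toQFrac_eq (hc : Compat d Λ B) {J : Set (Fin n)}
    {y : QFrac K Λ} (hy : y ∈ quantumClusterAlgebra K Λ B J) :
    ∃ b ∈ torusClusterAlgebra K Λ B J, toQFracAlg K Λ b = y := by
  obtain ⟨b, -, rfl⟩ := (QSeed.IsToric.initial hc).mem_laurentSpan.1
    (mem_laurentSpan_of_mem_quantumClusterAlgebra hc hy .init)
  exact ⟨b, hy, rfl⟩

theorem mem_quantumUpper_of_mem (hc : Compat d Λ B) {J : Set (Fin n)} {b : QTorus K Λ}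
    (hb : b ∈ torusClusterAlgebra K Λ B J) : b ∈ quantumUpper K Λ B J := fun _ hS =>
  mem_laurentSpan_of_mem_quantumClusterAlgebra hc hb hS

/-- The quantum upper cluster algebra is saturated with respect to `q^{1/2} - 1`. -/
theorem mem_quantumUpper_of_uniformizer_smul (hc : Compat d Λ B) {J : Set (Fin n)}
    {b : QTorus K Λ} (hb : uniformizer K • b ∈ quantumUpper K Λ B J) :
    b ∈ quantumUpper K Λ B J := by
  intro S hS
  -- The induction carries only Laurentness; polynomiality in the frozen directions is then read off
  -- from `p b`, whose support agrees with that of `b`.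
  suffices H : ∀ ι, S.IsToric d ι → ∃ a, ι a = toQFracAlg K Λ b by
    obtain ⟨ι, hι⟩ := hS.exists_isToric hc
    obtain ⟨a, ha⟩ := H ι hι
    obtain ⟨a', ha', he⟩ := hι.mem_laurentSpan.1 (hb S hS)
    have h1 : a' = uniformizer K • a := hι.injective
      (he.trans ((map_smul (toQFracAlg K Λ) _ b).trans (by rw [map_smul ι, ha])))
    rw [h1, uniformizer_smul_mem_coneAlg] at ha'
    exact hι.mem_laurentSpan.2 ⟨a, ha', ha⟩
  induction hS with
  | init =>
    intro ι hι
    exact ⟨b, by rw [hι.unique (QSeed.IsToric.initial hc)]; rfl⟩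
  | step S k hS ih =>
    intro ι' hι'
    obtain ⟨ι, hι⟩ := hS.exists_isToric hc
    rw [hι'.unique (hι.mutate k)]
    obtain ⟨a, ha⟩ := ih ι hι
    have h1 : ι (uniformizer K • a) ∈ (S.mutate k).laurentSpan ⊤ := by
      rw [map_smul, ha]
      have h2 := (S.mutate k).laurentSpan_mono le_top (hb _ (.step S k hS))
      rwa [← map_smul (toQFracAlg K Λ)]
    rw [hι.mem_laurentSpan_mutate_iff] at h1
    have h2 := hι.mem_laurentSpan_mutate_iff.2 (hι.compat.mem_upper_of_uniformizer_smul h1)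
    obtain ⟨a', -, ha'⟩ := (hι.mutate k).mem_laurentSpan.1 h2
    exact ⟨a', ha'.trans ha⟩

theorem mem_quantumUpper_of_uniformizer_pow_smul (hc : Compat d Λ B) {J : Set (Fin n)} (N : ℕ)
    {b : QTorus K Λ} (hb : uniformizer K ^ N • b ∈ quantumUpper K Λ B J) :
    b ∈ quantumUpper K Λ B J := by
  induction N with
  | zero => simpa using hb
  | succ N ih =>
    rw [pow_succ', mul_smul] at hb
    exact ih (mem_quantumUpper_of_uniformizer_smul hc hb)

/-! ### The specialization of the quantum cluster algebra -/

/-- The specialization at `q = 1` with values in the field of rational functions. -/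
noncomputable def specFrac (K : Type*) [Field K] {m : ℕ} (Λ : Matrix (Fin m) (Fin m) ℤ) :
    QTorus K Λ →ₐ[Coeff K] CFrac K m :=
  (IsScalarTower.toAlgHom (Coeff K) (CTorus K m) (CFrac K m)).comp (spec K Λ)

theorem specFrac_apply {m : ℕ} {Λ : Matrix (Fin m) (Fin m) ℤ} (b : QTorus K Λ) :
    specFrac K Λ b = algebraMap _ (CFrac K m) (spec K Λ b) := rfl

theorem specFrac_eq_zero_iff {m : ℕ} {Λ : Matrix (Fin m) (Fin m) ℤ} {b : QTorus K Λ} :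
    specFrac K Λ b = 0 ↔ spec K Λ b = 0 := by
  rw [specFrac_apply, FaithfulSMul.algebraMap_eq_zero_iff]

theorem specFrac_mem [CharZero K] (hc : Compat d Λ B) {J : Set (Fin n)}
    (hupper : clusterAlgebra K B J = upperClusterAlgebra K B J) {b : QTorus K Λ}
    (hb : b ∈ quantumUpper K Λ B J) : specFrac K Λ b ∈ clusterAlgebra K B J := by
  rw [hupper]
  exact spec_mem_upperClusterAlgebra hc hb

/-- The image of the quantum cluster algebra is a `K`-algebra containing all generators: a quantum
cluster variable specializes to the classical one with the same mutation history. The equality with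
the upper cluster algebra plays no role here. -/
theorem exists_specFrac_eq [CharZero K] (hc : Compat d Λ B) {J : Set (Fin n)}
    {z : CFrac K (r + n)} (hz : z ∈ clusterAlgebra K B J) :
    ∃ b ∈ torusClusterAlgebra K Λ B J, specFrac K Λ b = z := by
  let A : Subalgebra K (CFrac K (r + n)) :=
    { ((torusClusterAlgebra K Λ B J).map (specFrac K Λ)).toSubsemiring with
      algebraMap_mem' := fun a => by
        refine ⟨algebraMap (Coeff K) _ (LaurentPolynomial.C a),
          Subalgebra.algebraMap_mem _ _, ?_⟩
        change specFrac K Λ (algebraMap (Coeff K) _ (LaurentPolynomial.C a)) = _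
        rw [AlgHom.commutes, Algebra.algebraMap_eq_smul_one, smul_CFrac, evalOne_C,
          ← Algebra.algebraMap_eq_smul_one] }
  have hle : clusterAlgebra K B J ≤ A := by
    refine Algebra.adjoin_le ?_
    rintro z (⟨s, hs, i, rfl⟩ | ⟨j, hj, rfl⟩)
    · obtain ⟨S, hSs⟩ := hs.exists_pair Λ
      obtain ⟨ι, hι⟩ := hSs.left.exists_isToric hc
      have hX : S.X i ∈ quantumClusterAlgebra K Λ B J :=
        Algebra.subset_adjoin (Or.inl ⟨S, hSs.left, i, rfl⟩)
      obtain ⟨b, hb, he⟩ := exists_toQFrac_eq hc hX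
      refine ⟨b, hb, ?_⟩
      have hx : ∀ i, s.x i ≠ 0 := fun i => (hs.isPositive i).ne_zero
      rw [← seedSpec_mono_single (Λ := S.L) hx i]
      exact (hSs.seedSpec_eq hc (fun S hS => S.laurentSpan_mono le_top
        (mem_quantumUpper_of_mem hc hb S hS)) hx ι hι _ ((hι.map_single i).trans he.symm)).symm
    · have hinv : ((QSeed.initial K Λ B).X (Fin.natAdd r j))⁻¹ ∈ quantumClusterAlgebra K Λ B J :=
        Algebra.subset_adjoin (Or.inr ⟨j, hj, rfl⟩)
      rw [(QSeed.IsToric.initial hc).inv_X] at hinv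
      refine ⟨_, hinv, ?_⟩
      change specFrac K Λ (mono K Λ (-Pi.single (Fin.natAdd r j) 1)) = _
      rw [specFrac_apply, spec_mono]
      refine eq_inv_of_mul_eq_one_left ?_
      change _ * algebraMap _ _ (cmono K _) = _
      rw [← map_mul, cmono_mul, neg_add_cancel]
      exact map_one _
  exact hle hz

end QuantumLaurent

section Grading

/-! ### Gradings of the quantum cluster algebra -/

variable {K : Type*} [Field K]

theorem algHom_ext_single {m : ℕ} {Λ : Matrix (Fin m) (Fin m) ℤ} (hΛ : Λ.transpose = -Λ)
    {D : Type*} [DivisionRing D] [Algebra (Coeff K) D] {φ ψ : QTorus K Λ →ₐ[Coeff K] D}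
    (h : ∀ i, φ (mono K Λ (Pi.single i 1)) = ψ (mono K Λ (Pi.single i 1))) : φ = ψ := by
  refine AlgHom.toLinearMap_injective (torus_hom_ext fun c => ?_)
  have h2 : (∑ i, c i • (Pi.single i 1 : Fin m → ℤ)) = c := by
    funext j
    simp [Finset.sum_apply, Pi.single_apply]
  have h1 := congrArg (fun x => (LaurentPolynomial.T (-∑ i, ∑ j ∈ Finset.Iio i,
    form Λ (c j • Pi.single j 1) (c i • Pi.single i 1)) : Coeff K) • x)
      (prod_ofFn_mono (K := K) (Λ := Λ) fun i => c i • Pi.single i 1)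
  simp only [T_smul_cancel, h2] at h1
  have h3 : (⇑φ ∘ fun i => mono K Λ (c i • Pi.single i 1)) =
      ⇑ψ ∘ fun i => mono K Λ (c i • Pi.single i 1) := by
    funext i
    simp only [Function.comp_apply, map_mono_smul hΛ, h]
  simp only [AlgHom.toLinearMap_apply]
  rw [← h1, map_smul, map_smul, map_list_prod, map_list_prod, List.map_ofFn, List.map_ofFn, h3]

/-! ### Detecting degrees by powers of `q^{1/2}`. -/

section Twist

variable {m : ℕ} {Λ : Matrix (Fin m) (Fin m) ℤ}

/-- The homomorphism which multiplies monomials by powers of `q^{1/2}` according to a grading. -/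
noncomputable def twist {D : Type*} [Ring D] [Algebra (Coeff K) D] (f : (Fin m → ℤ) →+ ℤ)
    (ι : QTorus K Λ →ₐ[Coeff K] D) : QTorus K Λ →ₐ[Coeff K] D :=
  monoHom (fun c => (LaurentPolynomial.T (f c) : Coeff K) • ι (mono K Λ c))
    (by simp [← one_eq_mono])
    (fun c c' => by
      rw [smul_mul_smul_comm, ← map_mul, mono_mul_mono, map_smul, smul_smul, smul_smul,
        ← LaurentPolynomial.T_add, map_add, mul_comm])

theorem twist_mono {D : Type*} [Ring D] [Algebra (Coeff K) D] (f : (Fin m → ℤ) →+ ℤ)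
    (ι : QTorus K Λ →ₐ[Coeff K] D) (c : Fin m → ℤ) :
    twist f ι (mono K Λ c) = (LaurentPolynomial.T (f c) : Coeff K) • ι (mono K Λ c) :=
  monoHom_mono _ _ _ c

theorem coeffAt_twist (f : (Fin m → ℤ) →+ ℤ) (x : QTorus K Λ) (c : Fin m → ℤ) :
    coeffAt (twist f (AlgHom.id _ _) x) c = LaurentPolynomial.T (f c) * coeffAt x c := by
  conv_lhs => rw [eq_sum x]
  simp only [map_sum, map_smul, coeffAt_sum, coeffAt_smul, twist_mono, AlgHom.id_apply,
    coeffAt_mono]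
  by_cases h : coeffAt x c = 0 <;> simp [mem_supp, h, mul_comm]

/-- The extension of `twist` to the skew field of fractions. -/
noncomputable def twistFrac (f : (Fin m → ℤ) →+ ℤ) : QFrac K Λ →ₐ[Coeff K] QFrac K Λ :=
  -- The twist multiplies each coefficient by a unit, so denominators stay nonzero.
  have hne : ∀ s : (QTorus K Λ)⁰, toQFracAlg K Λ (twist f (AlgHom.id _ _) s.1) ≠ 0 := by
    intro s h0
    rw [map_eq_zero_iff _ toQFracAlg_injective] at h0
    refine nonZeroDivisors.ne_zero s.2 (torus_ext fun c => ?_)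
    have h1 := congrArg (fun x => coeffAt x c) h0
    simp only [coeffAt_twist, coeffAt_zero] at h1
    rw [coeffAt_zero]
    exact (mul_eq_zero.1 h1).resolve_left (T_ne_zero _)
  let fS : (QTorus K Λ)⁰ →* (QFrac K Λ)ˣ :=
    { toFun := fun s => Units.mk0 _ (hne s)
      map_one' := Units.ext (by simp)
      map_mul' := fun s t => Units.ext (by simp) }
  have hfS : ∀ s : (QTorus K Λ)⁰,
      ((toQFracAlg K Λ).comp (twist f (AlgHom.id _ _))).toRingHom s = fS s := fun _ => rfl
  { OreLocalization.universalHom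
      ((toQFracAlg K Λ).comp (twist f (AlgHom.id _ _))).toRingHom fS hfS with
    commutes' := fun c =>
      (OreLocalization.universalHom_commutes _ fS hfS (r := algebraMap (Coeff K) _ c)).trans
        (AlgHom.commutes ((toQFracAlg K Λ).comp (twist f (AlgHom.id _ _))) c) }

theorem twistFrac_toQFracAlg (f : (Fin m → ℤ) →+ ℤ) (b : QTorus K Λ) :
    twistFrac f (toQFracAlg K Λ b) = toQFracAlg K Λ (twist f (AlgHom.id _ _) b) :=
  OreLocalization.universalHom_commutes _ _ _

/-- Distinct powers of `q^{1/2}` are distinct eigenvalues, so an eigenvector is homogeneous.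
Homogeneity can thus be followed through mutations in the skew field, where degrees are not
available. -/
theorem comp_eq_of_twist_eq {f : (Fin m → ℤ) →+ ℤ} {b : QTorus K Λ} {N : ℤ}
    (h : twist f (AlgHom.id _ _) b = (LaurentPolynomial.T N : Coeff K) • b) (M : ℤ) :
    comp f M b = if M = N then b else 0 := by
  have h1 : ∀ c, coeffAt b c ≠ 0 → f c = N := by
    intro c hcb
    have h2 := congrArg (fun x => coeffAt x c) h
    simp only [coeffAt_twist, coeffAt_smul] at h2
    have h3 := mul_right_cancel₀ hcb h2
    exact AddMonoidAlgebra.single_left_injective (one_ne_zero (α := K)) h3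
  refine torus_ext fun c => ?_
  by_cases hb : coeffAt b c = 0
  · rw [coeffAt_comp, hb]
    split_ifs <;> simp [hb, coeffAt_zero]
  · rw [coeffAt_comp, h1 c hb]
    by_cases hMN : M = N
    · rw [if_pos hMN, if_pos hMN.symm]
    · rw [if_neg hMN, if_neg (Ne.symm hMN), coeffAt_zero]

theorem comp_comp_mul (f : (Fin m → ℤ) →+ ℤ) (M N : ℤ) (x y : QTorus K Λ) :
    comp f M (comp f N x * y) = comp f N x * comp f (M - N) y := by
  have key : comp f M ∘ₗ LinearMap.mulRight (Coeff K) y ∘ₗ comp f N =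
      LinearMap.mulRight (Coeff K) (comp f (M - N) y) ∘ₗ comp f N := by
    refine torus_hom_ext fun c => ?_
    change comp f M (comp f N (mono K Λ c) * y) = comp f N (mono K Λ c) * comp f (M - N) y
    rw [comp_mono]
    split_ifs with h
    · rw [comp_mono_mul, h]
    · simp
  exact congrArg (fun φ => φ x) key

end Twist

variable {r n : ℕ} {Λ : Matrix (Fin (r + n)) (Fin (r + n)) ℤ}
  {B : Matrix (Fin (r + n)) (Fin r) ℤ} {d : Fin r → ℤ}

/-- Quantum cluster variables are homogeneous for every grading for which the exchange relations of
the initial seed are homogeneous. -/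
theorem QSeed.Reachable.twistFrac_X (hc : Compat d Λ B) {f : (Fin (r + n) → ℤ) →+ ℤ}
    (hf : ∀ k, f (col k B) = 0) {S : QSeed K Λ} (hS : QSeed.Reachable K Λ B S) :
    ∃ w : (Fin (r + n) → ℤ) →+ ℤ, (∀ k, w (col k S.B) = 0) ∧
      ∀ i, twistFrac f (S.X i) = (LaurentPolynomial.T (w (Pi.single i 1)) : Coeff K) • S.X i := by
  induction hS with
  | init =>
    refine ⟨f, hf, fun i => ?_⟩
    change twistFrac f (toQFracAlg K Λ (mono K Λ _)) = _ • toQFracAlg K Λ (mono K Λ _)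
    rw [twistFrac_toQFracAlg, twist_mono, map_smul]
    rfl
  | step S k hS ih =>
    obtain ⟨w, hw, hX⟩ := ih
    obtain ⟨ι, hι⟩ := hS.exists_isToric hc
    have h1 : (twistFrac f).comp ι = twist w ι := algHom_ext_single hι.compat.skew fun i => by
      rw [AlgHom.comp_apply, twist_mono, hι.map_single, hX]
    have h2 : ∀ c, twistFrac f (ι (mono K S.L c)) =
        (LaurentPolynomial.T (w c) : Coeff K) • ι (mono K S.L c) := fun c => by
      rw [← twist_mono, ← h1, AlgHom.comp_apply]
    -- The weight of the mutated seed is pulled back along `E`: `E` sends `e_k` to the exponent of a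
    -- term of the new variable and fixes the other basis vectors.
    let w' : (Fin (r + n) → ℤ) →+ ℤ := w.comp (Matrix.mulVecLin (mutE k S.B)).toAddMonoidHom
    have hw' : ∀ c, w' c = w ((mutE k S.B).mulVec c) := fun c => rfl
    refine ⟨w', fun j => ?_, fun i => ?_⟩
    · rw [hw']
      change w ((mutE k S.B).mulVec (col j (mutateB k S.B))) = 0
      by_cases hjk : j = k
      · subst hjk
        rw [hι.compat.mutE_mulVec_col_mutateB_self, map_neg, hw, neg_zero]
      · rw [hι.compat.mutE_mulVec_col_mutateB hjk, map_add, map_zsmul, hw, hw, smul_zero, add_zero]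
    · rw [hw']
      by_cases hi : i = Fin.castAdd n k
      · subst hi
        have h3 : w (-mutVec n k + posCol k S.B) = w (-mutVec n k + negCol k S.B) := by
          rw [posCol_eq, map_add, map_add, map_add, hw, add_zero]
        have h4 := hι.compat.mutE_mulVec_mutVec k
        rw [mutVec] at h4
        rw [h4, hι.map_exch, exch, map_add, map_add, h2, h2, h3, smul_add]
        rfl
      · have h3 : (S.mutate k).X i = S.X i := Function.update_of_ne hi _ _
        rw [h3, hX, hι.compat.mutE_mulVec_of_eq_zero (Pi.single_eq_of_ne' hi 1)]

/-- The quantum cluster algebra contains the homogeneous components of its elements. -/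
theorem comp_mem_torusClusterAlgebra (hc : Compat d Λ B) {f : (Fin (r + n) → ℤ) →+ ℤ}
    (hf : ∀ k, f (col k B) = 0) {J : Set (Fin n)} {b : QTorus K Λ}
    (hb : b ∈ torusClusterAlgebra K Λ B J) (N : ℤ) :
    comp f N b ∈ torusClusterAlgebra K Λ B J := by
  -- The elements all of whose components lie in the algebra form a subalgebra, so it is enough to
  -- treat generators, which are homogeneous.
  let G : Subalgebra (Coeff K) (QTorus K Λ) :=
    { carrier := {b | b ∈ torusClusterAlgebra K Λ B J ∧
        ∀ N, comp f N b ∈ torusClusterAlgebra K Λ B J}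
      add_mem' := fun ha hb => ⟨add_mem ha.1 hb.1, fun N => by
        rw [map_add]; exact add_mem (ha.2 N) (hb.2 N)⟩
      mul_mem' := fun {a b} ha hb => ⟨mul_mem ha.1 hb.1, fun N => by
        conv in comp f N (a * b) => rw [sum_comp f a, Finset.sum_mul, map_sum]
        refine sum_mem fun M _ => ?_
        rw [comp_comp_mul]
        exact mul_mem (ha.2 M) (hb.2 _)⟩
      algebraMap_mem' := fun c => ⟨Subalgebra.algebraMap_mem _ c, fun N => by
        rw [Algebra.algebraMap_eq_smul_one, map_smul, one_eq_mono, comp_mono]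
        refine Subalgebra.smul_mem _ ?_ _
        split_ifs
        · exact one_mem _
        · exact zero_mem _⟩ }
  have hle : quantumClusterAlgebra K Λ B J ≤ G.map (toQFracAlg K Λ) := by
    refine Algebra.adjoin_le ?_
    rintro y (⟨S, hS, i, rfl⟩ | ⟨j, hj, rfl⟩)
    · have hX : S.X i ∈ quantumClusterAlgebra K Λ B J :=
        Algebra.subset_adjoin (Or.inl ⟨S, hS, i, rfl⟩)
      obtain ⟨b, hb, he⟩ := exists_toQFrac_eq hc hX
      obtain ⟨w, -, hw⟩ := hS.twistFrac_X hc hf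
      have h1 := hw i
      rw [← he, twistFrac_toQFracAlg, ← map_smul] at h1
      refine ⟨b, ⟨hb, fun N => ?_⟩, he⟩
      rw [comp_eq_of_twist_eq (toQFracAlg_injective h1)]
      split_ifs
      · exact hb
      · exact zero_mem _
    · have hinv : ((QSeed.initial K Λ B).X (Fin.natAdd r j))⁻¹ ∈ quantumClusterAlgebra K Λ B J :=
        Algebra.subset_adjoin (Or.inr ⟨j, hj, rfl⟩)
      rw [(QSeed.IsToric.initial hc).inv_X] at hinv ⊢
      refine ⟨_, ⟨hinv, fun N => ?_⟩, rfl⟩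
      change comp f N (mono K Λ _) ∈ _
      rw [comp_mono]
      split_ifs
      · exact hinv
      · exact zero_mem _
  obtain ⟨b', hb', he⟩ := hle hb
  rw [← toQFracAlg_injective he]
  exact hb'.2 N

end Grading

section ClassicalGrading

/-! ### Gradings of the cluster algebra -/

/-- A cluster grading is not required to put `1` in degree `0`. The degree `0` component of `1` acts
as the identity on homogeneous elements, by comparing degrees in `a = a · 1`, hence it equals `1`.
-/
theorem one_mem_of_decomposition {k A : Type*} [CommRing k] [CommRing A] [Algebra k A]
    (𝒜 : ℤ → Submodule k A) [DirectSum.Decomposition 𝒜]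
    (hmul : ∀ (g h : ℤ) (a b : A), a ∈ 𝒜 g → b ∈ 𝒜 h → a * b ∈ 𝒜 (g + h)) : (1 : A) ∈ 𝒜 0 := by
  classical
  set e : A := ↑(DirectSum.decompose 𝒜 (1 : A) 0) with he
  have hhom : ∀ g, ∀ a ∈ 𝒜 g, a * e = a := by
    intro g a ha
    have h1 : a = ∑ h ∈ (DirectSum.decompose 𝒜 (1 : A)).support,
        a * (DirectSum.decompose 𝒜 (1 : A) h : A) := by
      rw [← Finset.mul_sum, DirectSum.sum_support_decompose, mul_one]
    have h2 := congrArg (fun x => (DirectSum.decompose 𝒜 x g : A)) h1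
    simp only [DirectSum.decompose_of_mem_same 𝒜 ha, DirectSum.decompose_sum, DirectSum.sum_apply,
      AddSubmonoidClass.coe_finsetSum] at h2
    rw [Finset.sum_eq_single 0] at h2
    · have h3 := hmul g 0 a e ha (SetLike.coe_mem _)
      rw [add_zero] at h3
      exact (h2.trans (DirectSum.decompose_of_mem_same 𝒜 h3)).symm
    · intro h _ hne
      exact DirectSum.decompose_of_mem_ne 𝒜 (hmul g h a _ ha (SetLike.coe_mem _)) (by omega)
    · intro h0
      rw [DFinsupp.notMem_support_iff] at h0
      rw [h0]
      simp
  have hall : ∀ a, a * e = a := by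
    intro a
    conv_rhs => rw [← DirectSum.sum_support_decompose 𝒜 a]
    conv_lhs => rw [← DirectSum.sum_support_decompose 𝒜 a]
    rw [Finset.sum_mul]
    exact Finset.sum_congr rfl fun g _ => hhom g _ (SetLike.coe_mem _)
  rw [← hall 1, one_mul]
  exact SetLike.coe_mem _

variable {K : Type*} [Field K] {r n : ℕ} {B : Matrix (Fin (r + n)) (Fin r) ℤ} {J : Set (Fin n)}

theorem IsClusterGrading.gradedMonoid {𝒜 : ℤ → Submodule K (clusterAlgebra K B J)}
    (h : IsClusterGrading K B J 𝒜) : SetLike.GradedMonoid 𝒜 where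
  one_mem := by
    let _ := h.isInternal.chooseDecomposition
    exact one_mem_of_decomposition 𝒜 h.mul_mem
  mul_mem _ _ _ _ ha hb := h.mul_mem _ _ _ _ ha hb

variable (K B J) in
/-- The initial cluster variables as elements of the cluster algebra. -/
noncomputable def initialVar (i : Fin (r + n)) : clusterAlgebra K B J :=
  ⟨(Seed.initial K B).x i, Algebra.subset_adjoin (Or.inl ⟨_, .init, i, rfl⟩)⟩

variable (K B J) in
/-- The monomials in the initial cluster variables as elements of the cluster algebra. -/
noncomputable def initialMono (c : Fin (r + n) → ℕ) : clusterAlgebra K B J :=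
  ∏ i, initialVar K B J i ^ c i

theorem coe_initialMono (c : Fin (r + n) → ℕ) :
    (initialMono K B J c : CFrac K (r + n)) = algebraMap _ _ (cmono K fun i => (c i : ℤ)) := by
  rw [initialMono, ← prod_initial_zpow B]
  simp [initialVar]

theorem cmono_ne_zero {m : ℕ} (c : Fin m → ℤ) : cmono K c ≠ 0 := by
  simp [cmono]

theorem initialMono_ne_zero (c : Fin (r + n) → ℕ) : initialMono K B J c ≠ 0 := by
  intro h
  have h1 := coe_initialMono (K := K) (B := B) (J := J) c
  rw [h, ZeroMemClass.coe_zero, eq_comm, FaithfulSMul.algebraMap_eq_zero_iff] at h1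
  exact cmono_ne_zero _ h1

/-- The degrees of the initial variables extend additively to exponents. The functional vanishes on
each column because the product in an initial exchange relation is homogeneous, which forces its two
monomials to have equal degree. -/
theorem IsClusterGrading.exists_degree [CharZero K]
    {𝒜 : ℤ → Submodule K (clusterAlgebra K B J)}
    (h : IsClusterGrading K B J 𝒜) : ∃ f : (Fin (r + n) → ℤ) →+ ℤ,
      (∀ c : Fin (r + n) → ℕ, initialMono K B J c ∈ 𝒜 (f fun i => (c i : ℤ))) ∧
      ∀ k, f (col k B) = 0 := by
  have := h.gradedMonoid
  let _ := h.isInternal.chooseDecomposition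
  have h1 : ∀ i, ∃ g, initialVar K B J i ∈ 𝒜 g := fun i => h.homogeneous _ ⟨_, .init, i, rfl⟩
  choose g hg using h1
  let f : (Fin (r + n) → ℤ) →+ ℤ := ∑ i, g i • Pi.evalAddMonoidHom (fun _ => ℤ) i
  have hf : ∀ c : Fin (r + n) → ℕ, initialMono K B J c ∈ 𝒜 (f fun i => (c i : ℤ)) := by
    intro c
    have h2 := SetLike.prod_pow_mem_graded 𝒜 g (initialVar K B J) c (F := Finset.univ)
      fun i _ => hg i
    have h3 : (f fun i => (c i : ℤ)) = ∑ i, c i • g i := by simp [f, mul_comm]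
    rwa [h3]
  refine ⟨f, hf, fun k => ?_⟩
  let x' : clusterAlgebra K B J := ⟨((Seed.initial K B).mutate k).x (Fin.castAdd n k),
    Algebra.subset_adjoin (Or.inl ⟨_, .step _ k .init, _, rfl⟩)⟩
  obtain ⟨g', hg'⟩ := h.homogeneous x' ⟨_, .step _ k .init, _, rfl⟩
  have hpos : (fun i => ((posCol k B i).toNat : ℤ)) = posCol k B :=
    funext fun i => Int.toNat_of_nonneg (le_max_right _ _)
  have hneg : (fun i => ((negCol k B i).toNat : ℤ)) = negCol k B :=
    funext fun i => Int.toNat_of_nonneg (le_max_right _ _)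
  have hP := hf fun i => (posCol k B i).toNat
  have hN := hf fun i => (negCol k B i).toNat
  rw [hpos] at hP
  rw [hneg] at hN
  have hrel : initialVar K B J (Fin.castAdd n k) * x' =
      initialMono K B J (fun i => (posCol k B i).toNat) +
        initialMono K B J (fun i => (negCol k B i).toNat) := by
    refine Subtype.ext ?_
    rw [MulMemClass.coe_mul, AddMemClass.coe_add, coe_initialMono, coe_initialMono, hpos, hneg,
      ← prod_initial_zpow B, ← prod_initial_zpow B]
    have h3 : (x' : CFrac K (r + n)) = _ := Function.update_self _ _ _
    rw [h3]
    exact mul_div_cancel₀ _ ((Seed.Reachable.init (B := B)).isPositive _).ne_zero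
  have hmem := h.mul_mem _ _ _ _ (hg (Fin.castAdd n k)) hg'
  rw [hrel] at hmem
  have hkey : f (posCol k B) = f (negCol k B) := by
    by_contra hne
    -- If the two monomials had different degrees, one of them would be a component of the product
    -- in a degree where the product has none.
    by_cases hs : g (Fin.castAdd n k) + g' = f (posCol k B)
    · rw [hs] at hmem
      have h4 := DirectSum.decompose_of_mem_ne 𝒜 hmem hne
      rw [DirectSum.decompose_add, DirectSum.add_apply, Submodule.coe_add,
        DirectSum.decompose_of_mem_ne 𝒜 hP hne, DirectSum.decompose_of_mem_same 𝒜 hN,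
        zero_add] at h4
      exact initialMono_ne_zero _ h4
    · have h4 := DirectSum.decompose_of_mem_ne 𝒜 hmem hs
      rw [DirectSum.decompose_add, DirectSum.add_apply, Submodule.coe_add,
        DirectSum.decompose_of_mem_same 𝒜 hP, DirectSum.decompose_of_mem_ne 𝒜 hN (Ne.symm hne),
        add_zero] at h4
      exact initialMono_ne_zero _ h4
  rw [← posCol_sub_negCol, map_sub, hkey, sub_self]

/-- A monomial multiple of `z` is a combination of initial monomials, whose degrees are known. Since
the cluster algebra is a domain, any component of `z` in another degree must vanish. -/
theorem IsClusterGrading.mem_of_degree 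
    {𝒜 : ℤ → Submodule K (clusterAlgebra K B J)}
    (h : IsClusterGrading K B J 𝒜) {f : (Fin (r + n) → ℤ) →+ ℤ}
    (hf : ∀ c : Fin (r + n) → ℕ, initialMono K B J c ∈ 𝒜 (f fun i => (c i : ℤ))) {N : ℤ}
    {t : CTorus K (r + n)} (ht : ∀ c, t.coeff c ≠ 0 → f c = N)
    {z : clusterAlgebra K B J} (hz : (z : CFrac K (r + n)) = algebraMap _ _ t) : z ∈ 𝒜 N := by
  classical
  have := h.gradedMonoid
  let _ := h.isInternal.chooseDecomposition
  let _ : GradedRing 𝒜 := { }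
  obtain ⟨u, hu⟩ : ∃ u : Fin (r + n) → ℕ, ∀ c ∈ t.coeff.support, ∀ i, 0 ≤ (u i : ℤ) + c i := by
    refine ⟨fun i => ∑ c ∈ t.coeff.support, (c i).natAbs, fun c hc i => ?_⟩
    have := Finset.single_le_sum (f := fun c : Fin (r + n) → ℤ => (c i).natAbs)
      (fun _ _ => Nat.zero_le _) hc
    beta_reduce
    omega
  have hprod : initialMono K B J u * z = ∑ c ∈ t.coeff.support,
      t.coeff c • initialMono K B J (fun i => ((u i : ℤ) + c i).toNat) := by
    refine Subtype.ext ?_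
    have h1 : t = ∑ c ∈ t.coeff.support, t.coeff c • cmono K c := by
      refine AddMonoidAlgebra.ext (Finsupp.ext fun a => ?_)
      simp [cmono, Finsupp.single_apply]
    rw [MulMemClass.coe_mul, hz, coe_initialMono, ← map_mul]
    conv_lhs => rw [h1]
    rw [AddSubmonoidClass.coe_finsetSum, Finset.mul_sum, map_sum]
    refine Finset.sum_congr rfl fun c hc => ?_
    rw [SetLike.val_smul, coe_initialMono, mul_smul_comm, cmono_mul,
      ← IsScalarTower.coe_toAlgHom' K, map_smul]
    congr 3
    funext i
    exact (Int.toNat_of_nonneg (hu c hc i)).symm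
  have hmem : initialMono K B J u * z ∈ 𝒜 ((f fun i => (u i : ℤ)) + N) := by
    rw [hprod]
    refine sum_mem fun c hc => Submodule.smul_mem _ _ ?_
    have h2 := hf fun i => ((u i : ℤ) + c i).toNat
    have h3 : (fun i => (((u i : ℤ) + c i).toNat : ℤ)) = (fun i => (u i : ℤ)) + c :=
      funext fun i => Int.toNat_of_nonneg (hu c hc i)
    rwa [h3, map_add, ht c (Finsupp.mem_support_iff.1 hc)] at h2
  rw [← DirectSum.sum_support_decompose 𝒜 z]
  refine sum_mem fun i _ => ?_
  by_cases hi : i = N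
  · rw [hi]
    exact SetLike.coe_mem _
  · have h4 := DirectSum.coe_decompose_mul_add_of_left_mem 𝒜 (j := i) (b := z) (hf u)
    rw [DirectSum.decompose_of_mem_ne 𝒜 hmem (by omega), eq_comm, mul_eq_zero] at h4
    rw [h4.resolve_left (initialMono_ne_zero u)]
    exact zero_mem _

end ClassicalGrading

section Saturation

/-! ### The quantum cluster algebra is saturated with respect to `q^{1/2} - 1` -/

variable {K : Type*} [Field K]

theorem isNoetherianRing_coeff : IsNoetherianRing (Coeff K) :=
  have := LaurentPolynomial.isLocalization (R := K)
  IsLocalization.isNoetherianRing (Submonoid.powers (Polynomial.X : Polynomial K)) _ inferInstance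

/-- A consequence of Krull's intersection theorem. -/
theorem exists_sub_smul_mem_span {m : ℕ} {Λ : Matrix (Fin m) (Fin m) ℤ} {p : Coeff K}
    (s : Finset (QTorus K Λ)) {y : QTorus K Λ}
    (h : ∀ k : ℕ, ∃ x ∈ Submodule.span (Coeff K) (s : Set (QTorus K Λ)), ∃ z, y = x + p ^ k • z) :
    ∃ a, (1 - p * a) • y ∈ Submodule.span (Coeff K) (s : Set (QTorus K Λ)) := by
  classical
  have := isNoetherianRing_coeff (K := K)
  set N := Submodule.span (Coeff K) (s : Set (QTorus K Λ))
  -- Only finitely many exponents matter. Restricting to them gives a finite free module over a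
  -- noetherian ring, and Krull's theorem applies to its quotient `Q`.
  let E : Finset (Fin m → ℤ) := supp y ∪ s.biUnion supp
  let π : QTorus K Λ →ₗ[Coeff K] (E → Coeff K) :=
    { toFun := fun x c => coeffAt x c
      map_add' := fun x y => funext fun c => coeffAt_add x y c
      map_smul' := fun a x => funext fun c => coeffAt_smul a x c }
  let Q := (E → Coeff K) ⧸ N.map π
  have hy : ∀ c ∉ E, coeffAt y c = 0 := by
    intro c hc
    by_contra h0
    exact hc (Finset.mem_union_left _ (mem_supp.2 h0))
  have hN : ∀ x ∈ N, ∀ c ∉ E, coeffAt x c = 0 := by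
    intro x hx c hc
    induction hx using Submodule.span_induction with
    | mem x hx =>
      by_contra h0
      exact hc (Finset.mem_union_right _ (Finset.mem_biUnion.2 ⟨x, hx, mem_supp.2 h0⟩))
    | zero => exact coeffAt_zero c
    | add x x' _ _ hx hx' => rw [coeffAt_add, hx, hx', add_zero]
    | smul a x _ hx => rw [coeffAt_smul, hx, mul_zero]
  have hmem : ((N.map π).mkQ (π y) : Q) ∈
      (⨅ i : ℕ, Ideal.span {p} ^ i • ⊤ : Submodule (Coeff K) Q) := by
    rw [Submodule.mem_iInf]
    intro k
    obtain ⟨x, hx, z, rfl⟩ := h k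
    have h1 : (N.map π).mkQ (π x) = 0 :=
      (Submodule.Quotient.mk_eq_zero _).2 (Submodule.mem_map_of_mem hx)
    rw [map_add, map_add, h1, zero_add, map_smul, map_smul]
    exact Submodule.smul_mem_smul (Ideal.pow_mem_pow (Ideal.mem_span_singleton_self p) k) trivial
  rw [Ideal.mem_iInf_smul_pow_eq_bot_iff] at hmem
  obtain ⟨⟨t, ht⟩, hr⟩ := hmem
  obtain ⟨a, rfl⟩ := Ideal.mem_span_singleton'.1 ht
  refine ⟨a, ?_⟩
  have h1 : (N.map π).mkQ (π ((1 - p * a) • y)) = 0 := by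
    rw [map_smul, map_smul, sub_smul, one_smul, mul_comm p a, sub_eq_zero]
    exact hr.symm
  obtain ⟨x, hx, he⟩ := (Submodule.Quotient.mk_eq_zero _).1 h1
  -- Both sides are supported in `E`, where the restriction map loses nothing.
  suffices x = (1 - p * a) • y from this ▸ hx
  refine torus_ext fun c => ?_
  by_cases hc : c ∈ E
  · exact congrFun he ⟨c, hc⟩
  · rw [hN x hx c hc, coeffAt_smul, hy c hc, mul_zero]

theorem exists_mem_span_map_eq {m : ℕ} {Λ : Matrix (Fin m) (Fin m) ℤ} {s : Set (QTorus K Λ)}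
    {z : CFrac K m} (hz : z ∈ Submodule.span K (specFrac K Λ '' s)) :
    ∃ x ∈ Submodule.span (Coeff K) s, specFrac K Λ x = z := by
  induction hz using Submodule.span_induction with
  | mem z hz =>
    obtain ⟨x, hx, rfl⟩ := hz
    exact ⟨x, Submodule.subset_span hx, rfl⟩
  | zero => exact ⟨0, zero_mem _, map_zero _⟩
  | add z z' _ _ hz hz' =>
    obtain ⟨x, hx, rfl⟩ := hz
    obtain ⟨x', hx', rfl⟩ := hz'
    exact ⟨x + x', add_mem hx hx', map_add _ _ _⟩
  | smul a z _ hz =>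
    obtain ⟨x, hx, rfl⟩ := hz
    exact ⟨LaurentPolynomial.C a • x, Submodule.smul_mem _ _ hx,
      by rw [map_smul, smul_CFrac, evalOne_C]⟩

theorem exists_sub_eq_uniformizer_smul {m : ℕ} {Λ : Matrix (Fin m) (Fin m) ℤ} {x y : QTorus K Λ}
    (h : specFrac K Λ x = specFrac K Λ y) : ∃ z, x = y + uniformizer K • z := by
  obtain ⟨z, hz⟩ := exists_eq_uniformizer_smul (x := x - y)
    (specFrac_eq_zero_iff.1 (by rw [map_sub, h, sub_self]))
  exact ⟨z, by rw [← hz, add_sub_cancel]⟩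

theorem specFrac_uniformizer_smul {m : ℕ} {Λ : Matrix (Fin m) (Fin m) ℤ} (x : QTorus K Λ) :
    specFrac K Λ (uniformizer K • x) = 0 := by
  rw [specFrac_eq_zero_iff, spec_uniformizer_smul]

variable [CharZero K] {r n : ℕ} {Λ : Matrix (Fin (r + n)) (Fin (r + n)) ℤ}
  {B : Matrix (Fin (r + n)) (Fin r) ℤ} {d : Fin r → ℤ} {J : Set (Fin n)}
  {𝒜 : ℤ → Submodule K (clusterAlgebra K B J)} {f : (Fin (r + n) → ℤ) →+ ℤ}

/-- The degree `N` part of the quantum cluster algebra specializes into the finite-dimensional piece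
`𝒜 N`. A finite spanning set can be chosen among the specializations themselves, so it lifts. -/
theorem exists_finset_lift (hc : Compat d Λ B)
    (hupper : clusterAlgebra K B J = upperClusterAlgebra K B J) (h : IsClusterGrading K B J 𝒜)
    (hfin : ∀ g, FiniteDimensional K (𝒜 g))
    (hf : ∀ c : Fin (r + n) → ℕ, initialMono K B J c ∈ 𝒜 (f fun i => (c i : ℤ))) (N : ℤ) :
    ∃ s : Finset (QTorus K Λ), (∀ x ∈ s, x ∈ torusClusterAlgebra K Λ B J ∧ comp f N x = x) ∧
      ∀ x ∈ torusClusterAlgebra K Λ B J, comp f N x = x →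
        specFrac K Λ x ∈ Submodule.span K (specFrac K Λ '' (s : Set (QTorus K Λ))) := by
  classical
  let V : Set (QTorus K Λ) := {x | x ∈ torusClusterAlgebra K Λ B J ∧ comp f N x = x}
  have hle : Submodule.span K (specFrac K Λ '' V) ≤
      (𝒜 N).map (clusterAlgebra K B J).val.toLinearMap := by
    rw [Submodule.span_le]
    rintro _ ⟨x, ⟨hx, hxN⟩, rfl⟩
    refine ⟨⟨_, specFrac_mem hc hupper (mem_quantumUpper_of_mem hc hx)⟩,
      h.mem_of_degree hf (t := spec K Λ x) (fun c hcx => ?_) rfl, rfl⟩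
    by_contra hne
    refine hcx ?_
    rw [coeff_spec, ← hxN, coeffAt_comp, if_neg hne, map_zero]
  have hfg : (Submodule.span K (specFrac K Λ '' V)).FG := by
    have := hfin N
    exact Module.Finite.iff_fg.1 (Submodule.finiteDimensional_of_le hle)
  obtain ⟨s', hs', he⟩ := Submodule.fg_span_iff_fg_span_finset_subset _ |>.1 hfg
  obtain ⟨s, hs, rfl⟩ := Finset.subset_set_image_iff.1 hs'
  refine ⟨s, fun x hx => hs hx, fun x hx hxN => ?_⟩
  rw [Finset.coe_image] at he
  rw [← he]
  exact Submodule.subset_span ⟨x, ⟨hx, hxN⟩, rfl⟩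

/-- A homogeneous element lies in the quantum cluster algebra when its multiple by `q^{1/2} - 1`
does. -/
theorem mem_of_uniformizer_smul_mem_of_comp_eq (hc : Compat d Λ B)
    (hupper : clusterAlgebra K B J = upperClusterAlgebra K B J) (h : IsClusterGrading K B J 𝒜)
    (hfin : ∀ g, FiniteDimensional K (𝒜 g))
    (hf : ∀ c : Fin (r + n) → ℕ, initialMono K B J c ∈ 𝒜 (f fun i => (c i : ℤ)))
    (hcol : ∀ k, f (col k B) = 0) {N : ℤ} {y : QTorus K Λ} (hyN : comp f N y = y)
    (hy : uniformizer K • y ∈ torusClusterAlgebra K Λ B J) :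
    y ∈ torusClusterAlgebra K Λ B J := by
  obtain ⟨s, hs, hspan⟩ := exists_finset_lift hc hupper h hfin hf N
  have hsT : Submodule.span (Coeff K) (s : Set (QTorus K Λ)) ≤
      Subalgebra.toSubmodule (torusClusterAlgebra K Λ B J) :=
    Submodule.span_le.2 fun x hx => (hs x hx).1
  have hsN : ∀ x ∈ Submodule.span (Coeff K) (s : Set (QTorus K Λ)), comp f N x = x := by
    intro x hx
    exact LinearMap.mem_eqLocus.1 (Submodule.span_le
      (p := LinearMap.eqLocus (comp f N) LinearMap.id) |>.2 (fun x hx => (hs x hx).2) hx)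
  -- One step of successive approximation. By saturation of the quantum upper algebra and `A = U`,
  -- `y` agrees modulo `p` with some `b` in the algebra. Its degree `N` part may replace `b`, and
  -- can then be traded for an element of the span.
  have hstep : ∀ y, comp f N y = y → (∃ k, uniformizer K ^ k • y ∈ torusClusterAlgebra K Λ B J) →
      ∃ x ∈ Submodule.span (Coeff K) (s : Set (QTorus K Λ)), ∃ z, y = x + uniformizer K • z ∧
        comp f N z = z ∧ ∃ k, uniformizer K ^ k • z ∈ torusClusterAlgebra K Λ B J := by
    rintro y hyN ⟨k, hk⟩
    obtain ⟨b, hb, he⟩ := exists_specFrac_eq hc (specFrac_mem hc hupper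
      (mem_quantumUpper_of_uniformizer_pow_smul hc k (mem_quantumUpper_of_mem hc hk)))
    obtain ⟨w, rfl⟩ := exists_sub_eq_uniformizer_smul he
    have h1 := hspan _ (comp_mem_torusClusterAlgebra hc hcol hb N)
      (by rw [comp_comp_self, if_pos rfl])
    rw [map_add, hyN, map_smul, map_add, specFrac_uniformizer_smul, add_zero] at h1
    obtain ⟨x, hx, hxy⟩ := exists_mem_span_map_eq h1
    obtain ⟨z, rfl⟩ := exists_sub_eq_uniformizer_smul hxy.symm
    refine ⟨x, hx, z, rfl, ?_, k + 1, ?_⟩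
    · rw [map_add, hsN x hx, map_smul] at hyN
      exact uniformizer_smul_injective (add_left_cancel hyN)
    · rw [smul_add, smul_smul, ← pow_succ] at hk
      exact ((Subalgebra.toSubmodule (torusClusterAlgebra K Λ B J)).add_mem_iff_right
        (Submodule.smul_mem _ _ (hsT hx))).1 hk
  -- The span does not depend on the step, so iteration places `y` in it modulo every power of `p`.
  have hiter : ∀ k : ℕ, ∃ x ∈ Submodule.span (Coeff K) (s : Set (QTorus K Λ)), ∃ z,
      y = x + uniformizer K ^ k • z ∧ comp f N z = z ∧
        ∃ k, uniformizer K ^ k • z ∈ torusClusterAlgebra K Λ B J := by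
    intro k
    induction k with
    | zero => exact ⟨0, zero_mem _, y, by simp, hyN, 1, by rwa [pow_one]⟩
    | succ k ih =>
      obtain ⟨x, hx, z, hxz, hzN, hz⟩ := ih
      obtain ⟨x', hx', z', rfl, hz'⟩ := hstep z hzN hz
      refine ⟨x + uniformizer K ^ k • x', add_mem hx (Submodule.smul_mem _ _ hx'), z', ?_, hz'⟩
      rw [hxz, smul_add, smul_smul, ← pow_succ, add_assoc]
  obtain ⟨a, ha⟩ := exists_sub_smul_mem_span s fun k => by
    obtain ⟨x, hx, z, hxz, -⟩ := hiter k
    exact ⟨x, hx, z, hxz⟩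
  -- `y = (1 - p a) y + a (p y)`, and both summands lie in the algebra.
  have h1 := add_mem (hsT ha) (Submodule.smul_mem
    (Subalgebra.toSubmodule (torusClusterAlgebra K Λ B J)) a hy)
  rwa [smul_smul, ← add_smul, mul_comm a, sub_add_cancel, one_smul] at h1

theorem mem_of_uniformizer_smul_mem (hc : Compat d Λ B)
    (hupper : clusterAlgebra K B J = upperClusterAlgebra K B J) (h : IsClusterGrading K B J 𝒜)
    (hfin : ∀ g, FiniteDimensional K (𝒜 g)) {y : QTorus K Λ}
    (hy : uniformizer K • y ∈ torusClusterAlgebra K Λ B J) :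
    y ∈ torusClusterAlgebra K Λ B J := by
  obtain ⟨f, hf, hcol⟩ := h.exists_degree
  refine mem_of_comp f (N := Subalgebra.toSubmodule (torusClusterAlgebra K Λ B J)) fun N => ?_
  refine mem_of_uniformizer_smul_mem_of_comp_eq hc hupper h hfin hf hcol (N := N)
    (by rw [comp_comp_self, if_pos rfl]) ?_
  rw [← map_smul]
  exact comp_mem_torusClusterAlgebra hc hcol hy N

end Saturation

section BaseChange

/-! ### Base change to `q = 1` -/

variable {K : Type*} [Field K]

theorem exists_one_tmul_eq {A : Type*} [Ring A] [Algebra (Coeff K) A]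
    (z : CoeffOne K ⊗[Coeff K] A) : ∃ a, 1 ⊗ₜ[Coeff K] a = z := by
  induction z with
  | zero => exact ⟨0, TensorProduct.tmul_zero _ _⟩
  | tmul c a =>
    obtain ⟨c, rfl⟩ := Ideal.Quotient.mk_surjective c
    exact ⟨c • a, (TensorProduct.smul_tmul c 1 a).symm.trans
      (congrArg (· ⊗ₜ[Coeff K] a) (Algebra.algebraMap_eq_smul_one c).symm)⟩
  | add z z' hz hz' =>
    obtain ⟨a, rfl⟩ := hz
    obtain ⟨a', rfl⟩ := hz'
    exact ⟨a + a', TensorProduct.tmul_add _ _ _⟩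

/-- A specialization of an algebra at `q = 1` with the expected kernel is its base change. -/
theorem exists_algEquiv_of_specialization {A C : Type*} [Ring A] [Algebra (Coeff K) A] [CommRing C]
    [Algebra K C] (π : A →+* C) (hπ : ∀ (c : Coeff K) a, π (c • a) = evalOne K c • π a)
    (hsurj : Function.Surjective π) (hker : ∀ a, π a = 0 → ∃ b, a = uniformizer K • b) :
    ∃ e : CoeffOne K ⊗[Coeff K] A ≃ₐ[K] C, ∀ a, e (1 ⊗ₜ[Coeff K] a) = π a := by
  let _ : Algebra (Coeff K) C := specAlgebra K C
  have hmap : ∀ c : Coeff K, algebraMap (Coeff K) C c = algebraMap K C (evalOne K c) :=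
    fun _ => rfl
  let π' : A →ₐ[Coeff K] C :=
    { π with
      commutes' := fun c => by
        change π (algebraMap _ _ c) = _
        rw [Algebra.algebraMap_eq_smul_one, hπ, map_one, hmap, Algebra.algebraMap_eq_smul_one] }
  let ε : CoeffOne K →ₐ[Coeff K] C := Ideal.Quotient.liftₐ _ (Algebra.ofId (Coeff K) C) (by
    intro c hc
    obtain ⟨c', rfl⟩ := Ideal.mem_span_singleton'.1 hc
    change algebraMap (Coeff K) C (c' * uniformizer K) = 0
    rw [hmap, map_mul, evalOne_uniformizer, mul_zero, map_zero])
  let φ : CoeffOne K ⊗[Coeff K] A →ₐ[Coeff K] C :=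
    Algebra.TensorProduct.lift ε π' fun _ _ => Commute.all _ _
  have hφ : ∀ a, φ (1 ⊗ₜ[Coeff K] a) = π a := fun a => by
    rw [Algebra.TensorProduct.lift_tmul, map_one, one_mul]
    rfl
  let ψ : CoeffOne K ⊗[Coeff K] A →ₐ[K] C :=
    { φ.toRingHom with
      commutes' := fun k => by
        change φ (algebraMap K (CoeffOne K) k ⊗ₜ[Coeff K] 1) = _
        rw [Algebra.TensorProduct.lift_tmul, map_one, mul_one]
        change algebraMap (Coeff K) C (LaurentPolynomial.C k) = _
        rw [hmap, evalOne_C] }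
  have hψ : ∀ a, ψ (1 ⊗ₜ[Coeff K] a) = π a := hφ
  refine ⟨AlgEquiv.ofBijective ψ ⟨?_, fun c => ?_⟩, hψ⟩
  · rw [injective_iff_map_eq_zero]
    intro z hz
    obtain ⟨a, rfl⟩ := exists_one_tmul_eq z
    obtain ⟨b, rfl⟩ := hker a ((hψ a).symm.trans hz)
    have h0 : uniformizer K • (1 : CoeffOne K) = 0 :=
      (Algebra.algebraMap_eq_smul_one _).symm.trans
        (Ideal.Quotient.eq_zero_iff_mem.2 (Ideal.mem_span_singleton_self _))
    rw [← TensorProduct.smul_tmul, h0, TensorProduct.zero_tmul]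
  · obtain ⟨a, rfl⟩ := hsurj c
    exact ⟨_, hψ a⟩

theorem spec_surjective {m : ℕ} {Λ : Matrix (Fin m) (Fin m) ℤ} :
    Function.Surjective (spec K Λ) := by
  intro t
  induction t using AddMonoidAlgebra.induction_linear with
  | zero => exact ⟨0, map_zero _⟩
  | add t t' ht ht' =>
    obtain ⟨x, rfl⟩ := ht
    obtain ⟨x', rfl⟩ := ht'
    exact ⟨x + x', map_add _ _ _⟩
  | single c a =>
    refine ⟨LaurentPolynomial.C a • mono K Λ c, ?_⟩
    rw [map_smul, spec_mono, smul_CTorus, evalOne_C, cmono, AddMonoidAlgebra.smul_single,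
      smul_eq_mul, mul_one]

variable {r n : ℕ} {Λ : Matrix (Fin (r + n)) (Fin (r + n)) ℤ}
  {B : Matrix (Fin (r + n)) (Fin r) ℤ} {d : Fin r → ℤ} {J : Set (Fin n)}

/-- The inclusion of the quantum cluster algebra in the initial quantum torus. -/
theorem exists_inclusion (hc : Compat d Λ B) :
    ∃ i : quantumClusterAlgebra K Λ B J →ₐ[Coeff K] QTorus K Λ, ∀ a, toQFracAlg K Λ (i a) = a := by
  let j : (torusClusterAlgebra K Λ B J) →ₐ[Coeff K] quantumClusterAlgebra K Λ B J :=
    ((toQFracAlg K Λ).comp (torusClusterAlgebra K Λ B J).val).codRestrict _ fun b => b.2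
  have hj : Function.Bijective j := by
    refine ⟨fun b b' h => ?_, fun a => ?_⟩
    · exact Subtype.ext (toQFracAlg_injective (congrArg Subtype.val h))
    · obtain ⟨b, hb, he⟩ := exists_toQFrac_eq hc a.2
      exact ⟨⟨b, hb⟩, Subtype.ext he⟩
  let e := AlgEquiv.ofBijective j hj
  exact ⟨(torusClusterAlgebra K Λ B J).val.comp e.symm.toAlgHom,
    fun a => congrArg Subtype.val (e.apply_symm_apply a)⟩

end BaseChange

end QuantumCluster

/-! ### Assembly of the isomorphism. -/

theorem theorem5p1 {K : Type*} [Field K] [CharZero K] {r n : ℕ}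
    (Λ : Matrix (Fin (r + n)) (Fin (r + n)) ℤ) (B : Matrix (Fin (r + n)) (Fin r) ℤ)
    (J : Set (Fin n))
    (hcomp : IsCompatiblePair Λ B)
    (hupper : clusterAlgebra K B J = upperClusterAlgebra K B J)
    (hgraded : ∃ 𝒜 : ℤ → Submodule K (clusterAlgebra K B J),
      IsClusterGrading K B J 𝒜 ∧ ∀ g, FiniteDimensional K (𝒜 g)) :
    ∃ (i : quantumClusterAlgebra K Λ B J →ₐ[Coeff K] QTorus K Λ)
      (θ : CoeffOne K ⊗[Coeff K] QTorus K Λ ≃ₐ[K] CTorus K (r + n))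
      (e : CoeffOne K ⊗[Coeff K] quantumClusterAlgebra K Λ B J ≃ₐ[K] clusterAlgebra K B J),
      (∀ a, toQFrac K Λ (i a) = a) ∧
      (∀ c, θ (1 ⊗ₜ[Coeff K] mono K Λ c) = cmono K c) ∧
      ∀ z, (e z : CFrac K (r + n)) =
        algebraMap (CTorus K (r + n)) (CFrac K (r + n))
          (θ (Algebra.TensorProduct.map (AlgHom.id (Coeff K) (CoeffOne K)) i z)) := by
  obtain ⟨d, hc⟩ := hcomp.exists_compat
  obtain ⟨𝒜, h𝒜, hfin⟩ := hgraded
  obtain ⟨i, hi⟩ := exists_inclusion (K := K) (J := J) hc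
  have hmem : ∀ a, i a ∈ torusClusterAlgebra K Λ B J := fun a =>
    mem_torusClusterAlgebra.2 ((hi a).symm ▸ a.2)
  -- `θ` and `e` come from one principle: a surjective specialization whose kernel consists of
  -- multiples of `p` is the base change to `q^{1/2} = 1`.
  obtain ⟨θ, hθ⟩ := exists_algEquiv_of_specialization (spec K Λ).toRingHom
    (fun c x => map_smul (spec K Λ) c x) spec_surjective fun x => exists_eq_uniformizer_smul
  have hspec : ∀ a, specFrac K Λ (i a) ∈ clusterAlgebra K B J := fun a =>
    specFrac_mem hc hupper (mem_quantumUpper_of_mem hc (hmem a))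
  obtain ⟨e, he⟩ := exists_algEquiv_of_specialization (K := K) (C := clusterAlgebra K B J)
    (((specFrac K Λ).comp i).toRingHom.codRestrict (clusterAlgebra K B J) hspec)
    (fun c a => Subtype.ext ((map_smul ((specFrac K Λ).comp i) c a).trans (smul_CFrac c _)))
    (fun z => by
      obtain ⟨b, hb, hbz⟩ := exists_specFrac_eq hc z.2
      refine ⟨⟨_, hb⟩, Subtype.ext (Eq.trans ?_ hbz)⟩
      exact congrArg (specFrac K Λ) (toQFracAlg_injective (hi ⟨_, hb⟩)))
    -- An element of the kernel is `p y` with `y` in the torus; saturation puts `y` in the quantum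
    -- cluster algebra. This is where the grading with finite-dimensional components enters.
    (fun a ha => by
      obtain ⟨y, hy⟩ := exists_eq_uniformizer_smul
        (specFrac_eq_zero_iff.1 (congrArg Subtype.val ha))
      have hyT := mem_of_uniformizer_smul_mem hc hupper h𝒜 hfin (hy ▸ hmem a)
      refine ⟨⟨_, mem_torusClusterAlgebra.1 hyT⟩, Subtype.ext ?_⟩
      exact (hi a).symm.trans ((congrArg _ hy).trans (map_smul (toQFracAlg K Λ) _ y)))
  refine ⟨i, θ, e, hi, fun c => (hθ _).trans (spec_mono c), fun z => ?_⟩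
  obtain ⟨a, rfl⟩ := exists_one_tmul_eq z
  rw [he, Algebra.TensorProduct.map_tmul, AlgHom.id_apply, hθ]
  rfl
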